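/- **Setting.** Greek indices run over $1,2$, Latin indices over $1,2,3$, and repeated indices are summed. Write $x=(x^1,x^2)=(z,r)$. Let $D\subset\mathbb R^2$ be a bounded open set on which $r=x^2\ge r_0>0$, with $\partial D=\gamma_0\cup\gamma_1$ (walls $\gamma_0$; inlet and outlet $\gamma_1$, of finite length). Let $\varepsilon>0$ (half the angle between two blades), $\mu>0$, $\omega\in\mathbb R$, $\Omega=D\times(-1,1)\ni(x,\xi)$. For $\Theta\in C^2(\overline D)$ the blade has the middle surface $\theta=\Theta(z,r)$ in cylindrical coordinates, and $\xi=\varepsilon^{-1}(\theta-\Theta)$. With $\Theta_\alpha=\partial_\alpha\Theta$, $\Theta_{\alpha\beta}=\partial_\alpha\partial_\beta\Theta$, the Euclidean metric in the coordinates $(x^1,x^2,\xi)$ is $$g_{\alpha\beta}=\delta_{\alpha\beta}+r^2\Theta_\alpha\Theta_\beta,\quad g_{3\alpha}=\varepsilon r^2\Theta_\alpha,\quad g_{33}=\varepsilon^2r^2,\quad \sqrt g=\varepsilon r,$$ with inverse $g^{ij}$. Let $\nabla$ be its covariant derivative, $e_{ij}(w)=\tfrac12(\nabla_iw_j+\nabla_jw_i)$,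 and $A^{ijkl}=-\tfrac23\mu g^{ij}g^{kl}+\mu(g^{ik}g^{jl}+g^{il}g^{jk})$. Let $V(\Omega)$ be the closure in $H^1(\Omega)^3$ of the smooth fields on $\mathbb R^3$ that vanish near $\gamma_0\times[-1,1]\cup\overline D\times\{\pm1\}$; the dense set of these smooth fields is called $\mathcal V$. The dissipation energy of a velocity field $w\in V(\Omega)$ (contravariant components $w^i$) is $$J(\Theta,w)=\tfrac12\int_\Omega A^{ijkl}e_{kl}(w)e_{ij}(w)\sqrt g\,dx\,d\xi .$$ **Flow problem.** Given a body force $f\in L^2$ and normal stresses $g^i$ on $\gamma_1\times(-1,1)$ (fixed contravariant components), a solution for the surface $\Theta$ is a stationary weak solution, $w\in V(\Omega)$, of the rotating Navier–Stokes equations in these coordinates, $$\int_\Omega\big[A^{ijkl}e_{kl}(w)e_{ij}(v)+g_{km}\big(\rho a^k-f^k\big)v^m-p\,\mathrm{div}\,v\big]\sqrt g\,dx\,d\xi=\int_{\gamma_1\times(-1,1)}g_{km}g^kv^m\,\varepsilon r\,ds\,d\xi\qquad(v\in\mathcal V),$$ $a=(w\cdot\nabla)w+2\vec\omega\times w+\vec\omega\times(\vec\omega\times\vec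 R)$, for one of the following models: (i) incompressible: $\rho=1$, $\mathrm{div}\,w=0$, $p\in L^2(\Omega)$; (ii) compressible: $\mathrm{div}(\rho w)=0$, $\rho c_vw^j\partial_jT-\mathrm{div}(\kappa\nabla T)+p\,\mathrm{div}\,w-A^{ijkl}e_{ij}(w)e_{kl}(w)=h$, both in the sense of distributions on $\Omega$, with $p=p(\rho,T)$, $p\in C^1((0,\infty)^2)$, $c_v,\kappa>0$, $h\in L^1$, $T\in H^1(\Omega)$, and $\rho,T$ bounded and bounded away from $0$; (iii) isentropic: $\mathrm{div}(\rho w)=0$ in the sense of distributions, $p=a_0\rho^{\gamma}$ with $a_0>0$, $\gamma>1$, and $\rho$ bounded and bounded away from $0$. **Hypotheses.** Let $\mathcal F$ be a set of surfaces $\Theta\in C^2(\overline D)$ (restrictions of $C^2$ functions on $\mathbb R^2$) with $\Theta=\Theta_0$, $\partial\Theta/\partial n=\Theta_*$ on $\partial D$ (the second condition wherever $\partial D$ is $C^1$). Let each $\Theta'\in\mathcal F$ be assigned a solution of the flow problem with velocity $w(\Theta')$. Let $\Theta\in\mathcal F$ minimize $\Theta'\mapsto J(\Theta',w(\Theta'))$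 over $\mathcal F$, and suppose that for every $\eta\in C_c^\infty(D)$ one has $\Theta+t\eta\in\mathcal F$ for all small $|t|$ and that the solution has a Gateaux derivative at $\Theta$ in direction $\eta$, the velocity in $V(\Omega)$, with derivative $\widehat w\eta$, and the remaining variables in $L^2$ (the pressure in (i)), $L^\infty$ (the density in (ii), (iii)) and $H^1\cap L^\infty$ (the temperature in (ii)). **Coefficients.** With $w=w(\Theta)$ put $$K^{\alpha\beta\lambda\sigma}=2\mu r^3W^{\alpha\sigma}\delta^{\beta\lambda},\qquad W^{\alpha\beta}=\int_{-1}^1w^\alpha w^\beta d\xi,$$ $$\widehat\Phi^0(w,\widehat w\eta)=\int_{-1}^12A^{ijkl}e_{ij}(\widehat w\eta)e_{kl}(w)\,d\xi,\qquad \widehat\Phi^\lambda(w,\Theta)=\int_{-1}^1\Big(2A^{ijkl}\frac{\partial e_{ij}(w)}{\partial\Theta_\lambda}e_{kl}(w)+\frac{\partial A^{ijkl}}{\partial\Theta_\lambda}e_{ij}(w)e_{kl}(w)\Big)d\xi,$$ $$\widehat\Phi^{\lambda\sigma}(w,\Theta)=2\mu r^2\Big(\varepsilon W^{\sigma3}_\lambda+W^{\sigma\nu}_\lambda\Theta_\nu-\varepsilon^{-1}\Theta_\lambda\int_{-1}^1w^\sigma\,\partial_\xi(\varepsilon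 w^3+w^\nu\Theta_\nu)\,d\xi\Big),\qquad W^{\sigma i}_\lambda=\int_{-1}^1w^\sigma\partial_\lambda w^i\,d\xi .$$ (In $\partial/\partial\Theta_\lambda$ the field $w$ and the second derivatives of $\Theta$ are held fixed.) **Theorem.** 1. The state belonging to $\Theta$ solves the Navier–Stokes equations, and for every $\eta\in C_c^\infty(D)$ its Gateaux derivative solves the linearized Navier–Stokes equations (same model, homogeneous data on the wall), whose right-hand side is minus the derivative, at fixed state, of the weak equations with respect to the surface in direction $\eta$. For (i) this reads $\mathrm{div}\,\widehat w\eta=0$ and $$a(\widehat w\eta,v)+b(w;\widehat w\eta,v)+b(\widehat w\eta;w,v)+2(\vec\omega\times\widehat w\eta,v)-(\widehat p\eta,\mathrm{div}\,v)=(R\eta,v)\qquad(v\in\mathcal V),$$ where $a(u,v)=\int_\Omega A^{ijkl}e_{kl}(u)e_{ij}(v)\sqrt g\,dx\,d\xi$ and $b(u;w,v)=\int_\Omega g_{km}u^j\nabla_jw^k\,v^m\sqrt g\,dx\,d\xi$. 2. $\Theta$ solves the boundary value problem $$\frac{\partial^2}{\partial x^\lambda\partial x^\sigma}\Big(K^{\alpha\beta\lambda\sigma}\frac{\partial^2\Theta}{\partial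 x^\beta\partial x^\alpha}\Big)+\frac{\partial^2}{\partial x^\lambda\partial x^\sigma}\big(r\widehat\Phi^{\lambda\sigma}\big)-\frac{\partial}{\partial x^\lambda}\big(r\widehat\Phi^\lambda\big)+r\widehat\Phi^0(w,\widehat w)=0\ \text{ in }D,\qquad \Theta=\Theta_0,\ \frac{\partial\Theta}{\partial n}=\Theta_*\ \text{ on }\partial D,$$ in the sense of distributions, where $r\widehat\Phi^0(w,\widehat w)$ denotes the functional $\eta\mapsto\int_Dr\widehat\Phi^0(w,\widehat w\eta)\,dx$; all integrals involved converge. If $K^{\alpha\beta\lambda\sigma}\Theta_{\alpha\beta}$ and $r\widehat\Phi^{\lambda\sigma}$ are $C^2$ and $r\widehat\Phi^\lambda$ is $C^1$ in $D$, then this functional is given by a continuous density $r\Psi$, and the equation holds at every point of $D$ with $\Psi$ in place of $\widehat\Phi^0(w,\widehat w)$. 3. (Variational form.) For all $\eta\in C_c^\infty(D)$, $$\int_D\big[(K^{\alpha\beta\lambda\sigma}\Theta_{\alpha\beta}+r\widehat\Phi^{\lambda\sigma})\eta_{\lambda\sigma}+r\widehat\Phi^\lambda\eta_\lambda+r\widehat\Phi^0(w,\widehat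 w\eta)\big]dx=0 .$$ If $K^{\alpha\beta\lambda\sigma}\Theta_{\alpha\beta}+r\widehat\Phi^{\lambda\sigma}$ and $r\widehat\Phi^\lambda$ are in $L^2(D)$, it holds for every $\eta\in H^2_0(D)$ to which $\widehat w$ extends continuously, that is, whenever $\eta=\lim\eta_n$ in $H^2(D)$ with $\eta_n\in C_c^\infty(D)$, and $\widehat w\eta_n$ converges in $H^1(\Omega)^3$ to a field in $V(\Omega)$, denoted by $\widehat w\eta$. 4. The equation is (possibly degenerate) elliptic: for almost every $x\in D$ and all $\zeta\in\mathbb R^2$, $K^{\alpha\beta\lambda\sigma}\zeta_\alpha\zeta_\beta\zeta_\lambda\zeta_\sigma\ge0$, with equality only if $\zeta=0$ or $\zeta_\alpha w^\alpha(x,\xi)=0$ for almost every $\xi$ (and always in these cases). -/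

import Mathlib

open MeasureTheory Filter Topology Set
open scoped ContDiff

noncomputable section

namespace Blade

/-! ## Coordinates

A point of the meridian plane is `x = (x¹, x²) = (z, r)`, stored as `x 0`, `x 1`.  A point of the
fixed three-dimensional domain is `(x, ξ)`.  Latin indices `1, 2, 3` are `0, 1, 2 : Fin 3` (the last
one belongs to `ξ`), Greek indices `1, 2` are `0, 1 : Fin 2`. -/

/-- The meridian plane with coordinates `(x¹, x²) = (z, r)`. -/
abbrev Plane := EuclideanSpace ℝ (Fin 2)

/-- Points `(x, ξ)` of the coordinate space. -/
abbrev Pt := Plane × ℝ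

/-- A Greek index seen as a Latin index. -/
abbrev up (α : Fin 2) : Fin 3 := Fin.castSucc α

/-- The coordinate directions of `Pt`. -/
def dir : Fin 3 → Pt :=
  ![(EuclideanSpace.single 0 1, 0), (EuclideanSpace.single 1 1, 0), (0, 1)]

/-- The partial derivative `∂u/∂x^α` of a function on the meridian plane. -/
def pd (α : Fin 2) (u : Plane → ℝ) (x : Plane) : ℝ :=
  fderiv ℝ u x (EuclideanSpace.single α 1)

/-- Kronecker's delta. -/
def kron (α β : Fin 2) : ℝ := if α = β then 1 else 0

/-! ## Geometry of the blade coordinate system -/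

/-- `|∇Θ|²`. -/
def gradSq (Θ : Plane → ℝ) (x : Plane) : ℝ := pd 0 Θ x ^ 2 + pd 1 Θ x ^ 2

/-- The covariant metric tensor `g_ij`: `g_αβ = δ_αβ + r² Θ_α Θ_β`, `g_3α = ε r² Θ_α`,
`g_33 = ε² r²`. -/
def gLow (ε : ℝ) (Θ : Plane → ℝ) (x : Plane) : Matrix (Fin 3) (Fin 3) ℝ :=
  !![1 + x 1 ^ 2 * pd 0 Θ x * pd 0 Θ x, x 1 ^ 2 * pd 0 Θ x * pd 1 Θ x, ε * x 1 ^ 2 * pd 0 Θ x;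
     x 1 ^ 2 * pd 1 Θ x * pd 0 Θ x, 1 + x 1 ^ 2 * pd 1 Θ x * pd 1 Θ x, ε * x 1 ^ 2 * pd 1 Θ x;
     ε * x 1 ^ 2 * pd 0 Θ x, ε * x 1 ^ 2 * pd 1 Θ x, ε ^ 2 * x 1 ^ 2]

/-- The contravariant metric tensor `g^ij`: `g^αβ = δ^αβ`, `g^3α = -ε⁻¹ Θ_α`,
`g^33 = ε⁻² r⁻² (1 + r² |∇Θ|²)`. -/
def gUp (ε : ℝ) (Θ : Plane → ℝ) (x : Plane) : Matrix (Fin 3) (Fin 3) ℝ :=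
  !![1, 0, -(pd 0 Θ x / ε);
     0, 1, -(pd 1 Θ x / ε);
     -(pd 0 Θ x / ε), -(pd 1 Θ x / ε), (1 + x 1 ^ 2 * gradSq Θ x) / (ε ^ 2 * x 1 ^ 2)]

/-- `∂g_ij/∂x^k`; the metric does not depend on `ξ`. -/
def gLowDeriv (ε : ℝ) (Θ : Plane → ℝ) (x : Plane) (k i j : Fin 3) : ℝ :=
  ![pd 0 (fun y => gLow ε Θ y i j) x, pd 1 (fun y => gLow ε Θ y i j) x, 0] k

/-- The Christoffel symbols `Γ^i_jk` of the second kind. -/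
def christoffel (ε : ℝ) (Θ : Plane → ℝ) (x : Plane) (i j k : Fin 3) : ℝ :=
  (1 / 2) * ∑ l, gUp ε Θ x i l *
    (gLowDeriv ε Θ x j k l + gLowDeriv ε Θ x k j l - gLowDeriv ε Θ x l j k)

/-- The viscosity tensor
`A^ijkl = λ g^ij g^kl + μ (g^ik g^jl + g^il g^jk)`, `λ = -2μ/3`. -/
def visc (μ ε : ℝ) (Θ : Plane → ℝ) (x : Plane) (i j k l : Fin 3) : ℝ :=
  -(2 / 3) * μ * (gUp ε Θ x i j * gUp ε Θ x k l) +
    μ * (gUp ε Θ x i k * gUp ε Θ x j l + gUp ε Θ x i l * gUp ε Θ x j k)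

/-- `A^ijkl s_kl t_ij` at the point `x`. -/
def viscPair (μ ε : ℝ) (Θ : Plane → ℝ) (x : Plane) (s t : Fin 3 → Fin 3 → ℝ) : ℝ :=
  ∑ i, ∑ j, ∑ k, ∑ l, visc μ ε Θ x i j k l * s k l * t i j

/-! ## Functions with first (weak) derivatives -/

/-- A function on the coordinate space together with its (weak) first derivatives. -/
structure Jet where
  val : Pt → ℝ
  grad : Pt → Fin 3 → ℝ

/-- A vector field in contravariant components `w^1, w^2, w^3`. -/
abbrev Field := Fin 3 → Jet

/-- A differentiable function with its classical derivatives. -/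
def Jet.of (φ : Pt → ℝ) : Jet := ⟨φ, fun p j => fderiv ℝ φ p (dir j)⟩

/-- Convergence in `H¹` with respect to the measure `ν`. -/
def JetTendsto {ι : Type} (ν : Measure Pt) (l : Filter ι) (F : ι → Jet) (u : Jet) : Prop :=
  Tendsto (fun n => eLpNorm (fun p => (F n).val p - u.val p) 2 ν) l (𝓝 0) ∧
    ∀ j, Tendsto (fun n => eLpNorm (fun p => (F n).grad p j - u.grad p j) 2 ν) l (𝓝 0)

/-- `u'` is the derivative at `t = 0`, in `L^q(ν)`, of the curve `t ↦ u t`. -/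
def HasLpDeriv (ν : Measure Pt) (q : ENNReal) (u : ℝ → Pt → ℝ) (u' : Pt → ℝ) : Prop :=
  Tendsto (fun t : ℝ => eLpNorm (fun p => t⁻¹ * (u t p - u 0 p) - u' p) q ν) (𝓝[≠] 0) (𝓝 0)

/-- `u'` is the derivative at `t = 0`, in `H¹(ν)`, of the curve `t ↦ u t`. -/
def HasH1Deriv (ν : Measure Pt) (u : ℝ → Jet) (u' : Jet) : Prop :=
  HasLpDeriv ν 2 (fun t => (u t).val) u'.val ∧
    ∀ j, HasLpDeriv ν 2 (fun t p => (u t).grad p j) (fun p => u'.grad p j)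

/-! ## Kinematics -/

/-- The covariant derivative `∇_i w^j = ∂_i w^j + Γ^j_ik w^k`. -/
def cov (ε : ℝ) (Θ : Plane → ℝ) (w : Field) (p : Pt) (i j : Fin 3) : ℝ :=
  (w j).grad p i + ∑ k, christoffel ε Θ p.1 j i k * (w k).val p

/-- `div w = ∇_i w^i`. -/
def divg (ε : ℝ) (Θ : Plane → ℝ) (w : Field) (p : Pt) : ℝ := ∑ i, cov ε Θ w p i i

/-- The strain rate tensor `e_ij(w) = ½ (∇_i w_j + ∇_j w_i)`, where `∇_i w_j = g_jk ∇_i w^k`. -/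
def strain (ε : ℝ) (Θ : Plane → ℝ) (w : Field) (p : Pt) (i j : Fin 3) : ℝ :=
  (1 / 2) * ∑ k, (gLow ε Θ p.1 j k * cov ε Θ w p i k + gLow ε Θ p.1 i k * cov ε Θ w p j k)

/-- `Π(w, Θ) = ε w³ + w^β Θ_β`. -/
def swirl (ε : ℝ) (Θ : Plane → ℝ) (w : Field) (p : Pt) : ℝ :=
  ε * (w 2).val p + ∑ β, (w (up β)).val p * pd β Θ p.1

/-- The components `w^j ∇_j u^k` of `(w · ∇) u`. -/
def convect (ε : ℝ) (Θ : Plane → ℝ) (w u : Field) (p : Pt) (k : Fin 3) : ℝ :=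
  ∑ j, (w j).val p * cov ε Θ u p j k

/-- The contravariant components of the Coriolis acceleration `2 ω × w`. -/
def coriolis (om ε : ℝ) (Θ : Plane → ℝ) (w : Field) (p : Pt) : Fin 3 → ℝ :=
  ![0, -(2 * p.1 1 * om * swirl ε Θ w p),
    2 * p.1 1 * om / ε * (pd 1 Θ p.1 * swirl ε Θ w p + (w 1).val p / p.1 1 ^ 2)]

/-- The contravariant components of `-ω × (ω × R) = ω² r e_r`. -/
def centrifugal (om ε : ℝ) (Θ : Plane → ℝ) (p : Pt) : Fin 3 → ℝ :=
  ![0, om ^ 2 * p.1 1, -(om ^ 2 * p.1 1 * pd 1 Θ p.1 / ε)]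

/-- The components of the absolute acceleration of a stationary flow. -/
def accel (om ε : ℝ) (Θ : Plane → ℝ) (w : Field) (p : Pt) (k : Fin 3) : ℝ :=
  convect ε Θ w w p k + coriolis om ε Θ w p k - centrifugal om ε Θ p k

/-- The derivative of the absolute acceleration with respect to the velocity, in direction `w'`. -/
def accelLin (om ε : ℝ) (Θ : Plane → ℝ) (w w' : Field) (p : Pt) (k : Fin 3) : ℝ :=
  convect ε Θ w w' p k + convect ε Θ w' w p k + coriolis om ε Θ w' p k

/-- The inner product `g_km a^k b^m`. -/
def gPair (ε : ℝ) (Θ : Plane → ℝ) (p : Pt) (a b : Fin 3 → ℝ) : ℝ :=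
  ∑ k, ∑ m, gLow ε Θ p.1 k m * a k * b m

/-! ## The flow passage and its function spaces -/

/-- The data of the flow passage: the meridian domain `D`, whose boundary consists of the wall part
`γ₀` (hub and shroud) and the part `γ₁` (inlet and outlet), the half angle `ε` between two blades,
the viscosity `μ`, the angular velocity `om` (`ω` in comments), the body force
and the normal stress prescribed at the inlet and the outlet (both in contravariant components). -/
structure Passage where
  D : Set Plane
  γ₀ : Set Plane
  γ₁ : Set Plane
  ε : ℝ
  μ : ℝ
  om : ℝ
  force : Fin 3 → Pt → ℝ
  traction : Fin 3 → Pt → ℝ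
  isOpen_D : IsOpen D
  isBounded_D : Bornology.IsBounded D
  radius_pos : ∃ r₀ : ℝ, 0 < r₀ ∧ ∀ x ∈ D, r₀ ≤ x 1
  frontier_eq : frontier D = γ₀ ∪ γ₁
  ε_pos : 0 < ε
  μ_pos : 0 < μ
  force_memLp : ∀ i, MemLp (force i) 2 (volume.restrict (D ×ˢ Ioo (-1 : ℝ) 1))
  length_finite : Measure.hausdorffMeasure 1 γ₁ ≠ ⊤
  traction_integrable : ∀ i, Integrable (traction i)
    (((Measure.hausdorffMeasure 1).restrict γ₁).prod (volume.restrict (Ioo (-1 : ℝ) 1)))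

namespace Passage

variable (P : Passage)

/-- Lebesgue measure on the fixed domain `Ω = D × (-1, 1)`. -/
def vol : Measure Pt := volume.restrict (P.D ×ˢ Ioo (-1 : ℝ) 1)

/-- The part of `∂Ω` on which the velocity vanishes: `γ₀ × [-1, 1]` and the two blades `ξ = ±1`. -/
def wall : Set Pt :=
  P.γ₀ ×ˢ Icc (-1 : ℝ) 1 ∪ closure P.D ×ˢ {-1, 1}

/-- Smooth functions that vanish near the wall. -/
def IsWallTest (φ : Pt → ℝ) : Prop := ContDiff ℝ ∞ φ ∧ ∀ᶠ p in 𝓝ˢ P.wall, φ p = 0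

/-- Test functions on `Ω`. -/
def IsInnerTest (q : Pt → ℝ) : Prop :=
  ContDiff ℝ ∞ q ∧ HasCompactSupport q ∧ tsupport q ⊆ P.D ×ˢ Ioo (-1 : ℝ) 1

/-- Test functions on `D`. -/
def IsTest (η : Plane → ℝ) : Prop :=
  ContDiff ℝ ∞ η ∧ HasCompactSupport η ∧ tsupport η ⊆ P.D

/-- `V(Ω) = {v ∈ H¹(Ω)³ : v = 0 on the wall}`, as the closure in `H¹` of the smooth fields that
vanish near the wall. -/
def MemV (w : Field) : Prop :=
  ∀ i, MemLp (w i).val 2 P.vol ∧ (∀ j, MemLp (fun p => (w i).grad p j) 2 P.vol) ∧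
    ∃ φ : ℕ → Pt → ℝ, (∀ n, P.IsWallTest (φ n)) ∧
      JetTendsto P.vol atTop (fun n => Jet.of (φ n)) (w i)

/-- `u ∈ H¹(Ω)`. -/
def MemH1 (u : Jet) : Prop :=
  MemLp u.val 2 P.vol ∧ ∀ j, MemLp (fun p => u.grad p j) 2 P.vol ∧
    ∀ q, P.IsInnerTest q →
      ∫ p, u.val p * fderiv ℝ q p (dir j) ∂P.vol = -∫ p, u.grad p j * q p ∂P.vol

end Passage

/-! ## Rotating Navier-Stokes equations -/

/-- The variables of state: velocity, pressure, density, temperature. The pressure is an independent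
variable for incompressible flow only; density and temperature are not used there. -/
structure State where
  vel : Field
  pres : Pt → ℝ
  dens : Pt → ℝ
  temp : Jet

/-- The stationary flow models: incompressible flow (of density `1`); compressible flow with the
equation of state `p = p(ρ, T)`, specific heat `cv`, heat conductivity `κ` and heat source `h`;
isentropic flow with `p = a ρ^b`. -/
inductive FlowModel where
  | incompressible : FlowModel
  | compressible (eos : ℝ → ℝ → ℝ) (cv κ : ℝ) (h : Pt → ℝ) : FlowModel
  | isentropic (a b : ℝ) : FlowModel

namespace FlowModel

/-- Standing conditions on the constants and data of the model. -/
def Regular (P : Passage) : FlowModel → Prop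
  | incompressible => True
  | compressible eos cv κ h =>
      ContDiffOn ℝ 1 (fun y : ℝ × ℝ => eos y.1 y.2) (Ioi 0 ×ˢ Ioi 0) ∧ 0 < cv ∧ 0 < κ ∧
        Integrable h P.vol
  | isentropic a b => 0 < a ∧ 1 < b

/-- The density field. -/
def density (s : State) : FlowModel → Pt → ℝ
  | incompressible => fun _ => 1
  | _ => s.dens

/-- The pressure field. -/
def pressure (s : State) : FlowModel → Pt → ℝ
  | incompressible => s.pres
  | compressible eos _ _ _ => fun p => eos (s.dens p) (s.temp.val p)
  | isentropic a b => fun p => a * s.dens p ^ b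

/-- The derivative of the density field in direction `s'`. -/
def densityLin (s' : State) : FlowModel → Pt → ℝ
  | incompressible => fun _ => 0
  | _ => s'.dens

/-- The derivative of the pressure field at `s` in direction `s'`. -/
def pressureLin (s s' : State) : FlowModel → Pt → ℝ
  | incompressible => s'.pres
  | compressible eos _ _ _ => fun p =>
      fderiv ℝ (fun y : ℝ × ℝ => eos y.1 y.2) (s.dens p, s.temp.val p) (s'.dens p, s'.temp.val p)
  | isentropic a b => fun p => a * b * s.dens p ^ (b - 1) * s'.dens p

end FlowModel

section NavierStokes

variable (P : Passage) (M : FlowModel)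

/-- The weak form of the momentum equation, tested with the field `v`:
`a(w, v) + (ρ (w·∇w + 2ω×w - ω² r e_r) - f, v) - (p, div v) - ⟨g, v⟩_{γ₁ × (-1,1)}`,
with the volume element `√g dx dξ = ε r dx dξ` and the surface element `ε r ds dξ`. -/
def momentum (Θ : Plane → ℝ) (s : State) (v : Field) : ℝ :=
  (∫ p, (viscPair P.μ P.ε Θ p.1 (strain P.ε Θ s.vel p) (strain P.ε Θ v p)
      + gPair P.ε Θ p
          (fun k => M.density s p * accel P.om P.ε Θ s.vel p k - P.force k p)
          (fun m => (v m).val p)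
      - M.pressure s p * divg P.ε Θ v p) * (P.ε * p.1 1) ∂P.vol)
  - ∫ x in P.γ₁, (∫ ξ in Ioo (-1 : ℝ) 1,
      gPair P.ε Θ (x, ξ) (fun k => P.traction k (x, ξ)) (fun m => (v m).val (x, ξ)) * (P.ε * x 1))
      ∂(Measure.hausdorffMeasure 1)

/-- The derivative of `momentum` with respect to the state at `s`, in direction `s'`. For
incompressible flow it is
`a(w', v) + b(w; w', v) + b(w'; w, v) + 2(ω × w', v) - (p', div v)`. -/
def momentumLin (Θ : Plane → ℝ) (s s' : State) (v : Field) : ℝ :=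
  ∫ p, (viscPair P.μ P.ε Θ p.1 (strain P.ε Θ s'.vel p) (strain P.ε Θ v p)
      + gPair P.ε Θ p
          (fun k => M.densityLin s' p * accel P.om P.ε Θ s.vel p k +
            M.density s p * accelLin P.om P.ε Θ s.vel s'.vel p k)
          (fun m => (v m).val p)
      - M.pressureLin s s' p * divg P.ε Θ v p) * (P.ε * p.1 1) ∂P.vol

/-- Weak form of `div (ρ w)`, tested with `q`. -/
def massFlux (ρ : Pt → ℝ) (w : Field) (q : Pt → ℝ) : ℝ :=
  ∫ p, (∑ j, ρ p * (w j).val p * fderiv ℝ q p (dir j)) * (P.ε * p.1 1) ∂P.vol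

/-- Weak form of the energy equation
`ρ cv w^j ∂_j T - div (κ grad T) + p div w - Φ = h`, tested with `ψ`. -/
def energy (cv κ : ℝ) (h : Pt → ℝ) (Θ : Plane → ℝ) (s : State) (ψ : Pt → ℝ) : ℝ :=
  ∫ p, ((s.dens p * cv * (∑ j, (s.vel j).val p * s.temp.grad p j)
        + M.pressure s p * divg P.ε Θ s.vel p
        - viscPair P.μ P.ε Θ p.1 (strain P.ε Θ s.vel p) (strain P.ε Θ s.vel p) - h p) * ψ p
      + κ * ∑ i, ∑ j, gUp P.ε Θ p.1 i j * s.temp.grad p i * fderiv ℝ ψ p (dir j))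
      * (P.ε * p.1 1) ∂P.vol

/-- The derivative of `energy` with respect to the state at `s`, in direction `s'`. -/
def energyLin (cv κ : ℝ) (Θ : Plane → ℝ) (s s' : State) (ψ : Pt → ℝ) : ℝ :=
  ∫ p, ((s'.dens p * cv * (∑ j, (s.vel j).val p * s.temp.grad p j)
        + s.dens p * cv * (∑ j, ((s'.vel j).val p * s.temp.grad p j
            + (s.vel j).val p * s'.temp.grad p j))
        + M.pressureLin s s' p * divg P.ε Θ s.vel p + M.pressure s p * divg P.ε Θ s'.vel p
        - 2 * viscPair P.μ P.ε Θ p.1 (strain P.ε Θ s.vel p) (strain P.ε Θ s'.vel p)) * ψ p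
      + κ * ∑ i, ∑ j, gUp P.ε Θ p.1 i j * s'.temp.grad p i * fderiv ℝ ψ p (dir j))
      * (P.ε * p.1 1) ∂P.vol

/-- Measurable, bounded, and bounded away from zero. -/
def PosBounded (ρ : Pt → ℝ) : Prop :=
  MemLp ρ ⊤ P.vol ∧ ∃ c : ℝ, 0 < c ∧ ∀ᵐ p ∂P.vol, c ≤ ρ p

/-- `s` is a weak solution of the stationary rotating Navier-Stokes equations in the passage bounded
by the blades with middle surface `Θ`, written in the blade coordinates. -/
def IsSolution (Θ : Plane → ℝ) (s : State) : Prop :=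
  P.MemV s.vel ∧
  (∀ v : Fin 3 → Pt → ℝ, (∀ i, P.IsWallTest (v i)) →
    momentum P M Θ s (fun i => Jet.of (v i)) = 0) ∧
  match M with
  | .incompressible => MemLp s.pres 2 P.vol ∧ ∀ᵐ p ∂P.vol, divg P.ε Θ s.vel p = 0
  | .compressible _ cv κ h =>
      PosBounded P s.dens ∧ PosBounded P s.temp.val ∧ P.MemH1 s.temp ∧
      ∀ q, P.IsInnerTest q → massFlux P s.dens s.vel q = 0 ∧ energy P M cv κ h Θ s q = 0
  | .isentropic _ _ =>
      PosBounded P s.dens ∧ ∀ q, P.IsInnerTest q → massFlux P s.dens s.vel q = 0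

/-- `s'` is the Gateaux derivative at `Θ`, in direction `η`, of the map `S` from surfaces to
states. -/
def IsGateauxDeriv (S : (Plane → ℝ) → State) (Θ η : Plane → ℝ) (s' : State) : Prop :=
  P.MemV s'.vel ∧
  (∀ i, HasH1Deriv P.vol (fun t => (S (Θ + t • η)).vel i) (s'.vel i)) ∧
  match M with
  | .incompressible =>
      MemLp s'.pres 2 P.vol ∧ HasLpDeriv P.vol 2 (fun t => (S (Θ + t • η)).pres) s'.pres
  | .compressible _ _ _ _ =>
      MemLp s'.dens ⊤ P.vol ∧ HasLpDeriv P.vol ⊤ (fun t => (S (Θ + t • η)).dens) s'.dens ∧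
      MemLp s'.temp.val ⊤ P.vol ∧
      HasLpDeriv P.vol ⊤ (fun t => (S (Θ + t • η)).temp.val) s'.temp.val ∧
      P.MemH1 s'.temp ∧ HasH1Deriv P.vol (fun t => (S (Θ + t • η)).temp) s'.temp
  | .isentropic _ _ =>
      MemLp s'.dens ⊤ P.vol ∧ HasLpDeriv P.vol ⊤ (fun t => (S (Θ + t • η)).dens) s'.dens

/-- `s'` is a weak solution of the Navier-Stokes equations linearized at the state `s` and the
surface `Θ`, with the right-hand side that a variation `η` of the surface produces: minus the
derivative, at fixed state, of the equations with respect to the surface in direction `η`. -/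
def IsLinearizedSolution (Θ η : Plane → ℝ) (s s' : State) : Prop :=
  P.MemV s'.vel ∧
  (∀ v : Fin 3 → Pt → ℝ, (∀ i, P.IsWallTest (v i)) →
    HasDerivAt (fun t : ℝ => momentum P M (Θ + t • η) s (fun i => Jet.of (v i)))
      (-momentumLin P M Θ s s' (fun i => Jet.of (v i))) 0) ∧
  match M with
  | .incompressible => MemLp s'.pres 2 P.vol ∧ ∀ᵐ p ∂P.vol, divg P.ε Θ s'.vel p = 0
  | .compressible _ cv κ h =>
      P.MemH1 s'.temp ∧ ∀ q, P.IsInnerTest q →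
        massFlux P s'.dens s.vel q + massFlux P s.dens s'.vel q = 0 ∧
        HasDerivAt (fun t : ℝ => energy P M cv κ h (Θ + t • η) s q)
          (-energyLin P M cv κ Θ s s' q) 0
  | .isentropic _ _ => ∀ q, P.IsInnerTest q →
      massFlux P s'.dens s.vel q + massFlux P s.dens s'.vel q = 0

/-- The global dissipation energy `J = ½ ∫_Ω A^ijkl e_kl(w) e_ij(w) √g dx dξ`. -/
def dissipation (Θ : Plane → ℝ) (w : Field) : ℝ :=
  (1 / 2) * ∫ p, viscPair P.μ P.ε Θ p.1 (strain P.ε Θ w p) (strain P.ε Θ w p)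
    * (P.ε * p.1 1) ∂P.vol

end NavierStokes

/-! ## Blade surfaces -/

/-- `n` is the outer unit normal of `D` at `x`, where `∂D` is of class `C¹` near `x`. -/
def IsOuterNormal (D : Set Plane) (x n : Plane) : Prop :=
  ‖n‖ = 1 ∧ ∃ ρ : Plane → ℝ, ContDiff ℝ 1 ρ ∧ ρ x = 0 ∧
    (∃ c : ℝ, 0 < c ∧ ∀ v, fderiv ℝ ρ x v = c * inner ℝ n v) ∧
    ∀ᶠ y in 𝓝 x, y ∈ D ↔ ρ y < 0

/-- The boundary conditions `Θ = Θ₀`, `∂Θ/∂n = Θs` on `∂D`. -/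
def BoundaryConditions (P : Passage) (Θ₀ Θs Θ : Plane → ℝ) : Prop :=
  (∀ x ∈ frontier P.D, Θ x = Θ₀ x) ∧
    ∀ x ∈ frontier P.D, ∀ n, IsOuterNormal P.D x n → fderiv ℝ Θ x n = Θs x

/-! ## Coefficients of the Euler-Lagrange equation -/

section Coefficients

variable (P : Passage) (Θ : Plane → ℝ) (w : Field)

/-- `W^αβ = ∫_{-1}^1 w^α w^β dξ`. -/
def Wten (α β : Fin 2) (x : Plane) : ℝ :=
  ∫ ξ in Ioo (-1 : ℝ) 1, (w (up α)).val (x, ξ) * (w (up β)).val (x, ξ)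

/-- `K^αβλσ = 2 μ r³ W^ασ δ^βλ`. -/
def Kten (α β l σ : Fin 2) (x : Plane) : ℝ :=
  2 * P.μ * x 1 ^ 3 * Wten w α σ x * kron β l

/-- `K^αβλσ ∂²Θ/∂x^β∂x^α`. -/
def Kterm (l σ : Fin 2) (x : Plane) : ℝ :=
  ∑ α, ∑ β, Kten P w α β l σ x * pd β (pd α Θ) x

/-- The symmetric tensor with the given components `t_αβ`, `t_3α`, `t_33`. -/
def assemble (a : Fin 2 → Fin 2 → ℝ) (b : Fin 2 → ℝ) (c : ℝ) : Fin 3 → Fin 3 → ℝ :=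
  ![![a 0 0, a 0 1, b 0], ![a 1 0, a 1 1, b 1], ![b 0, b 1, c]]

/-- `ψ^λ_ij(w)`. -/
def psi1 (ε : ℝ) (l : Fin 2) (p : Pt) : Fin 3 → Fin 3 → ℝ :=
  assemble
    (fun α β => (1 / 2) * ε * p.1 1 ^ 2 *
      ((w 2).grad p (up α) * kron l β + (w 2).grad p (up β) * kron l α))
    (fun α => (1 / 2) * ε * p.1 1 ^ 2 *
      ((w (up l)).grad p (up α) + kron l α * ((w 2).grad p 2 + 2 / p.1 1 * (w 1).val p)))
    (ε * p.1 1 ^ 2 * (w (up l)).grad p 2)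

/-- `ψ^λσ_ij(w)`. -/
def psi2 (l σ : Fin 2) (p : Pt) : Fin 3 → Fin 3 → ℝ :=
  assemble
    (fun α β => (1 / 2) * p.1 1 ^ 2 *
      ((w (up l)).grad p (up α) * kron β σ + (w (up l)).grad p (up β) * kron σ α
        + 2 / p.1 1 * (w 1).val p * kron α l * kron σ β))
    (fun α => (1 / 2) * p.1 1 ^ 2 * (w (up l)).grad p 2 * kron α σ)
    0

/-- `e^λ_ij(w) = ∂e_ij(w)/∂Θ_λ`, the velocity being fixed. -/
def strain1 (ε : ℝ) (l : Fin 2) (p : Pt) (i j : Fin 3) : ℝ :=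
  psi1 w ε l p i j + ∑ σ, (psi2 w l σ p i j + psi2 w σ l p i j) * pd σ Θ p.1
    + assemble
        (fun α β => (1 / 2) * p.1 1 ^ 2 * ∑ σ, (w (up σ)).val p *
          (kron α l * pd β (pd σ Θ) p.1 + kron β l * pd σ (pd α Θ) p.1))
        (fun _ => 0) 0 i j

/-- `∂g^ij/∂Θ_λ`. -/
def gUp1 (ε : ℝ) (l : Fin 2) (x : Plane) : Fin 3 → Fin 3 → ℝ :=
  assemble (fun _ _ => 0) (fun α => -(kron α l / ε)) (2 * pd l Θ x / ε ^ 2)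

/-- `∂A^ijkl/∂Θ_λ`. -/
def visc1 (μ ε : ℝ) (l₀ : Fin 2) (x : Plane) (i j k l : Fin 3) : ℝ :=
  -(2 / 3) * μ * (gUp1 Θ ε l₀ x i j * gUp ε Θ x k l + gUp ε Θ x i j * gUp1 Θ ε l₀ x k l) +
    μ * (gUp1 Θ ε l₀ x i k * gUp ε Θ x j l + gUp ε Θ x i k * gUp1 Θ ε l₀ x j l
      + gUp1 Θ ε l₀ x i l * gUp ε Θ x j k + gUp ε Θ x i l * gUp1 Θ ε l₀ x j k)

/-- `M^λ = ∂A^ijkl/∂Θ_λ e_ij(w) e_kl(w)`. -/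
def Mterm (l₀ : Fin 2) (p : Pt) : ℝ :=
  ∑ i, ∑ j, ∑ k, ∑ l,
    visc1 Θ P.μ P.ε l₀ p.1 i j k l * strain P.ε Θ w p i j * strain P.ε Θ w p k l

/-- `Φ̂^0(w, ŵ) = ∫_{-1}^1 2 A^ijkl e_ij(ŵ) e_kl(w) dξ`. -/
def Phi0 (w' : Field) (x : Plane) : ℝ :=
  ∫ ξ in Ioo (-1 : ℝ) 1,
    2 * viscPair P.μ P.ε Θ x (strain P.ε Θ w (x, ξ)) (strain P.ε Θ w' (x, ξ))

/-- `Φ̂^λ(w, Θ) = ∫_{-1}^1 (2 A^ijkl e^λ_ij(w) e_kl(w) + M^λ) dξ`. -/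
def Phi1 (l : Fin 2) (x : Plane) : ℝ :=
  ∫ ξ in Ioo (-1 : ℝ) 1,
    (2 * viscPair P.μ P.ε Θ x (strain P.ε Θ w (x, ξ)) (strain1 Θ w P.ε l (x, ξ))
      + Mterm P Θ w l (x, ξ))

/-- `Φ̂^λσ(w, Θ) = 2 μ r² (ε W^σ3_λ + W^σν_λ Θ_ν - ε⁻¹ Θ_λ ∫_{-1}^1 w^σ ∂_ξ Π(w, Θ) dξ)`,
where `W^σi_λ = ∫_{-1}^1 w^σ ∂_λ w^i dξ`. -/
def Phi2 (l σ : Fin 2) (x : Plane) : ℝ :=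
  2 * P.μ * x 1 ^ 2 *
    (P.ε * (∫ ξ in Ioo (-1 : ℝ) 1, (w (up σ)).val (x, ξ) * (w 2).grad (x, ξ) (up l))
    + (∑ ν, (∫ ξ in Ioo (-1 : ℝ) 1,
        (w (up σ)).val (x, ξ) * (w (up ν)).grad (x, ξ) (up l)) * pd ν Θ x)
    - pd l Θ x / P.ε * ∫ ξ in Ioo (-1 : ℝ) 1, (w (up σ)).val (x, ξ) *
        (P.ε * (w 2).grad (x, ξ) 2 + ∑ ν, (w (up ν)).grad (x, ξ) 2 * pd ν Θ x))

end Coefficients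

/-! ## The variational form -/

/-- A function on the meridian plane with its (weak) first and second derivatives. -/
structure Jet2 where
  val : Plane → ℝ
  grad : Fin 2 → Plane → ℝ
  hess : Fin 2 → Fin 2 → Plane → ℝ

/-- A smooth function with its classical derivatives. -/
def Jet2.of (φ : Plane → ℝ) : Jet2 := ⟨φ, fun l => pd l φ, fun l σ => pd l (pd σ φ)⟩

/-- The test functions `φ n` on `D` converge to `η` in `H²(D)`; the space `H²₀(D)` consists of
all such limits `η`. -/
def H2Tendsto (P : Passage) (φ : ℕ → Plane → ℝ) (η : Jet2) : Prop :=
  (∀ n, P.IsTest (φ n)) ∧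
  MemLp η.val 2 (volume.restrict P.D) ∧
  (∀ l, MemLp (η.grad l) 2 (volume.restrict P.D)) ∧
  (∀ l σ, MemLp (η.hess l σ) 2 (volume.restrict P.D)) ∧
  Tendsto (fun n => eLpNorm (fun x => φ n x - η.val x) 2 (volume.restrict P.D)) atTop (𝓝 0) ∧
  (∀ l, Tendsto (fun n => eLpNorm (fun x => pd l (φ n) x - η.grad l x) 2 (volume.restrict P.D))
    atTop (𝓝 0)) ∧
  ∀ l σ, Tendsto (fun n => eLpNorm (fun x => pd l (pd σ (φ n)) x - η.hess l σ x) 2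
    (volume.restrict P.D)) atTop (𝓝 0)

/-- The integrand
`(K^αβλσ Θ_αβ + r Φ̂^λσ) η_λσ + r Φ̂^λ η_λ + r Φ̂^0(w, ŵη)` of the variational form. -/
def weakIntegrand (P : Passage) (Θ : Plane → ℝ) (w : Field) (η : Jet2) (w' : Field)
    (x : Plane) : ℝ :=
  (∑ l, ∑ σ, (Kterm P Θ w l σ x + x 1 * Phi2 P Θ w l σ x) * η.hess l σ x)
    + (∑ l, x 1 * Phi1 P Θ w l x * η.grad l x) + x 1 * Phi0 P Θ w w' x

/-- The variational equation for the test function `η`, where `w'` stands for `ŵη`. -/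
def WeakEquation (P : Passage) (Θ : Plane → ℝ) (w : Field) (η : Jet2) (w' : Field) : Prop :=
  IntegrableOn (weakIntegrand P Θ w η w') P.D ∧ ∫ x in P.D, weakIntegrand P Θ w η w' x = 0

/-- The left-hand side of the fourth-order equation, where the function `Ψ` stands for the term
`Φ̂^0(w, ŵ)`. -/
def strongOperator (P : Passage) (Θ : Plane → ℝ) (w : Field) (Ψ : Plane → ℝ) (x : Plane) : ℝ :=
  (∑ l, ∑ σ, pd l (pd σ (Kterm P Θ w l σ)) x)
    + (∑ l, ∑ σ, pd l (pd σ (fun y => y 1 * Phi2 P Θ w l σ y)) x)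
    - (∑ l, pd l (fun y => y 1 * Phi1 P Θ w l y) x) + x 1 * Ψ x

end Blade

end

/-! The proof is a first-variation argument, run in Lebesgue spaces. Along the line `Θ + t • η` all
coefficients depending on the surface are polynomials in `r`, `r⁻¹` and the first and second
derivatives of the surface. They therefore vary differentiably in `L^∞`, while velocities vary in
`H¹`. By Hölder, a bounded factor times two `L²` factors is differentiable in `L¹`, and the integral
is continuous there. `LpTendsto` and `LpDeriv` package this calculus.

Linearized equations: subtract, on the same varied surface, the equation of the frozen state from
that of the true solution. The latter is zero, so the residual of the frozen state is minus a
difference that involves only the change of state. Its difference quotient converges to the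
linearized operator (`hasDerivAt_residual`). Differentiability of the frozen equation in the surface
is thus obtained without differentiating its coefficients or the boundary term. Since `√g = εr` does
not contain the surface, neither do the divergence nor the mass flux. For an equation of state one
needs that a `C¹` function acts differentiably on `L^∞` (`LpDeriv.comp₂`).

Equation for the surface: the energy is differentiable in `t` and has a minimum at `0`, so its
derivative vanishes. The strain is half the Lie derivative of the metric (`strain_eq_lie`), and its
variation splits into the response of the velocity, a part with first derivatives of `η`, and a part
with second derivatives. The last part pairs with the viscous stress only through `e_α3 - ε⁻¹ Θ_α
e_33` (`viscPair_strainHess`, `strain_transverse`). This produces `K`, `Φ̂^λσ`, and one extra term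
`w^σ ∂_ξ w^α η_ασ`. Symmetrized, the extra term is a `ξ`-derivative and integrates to zero because
the velocity vanishes on both blades (`integral_fibre_deriv_eq_zero`). Fubini along the fibres turns
the rest into the variational form on `D`.

The `H²₀` version follows by passing to the limit. The pointwise version follows from two
integrations by parts and the fundamental lemma. Ellipticity holds because the quartic form of `K`
is `2μr³|ζ|² ∫ (ζ·w)² dξ`. -/

namespace Blade

/-! ### Limits and derivatives of curves in `L^q` -/

section LpConvergence

variable {X ι : Type} [MeasurableSpace X]

/-- `F n → G` in `L^q(ν)` along `l`, where `F n ∈ L^q(ν)` eventually. -/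
structure LpTendsto (ν : Measure X) (q : ENNReal) (l : Filter ι) (F : ι → X → ℝ) (G : X → ℝ) :
    Prop where
  memLp : ∀ᶠ n in l, MemLp (F n) q ν
  memLp_lim : MemLp G q ν
  tendsto : Tendsto (fun n => eLpNorm (F n - G) q ν) l (𝓝 0)

variable {ν : Measure X} {p q r : ENNReal} {l : Filter ι} {F F' : ι → X → ℝ} {G G' : X → ℝ}

theorem LpTendsto.const (h : MemLp G q ν) : LpTendsto ν q l (fun _ => G) G :=
  ⟨Eventually.of_forall fun _ => h, h, by simpa using tendsto_const_nhds⟩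

theorem LpTendsto.of_le (hF : ∀ᶠ n in l, MemLp (F n) q ν) (hG : MemLp G q ν)
    {u : ι → ENNReal} (hu : Tendsto u l (𝓝 0)) (h : ∀ᶠ n in l, eLpNorm (F n - G) q ν ≤ u n) :
    LpTendsto ν q l F G :=
  ⟨hF, hG, tendsto_of_tendsto_of_tendsto_of_le_of_le' tendsto_const_nhds hu
    (Eventually.of_forall fun _ => zero_le) h⟩

theorem LpTendsto.congr' (h : LpTendsto ν q l F G) (hF : ∀ᶠ n in l, F n =ᵐ[ν] F' n)
    (hG : G =ᵐ[ν] G') : LpTendsto ν q l F' G' := by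
  refine .of_le ?_ (h.memLp_lim.ae_eq hG) h.tendsto ?_
  · filter_upwards [h.memLp, hF] with n h1 h2 using h1.ae_eq h2
  · filter_upwards [hF] with n h2
    refine (eLpNorm_congr_ae ?_).le
    filter_upwards [h2, hG] with x h3 h4
    simp [h3, h4]

theorem LpTendsto.congr (h : LpTendsto ν q l F G) (hF : ∀ n x, F n x = F' n x)
    (hG : ∀ x, G x = G' x) : LpTendsto ν q l F' G' := by
  obtain rfl : F = F' := funext fun n => funext fun x => hF n x
  obtain rfl : G = G' := funext hG
  exact h

theorem LpTendsto.add [hq : Fact (1 ≤ q)] (h : LpTendsto ν q l F G) (h' : LpTendsto ν q l F' G') :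
    LpTendsto ν q l (fun n x => F n x + F' n x) (fun x => G x + G' x) := by
  refine .of_le (u := fun n => eLpNorm (F n - G) q ν + eLpNorm (F' n - G') q ν) ?_
    (h.memLp_lim.add h'.memLp_lim) (by simpa using h.tendsto.add h'.tendsto) ?_
  · filter_upwards [h.memLp, h'.memLp] with n h1 h2 using h1.add h2
  · filter_upwards [h.memLp, h'.memLp] with n h1 h2
    have : ((fun x => F n x + F' n x) - fun x => G x + G' x) = (F n - G) + (F' n - G') := by
      ext x; simp; ring
    rw [this]
    exact eLpNorm_add_le (h1.sub h.memLp_lim).1 (h2.sub h'.memLp_lim).1 hq.out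

theorem LpTendsto.neg (h : LpTendsto ν q l F G) :
    LpTendsto ν q l (fun n x => -F n x) (fun x => -G x) := by
  refine .of_le ?_ h.memLp_lim.neg h.tendsto ?_
  · filter_upwards [h.memLp] with n h1 using h1.neg
  · refine Eventually.of_forall fun n => ?_
    rw [← eLpNorm_neg]
    refine (congrArg (eLpNorm · q ν) ?_).le
    ext x; simp; ring

theorem LpTendsto.sub [Fact (1 ≤ q)] (h : LpTendsto ν q l F G) (h' : LpTendsto ν q l F' G') :
    LpTendsto ν q l (fun n x => F n x - F' n x) (fun x => G x - G' x) :=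
  (h.add h'.neg).congr (fun _ _ => (sub_eq_add_neg _ _).symm) fun _ => (sub_eq_add_neg _ _).symm

theorem LpTendsto.sum [Fact (1 ≤ q)] {κ : Type} (s : Finset κ) {F : κ → ι → X → ℝ} {G : κ → X → ℝ}
    (h : ∀ k, LpTendsto ν q l (F k) (G k)) :
    LpTendsto ν q l (fun n x => ∑ k ∈ s, F k n x) (fun x => ∑ k ∈ s, G k x) := by
  classical
  induction s using Finset.induction_on with
  | empty => simpa using LpTendsto.const (MemLp.zero' (ε := ℝ))
  | insert a s ha ih =>
    exact ((h a).add ih).congr (fun _ _ => by rw [Finset.sum_insert ha])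
      fun _ => by rw [Finset.sum_insert ha]

/-- Hölder's inequality applied to the three terms of `(F - G)(F' - G') + (F - G) G' + G (F' - G')`.
The pairings needed below are `L^∞ · L^q → L^q` and `L² · L² → L¹`. -/
theorem LpTendsto.mul_of_holder [hr : Fact (1 ≤ r)] [ENNReal.HolderTriple p q r]
    (h : LpTendsto ν p l F G) (h' : LpTendsto ν q l F' G') :
    LpTendsto ν r l (fun n x => F n x * F' n x) (fun x => G x * G' x) := by
  have key : ∀ {f g : X → ℝ}, MemLp f p ν → MemLp g q ν →
      eLpNorm (f * g) r ν ≤ eLpNorm f p ν * eLpNorm g q ν := fun {f g} hf hg => by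
    have := eLpNorm_smul_le_mul_eLpNorm (p := p) (q := q) (r := r) hg.1 hf.1
    rwa [smul_eq_mul] at this
  refine .of_le (u := fun n => eLpNorm (F n - G) p ν * eLpNorm (F' n - G') q ν +
    eLpNorm (F n - G) p ν * eLpNorm G' q ν + eLpNorm G p ν * eLpNorm (F' n - G') q ν) ?_
    (h'.memLp_lim.mul h.memLp_lim) ?_ ?_
  · filter_upwards [h.memLp, h'.memLp] with n h1 h2 using h2.mul h1
  · have h1 := ENNReal.Tendsto.mul h.tendsto (by simp) h'.tendsto (by simp)
    have h2 := ENNReal.Tendsto.mul_const (b := eLpNorm G' q ν) h.tendsto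
      (Or.inr h'.memLp_lim.2.ne)
    have h3 := ENNReal.Tendsto.const_mul (a := eLpNorm G p ν) h'.tendsto
      (Or.inr h.memLp_lim.2.ne)
    simpa using (h1.add h2).add h3
  · filter_upwards [h.memLp, h'.memLp] with n h1 h2
    have e : ((fun x => F n x * F' n x) - fun x => G x * G' x) =
        (F n - G) * (F' n - G') + (F n - G) * G' + G * (F' n - G') := by
      ext x; simp; ring
    have d1 := h1.sub h.memLp_lim
    have d2 := h2.sub h'.memLp_lim
    have m1 : MemLp ((F n - G) * (F' n - G')) r ν := d2.mul d1
    have m2 : MemLp ((F n - G) * G') r ν := h'.memLp_lim.mul d1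
    have m3 : MemLp (G * (F' n - G')) r ν := d2.mul h.memLp_lim
    rw [e]
    refine (eLpNorm_add_le (m1.add m2).1 m3.1 hr.out).trans
      (add_le_add ((eLpNorm_add_le m1.1 m2.1 hr.out).trans (add_le_add ?_ ?_)) ?_)
    exacts [key d1 d2, key d1 h'.memLp_lim, key h.memLp_lim d2]

theorem LpTendsto.mul [Fact (1 ≤ q)] (h : LpTendsto ν ⊤ l F G) (h' : LpTendsto ν q l F' G') :
    LpTendsto ν q l (fun n x => F n x * F' n x) (fun x => G x * G' x) :=
  h.mul_of_holder h'

theorem LpTendsto.mul_two (h : LpTendsto ν 2 l F G) (h' : LpTendsto ν 2 l F' G') :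
    LpTendsto ν 1 l (fun n x => F n x * F' n x) (fun x => G x * G' x) :=
  h.mul_of_holder h'

theorem LpTendsto.pow (h : LpTendsto ν ⊤ l F G) (k : ℕ) :
    LpTendsto ν ⊤ l (fun n x => F n x ^ k) (fun x => G x ^ k) := by
  induction k with
  | zero => simpa using LpTendsto.const (memLp_top_const (1 : ℝ))
  | succ k ih => exact (h.mul ih).congr (fun _ _ => by ring) fun _ => by ring

theorem LpTendsto.const_mul [Fact (1 ≤ q)] (c : ℝ) (h : LpTendsto ν q l F G) :
    LpTendsto ν q l (fun n x => c * F n x) (fun x => c * G x) :=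
  (LpTendsto.const (memLp_top_const c)).mul h

theorem LpTendsto.of_tendsto {a : ι → ℝ} {b : ℝ} (h : Tendsto a l (𝓝 b)) :
    LpTendsto ν ⊤ l (fun n _ => a n) (fun _ => b) := by
  refine .of_le (u := fun n => ENNReal.ofReal ‖a n - b‖)
    (Eventually.of_forall fun _ => memLp_top_const _) (memLp_top_const _) ?_ ?_
  · have : Tendsto (fun n => ‖a n - b‖) l (𝓝 0) := by
      simpa using (h.sub_const b).norm
    simpa using ENNReal.tendsto_ofReal this
  · refine Eventually.of_forall fun n => ?_
    simp only [eLpNorm_exponent_top]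
    refine eLpNormEssSup_le_of_ae_bound (Eventually.of_forall fun x => ?_)
    simp

theorem LpTendsto.of_top [IsFiniteMeasure ν] [Fact (1 ≤ q)] (h : LpTendsto ν ⊤ l F G) :
    LpTendsto ν q l F G :=
  (h.mul (LpTendsto.const (memLp_const (1 : ℝ)))).congr (fun _ _ => mul_one _) fun _ => mul_one _

theorem LpTendsto.integral (h : LpTendsto ν 1 l F G) :
    Tendsto (fun n => ∫ x, F n x ∂ν) l (𝓝 (∫ x, G x ∂ν)) :=
  tendsto_integral_of_L1' G h.memLp_lim.1
    (h.memLp.mono fun _ hn => memLp_one_iff_integrable.1 hn) h.tendsto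

/-- `G` is the derivative at `t = 0`, in `L^q(ν)`, of the curve `F` in `L^q(ν)`. -/
structure LpDeriv (ν : Measure X) (q : ENNReal) (F : ℝ → X → ℝ) (G : X → ℝ) : Prop where
  memLp_zero : MemLp (F 0) q ν
  quotient : LpTendsto ν q (𝓝[≠] 0) (fun t x => t⁻¹ * (F t x - F 0 x)) G

variable {F F' : ℝ → X → ℝ}

/-- For `t ≠ 0` one has `F t = F 0 + t · (difference quotient)`, and the quotients converge. -/
theorem LpDeriv.tendsto [Fact (1 ≤ q)] (h : LpDeriv ν q F G) :
    LpTendsto ν q (𝓝[≠] 0) F (F 0) := by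
  have ht : Tendsto (fun t : ℝ => t) (𝓝[≠] 0) (𝓝 0) := tendsto_id.mono_left nhdsWithin_le_nhds
  refine ((LpTendsto.const h.memLp_zero).add
    ((LpTendsto.of_tendsto ht).mul h.quotient)).congr' ?_ (Eventually.of_forall fun x => by simp)
  filter_upwards [self_mem_nhdsWithin] with t (ht : t ≠ 0)
  refine Eventually.of_forall fun x => ?_
  simp only []
  field_simp
  ring

theorem LpDeriv.const (h : MemLp G q ν) : LpDeriv ν q (fun _ => G) (fun _ => 0) :=
  ⟨h, by simpa using LpTendsto.const (MemLp.zero' (ε := ℝ))⟩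

theorem LpDeriv.congr (h : LpDeriv ν q F G) (hF : ∀ n x, F n x = F' n x)
    (hG : ∀ x, G x = G' x) : LpDeriv ν q F' G' := by
  obtain rfl : F = F' := funext fun n => funext fun x => hF n x
  obtain rfl : G = G' := funext hG
  exact h

theorem LpDeriv.congr_ae (h : LpDeriv ν q F G) (hF : ∀ n, F n =ᵐ[ν] F' n)
    (hG : G =ᵐ[ν] G') : LpDeriv ν q F' G' := by
  refine ⟨h.1.ae_eq (hF 0), h.2.congr' (Eventually.of_forall fun t => ?_) hG⟩
  filter_upwards [hF t, hF 0] with x h1 h2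
  rw [h1, h2]

theorem LpDeriv.add [Fact (1 ≤ q)] (h : LpDeriv ν q F G) (h' : LpDeriv ν q F' G') :
    LpDeriv ν q (fun n x => F n x + F' n x) (fun x => G x + G' x) :=
  ⟨h.1.add h'.1, (h.2.add h'.2).congr (fun _ _ => by ring) fun _ => rfl⟩

theorem LpDeriv.sum [Fact (1 ≤ q)] {κ : Type} (s : Finset κ) {F : κ → ℝ → X → ℝ} {G : κ → X → ℝ}
    (h : ∀ k, LpDeriv ν q (F k) (G k)) :
    LpDeriv ν q (fun n x => ∑ k ∈ s, F k n x) (fun x => ∑ k ∈ s, G k x) := by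
  refine ⟨memLp_finsetSum _ fun k _ => (h k).1, (LpTendsto.sum s fun k => (h k).2).congr
    (fun _ _ => ?_) fun _ => rfl⟩
  rw [← Finset.mul_sum, Finset.sum_sub_distrib]

/-- The quotient of a product is (quotient of `F`) · `F' t` + `F 0` · (quotient of `F'`), so the
product rule reduces to limits of products. -/
theorem LpDeriv.mul_of_holder [Fact (1 ≤ p)] [Fact (1 ≤ q)] [hr : Fact (1 ≤ r)]
    [ENNReal.HolderTriple p q r] (h : LpDeriv ν p F G) (h' : LpDeriv ν q F' G') :
    LpDeriv ν r (fun n x => F n x * F' n x) (fun x => G x * F' 0 x + F 0 x * G' x) :=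
  ⟨h'.1.mul h.1, ((h.2.mul_of_holder h'.tendsto).add
    ((LpTendsto.const h.1).mul_of_holder h'.2)).congr (fun _ _ => by ring) fun _ => rfl⟩

theorem LpDeriv.mul [Fact (1 ≤ q)] (h : LpDeriv ν ⊤ F G) (h' : LpDeriv ν q F' G') :
    LpDeriv ν q (fun n x => F n x * F' n x) (fun x => G x * F' 0 x + F 0 x * G' x) :=
  h.mul_of_holder h'

theorem LpDeriv.mul_two (h : LpDeriv ν 2 F G) (h' : LpDeriv ν 2 F' G') :
    LpDeriv ν 1 (fun n x => F n x * F' n x) (fun x => G x * F' 0 x + F 0 x * G' x) :=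
  h.mul_of_holder h'

theorem LpDeriv.const_mul [Fact (1 ≤ q)] (c : ℝ) (h : LpDeriv ν q F G) :
    LpDeriv ν q (fun n x => c * F n x) (fun x => c * G x) :=
  ((LpDeriv.const (memLp_top_const c)).mul h).congr (fun _ _ => rfl) fun _ => by ring

theorem LpDeriv.of_top [IsFiniteMeasure ν] [Fact (1 ≤ q)] (h : LpDeriv ν ⊤ F G) :
    LpDeriv ν q F G :=
  ⟨h.1.mono_exponent le_top, h.2.of_top⟩

/-- The difference quotient of an affine curve is exactly `G'` for every `t ≠ 0`. The derivatives of
`Θ + t • η` are curves of this kind. -/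
theorem LpDeriv.line (h : MemLp G ⊤ ν) (h' : MemLp G' ⊤ ν) :
    LpDeriv ν ⊤ (fun t x => G x + t * G' x) G' := by
  refine ⟨by simpa using h, (LpTendsto.const h').congr' ?_ (Eventually.of_forall fun x => rfl)⟩
  filter_upwards [self_mem_nhdsWithin] with t (ht : t ≠ 0)
  refine Eventually.of_forall fun x => ?_
  simp only []
  field_simp
  ring

theorem LpDeriv.hasDerivAt_integral (h : LpDeriv ν 1 F G) :
    HasDerivAt (fun t => ∫ x, F t x ∂ν) (∫ x, G x ∂ν) 0 := by
  rw [hasDerivAt_iff_tendsto_slope]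
  have h0 : Integrable (F 0) ν := memLp_one_iff_integrable.1 h.1
  refine h.2.integral.congr' ?_
  filter_upwards [h.tendsto.memLp] with t ht
  rw [integral_const_mul, integral_sub (memLp_one_iff_integrable.1 ht) h0, slope_def_field,
    div_eq_inv_mul, sub_zero]

end LpConvergence

/-! ### Partial derivatives -/

section PartialDerivatives

variable {u v : Plane → ℝ} {x : Plane}

theorem pd_mul (α : Fin 2) (hu : DifferentiableAt ℝ u x) (hv : DifferentiableAt ℝ v x) :
    pd α (fun y => u y * v y) x = pd α u x * v x + u x * pd α v x := by
  simp only [pd]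
  rw [show (fun y => u y * v y) = u * v from rfl, fderiv_mul hu hv]
  simp
  ring

theorem pd_add (α : Fin 2) (hu : DifferentiableAt ℝ u x) (hv : DifferentiableAt ℝ v x) :
    pd α (fun y => u y + v y) x = pd α u x + pd α v x := by
  simp only [pd]
  rw [show (fun y => u y + v y) = u + v from rfl, fderiv_add hu hv]
  simp

theorem pd_const (α : Fin 2) (c : ℝ) : pd α (fun _ => c) x = 0 := by
  simp [pd]

theorem pd_coord (α i : Fin 2) (x : Plane) : pd α (fun y => y i) x = kron α i := by
  have : (fun y : Plane => y i) = EuclideanSpace.proj (𝕜 := ℝ) i := rfl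
  simp only [pd, this, ContinuousLinearMap.fderiv]
  simp [kron, eq_comm]

theorem differentiable_coord (i : Fin 2) : Differentiable ℝ fun y : Plane => y i :=
  (EuclideanSpace.proj (𝕜 := ℝ) i).differentiable

theorem pd_sq_coord (α : Fin 2) : pd α (fun y => y 1 ^ 2) x = 2 * x 1 * kron α 1 := by
  have h := pd_mul α (differentiable_coord 1 x) (differentiable_coord 1 x)
  simp only [← pow_two, pd_coord] at h
  rw [h]
  ring

theorem contDiff_pd {n : ℕ} {u : Plane → ℝ} (hu : ContDiff ℝ (n + 1) u) (α : Fin 2) :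
    ContDiff ℝ n (pd α u) :=
  (hu.fderiv_right le_rfl).clm_apply contDiff_const

theorem differentiable_pd {u : Plane → ℝ} (hu : ContDiff ℝ 2 u) (α : Fin 2) :
    Differentiable ℝ (pd α u) :=
  (contDiff_pd (n := 1) hu α).differentiable one_ne_zero

theorem continuous_pd {u : Plane → ℝ} (hu : ContDiff ℝ 2 u) (α : Fin 2) :
    Continuous (pd α u) :=
  (contDiff_pd (n := 1) hu α).continuous

theorem continuous_pd_pd {u : Plane → ℝ} (hu : ContDiff ℝ 2 u) (α β : Fin 2) :
    Continuous (pd α (pd β u)) :=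
  (contDiff_pd (n := 0) (contDiff_pd (n := 1) hu β) α).continuous

theorem pd_comm {u : Plane → ℝ} (hu : ContDiff ℝ 2 u) (α β : Fin 2) (x : Plane) :
    pd α (pd β u) x = pd β (pd α u) x := by
  have hd : DifferentiableAt ℝ (fderiv ℝ u) x :=
    (hu.fderiv_right (m := 1) (by norm_num)).differentiable one_ne_zero x
  have key : ∀ a b : Fin 2, pd a (pd b u) x =
      fderiv ℝ (fderiv ℝ u) x (EuclideanSpace.single a 1) (EuclideanSpace.single b 1) := by
    intro a b
    unfold pd
    rw [fderiv_clm_apply hd (differentiableAt_const _)]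
    simp
  rw [key, key]
  exact (hu.contDiffAt.isSymmSndFDerivAt (by simp)) _ _

theorem pd_line {u v : Plane → ℝ} (hu : Differentiable ℝ u) (hv : Differentiable ℝ v)
    (α : Fin 2) (t : ℝ) : pd α (u + t • v) = pd α u + t • pd α v := by
  ext x
  simp only [pd, Pi.add_apply, Pi.smul_apply]
  rw [fderiv_add (hu x) ((hv x).const_smul t), fderiv_const_smul (hv x)]
  simp

end PartialDerivatives

/-! ### The metric -/

section Metric

variable {ε : ℝ} {Θ : Plane → ℝ} {x : Plane}

theorem gLow_symm (i j : Fin 3) : gLow ε Θ x i j = gLow ε Θ x j i := by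
  fin_cases i <;> fin_cases j <;> simp [gLow] <;> ring

theorem gUp_symm (i j : Fin 3) : gUp ε Θ x i j = gUp ε Θ x j i := by
  fin_cases i <;> fin_cases j <;> simp [gUp]

theorem gLow_mul_gUp (hε : ε ≠ 0) (hx : x 1 ≠ 0) (i j : Fin 3) :
    ∑ k, gLow ε Θ x i k * gUp ε Θ x k j = if i = j then 1 else 0 := by
  fin_cases i <;> fin_cases j <;>
    simp [gLow, gUp, gradSq, Fin.sum_univ_three] <;> field_simp <;> ring

/-- The explicit form of `∂g_ij/∂x^a`. -/
noncomputable def gLowPartial (ε : ℝ) (Θ : Plane → ℝ) (x : Plane) (a : Fin 2) : Fin 3 → Fin 3 → ℝ :=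
  assemble
    (fun α β => 2 * x 1 * kron a 1 * (pd α Θ x * pd β Θ x) +
      x 1 ^ 2 * (pd a (pd α Θ) x * pd β Θ x + pd α Θ x * pd a (pd β Θ) x))
    (fun α => ε * (2 * x 1 * kron a 1 * pd α Θ x + x 1 ^ 2 * pd a (pd α Θ) x))
    (ε ^ 2 * (2 * x 1 * kron a 1))

/-- Polynomial expressions in `r`, `Θ_α` and `Θ_αβ` allow limits and derivatives in `L^∞` to be
taken factor by factor. -/
theorem pd_gLow (hΘ : ContDiff ℝ 2 Θ) (a : Fin 2) (i j : Fin 3) :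
    pd a (fun y => gLow ε Θ y i j) x = gLowPartial ε Θ x a i j := by
  have hr : Differentiable ℝ fun y : Plane => y 1 ^ 2 := (differentiable_coord 1).pow 2
  have hp := differentiable_pd hΘ
  have hrp : ∀ α, Differentiable ℝ fun y => y 1 ^ 2 * pd α Θ y := fun α => hr.mul (hp α)
  have hrpp : ∀ α β, Differentiable ℝ fun y => y 1 ^ 2 * pd α Θ y * pd β Θ y :=
    fun α β => (hrp α).mul (hp β)
  have h1 : ∀ α, pd a (fun y => y 1 ^ 2 * pd α Θ y) x =
      2 * x 1 * kron a 1 * pd α Θ x + x 1 ^ 2 * pd a (pd α Θ) x := fun α => by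
    rw [pd_mul a (hr x) (hp α x), pd_sq_coord]
  have h2 : ∀ α β, pd a (fun y => y 1 ^ 2 * pd α Θ y * pd β Θ y) x =
      2 * x 1 * kron a 1 * (pd α Θ x * pd β Θ x) +
      x 1 ^ 2 * (pd a (pd α Θ) x * pd β Θ x + pd α Θ x * pd a (pd β Θ) x) := fun α β => by
    rw [pd_mul a (hrp α x) (hp β x), h1]
    ring
  have h3 : ∀ α β, pd a (fun y => 1 + y 1 ^ 2 * pd α Θ y * pd β Θ y) x =
      2 * x 1 * kron a 1 * (pd α Θ x * pd β Θ x) +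
      x 1 ^ 2 * (pd a (pd α Θ) x * pd β Θ x + pd α Θ x * pd a (pd β Θ) x) := fun α β => by
    rw [pd_add a (differentiableAt_const _) (hrpp α β x), pd_const, h2,
      zero_add]
  have h4 : ∀ α, pd a (fun y => ε * y 1 ^ 2 * pd α Θ y) x =
      ε * (2 * x 1 * kron a 1 * pd α Θ x + x 1 ^ 2 * pd a (pd α Θ) x) := fun α => by
    simp_rw [mul_assoc ε]
    rw [pd_mul a (differentiableAt_const _) (hrp α x), pd_const, h1]
    ring
  have h5 : pd a (fun y => ε ^ 2 * y 1 ^ 2) x = ε ^ 2 * (2 * x 1 * kron a 1) := by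
    rw [pd_mul a (differentiableAt_const _) (hr x), pd_const, pd_sq_coord]
    ring
  fin_cases i <;> fin_cases j <;> simp [gLow, gLowPartial, assemble, h2, h3, h4, h5]

theorem gLowDeriv_eq (hΘ : ContDiff ℝ 2 Θ) (k i j : Fin 3) :
    gLowDeriv ε Θ x k i j =
      ![gLowPartial ε Θ x 0 i j, gLowPartial ε Θ x 1 i j, 0] k := by
  simp [gLowDeriv, pd_gLow hΘ]

theorem gLowDeriv_symm (k i j : Fin 3) : gLowDeriv ε Θ x k i j = gLowDeriv ε Θ x k j i := by
  simp only [gLowDeriv]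
  rw [show (fun y => gLow ε Θ y i j) = fun y => gLow ε Θ y j i from funext fun y => gLow_symm i j]

/-- Lowering the upper index cancels the inverse metric and leaves the Christoffel symbols of the
first kind. -/
theorem lower_christoffel (hε : ε ≠ 0) (hx : x 1 ≠ 0) (a j k : Fin 3) :
    ∑ i, gLow ε Θ x a i * christoffel ε Θ x i j k =
      (1 / 2) * (gLowDeriv ε Θ x j k a + gLowDeriv ε Θ x k j a - gLowDeriv ε Θ x a j k) := by
  have h : ∀ l, ∑ i, gLow ε Θ x a i * gUp ε Θ x i l = if a = l then 1 else 0 :=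
    gLow_mul_gUp hε hx a
  calc ∑ i, gLow ε Θ x a i * christoffel ε Θ x i j k
      = (1 / 2) * ∑ l, (∑ i, gLow ε Θ x a i * gUp ε Θ x i l) *
          (gLowDeriv ε Θ x j k l + gLowDeriv ε Θ x k j l - gLowDeriv ε Θ x l j k) := by
        simp only [christoffel, Fin.sum_univ_three]
        ring
    _ = _ := by simp [h]

/-- The strain rate tensor is half the Lie derivative of the metric. -/
theorem strain_eq_lie (hε : ε ≠ 0) {p : Pt} (hx : p.1 1 ≠ 0) (w : Field) (i j : Fin 3) :
    strain ε Θ w p i j = (1 / 2) * ∑ k, ((w k).val p * gLowDeriv ε Θ p.1 k i j +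
      (gLow ε Θ p.1 j k * (w k).grad p i + gLow ε Θ p.1 i k * (w k).grad p j)) := by
  have h1 := fun k => lower_christoffel (Θ := Θ) hε hx j i k
  have h2 := fun k => lower_christoffel (Θ := Θ) hε hx i j k
  have e : strain ε Θ w p i j = (1 / 2) * ∑ k, ((w k).val p *
      (∑ m, gLow ε Θ p.1 j m * christoffel ε Θ p.1 m i k +
        ∑ m, gLow ε Θ p.1 i m * christoffel ε Θ p.1 m j k) +
      (gLow ε Θ p.1 j k * (w k).grad p i + gLow ε Θ p.1 i k * (w k).grad p j)) := by
    simp only [strain, cov, Fin.sum_univ_three]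
    ring
  rw [e]
  congr 1
  refine Finset.sum_congr rfl fun k _ => ?_
  -- In the sum of the symbols of the first kind for `(j; i, k)` and `(i; j, k)`, everything cancels
  -- except `∂_k g_ij`.
  rw [h1, h2, gLowDeriv_symm k j i, gLowDeriv_symm i k j, gLowDeriv_symm j k i]
  ring

theorem strain_symm (w : Field) (p : Pt) (i j : Fin 3) :
    strain ε Θ w p i j = strain ε Θ w p j i := by
  simp only [strain, Fin.sum_univ_three]
  ring

/-- The contracted symbol is `½ g^il ∂_k g_il = ∂_k log √g` with `√g = εr`. Hence the divergence is
the same for all surfaces, which makes the incompressibility constraint linear along the variation.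
-/
theorem divg_eq (hε : ε ≠ 0) (hΘ : ContDiff ℝ 2 Θ) {p : Pt} (hx : p.1 1 ≠ 0) (w : Field) :
    divg ε Θ w p = ∑ i, (w i).grad p i + (p.1 1)⁻¹ * (w 1).val p := by
  have h : ∀ k, ∑ i, christoffel ε Θ p.1 i i k = ![0, (p.1 1)⁻¹, 0] k := by
    intro k
    have e : ∑ i, christoffel ε Θ p.1 i i k =
        (1 / 2) * ∑ i, ∑ l, gUp ε Θ p.1 i l * gLowDeriv ε Θ p.1 k i l := by
      simp only [christoffel, Fin.sum_univ_three]
      rw [gUp_symm 1 0, gUp_symm 2 0, gUp_symm 2 1, gLowDeriv_symm 2 1 k, gLowDeriv_symm 2 0 k,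
        gLowDeriv_symm 1 0 k, gLowDeriv_symm 1 2 k, gLowDeriv_symm 0 1 k, gLowDeriv_symm 0 2 k,
        gLowDeriv_symm 0 0 k, gLowDeriv_symm 1 1 k, gLowDeriv_symm 2 2 k]
      ring
    rw [e]
    fin_cases k <;>
      simp [gLowDeriv_eq hΘ, gLowPartial, assemble, gUp, gradSq, Fin.sum_univ_three, kron] <;>
      field_simp <;> ring
  have h2 : divg ε Θ w p =
      ∑ i, (w i).grad p i + ∑ k, (∑ i, christoffel ε Θ p.1 i i k) * (w k).val p := by
    simp only [divg, cov, Fin.sum_univ_three]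
    ring
  rw [h2]
  simp only [h]
  simp [Fin.sum_univ_three]

theorem sum_sum_comm {κ : Type} [Fintype κ] (f : κ → κ → κ → κ → ℝ) :
    ∑ i, ∑ j, ∑ k, ∑ l, f i j k l = ∑ k, ∑ l, ∑ i, ∑ j, f i j k l := by
  have := Finset.sum_comm (s := Finset.univ) (t := Finset.univ)
    (f := fun a b : κ × κ => f a.1 a.2 b.1 b.2)
  simpa only [Fintype.sum_prod_type] using this

/-- This is the major symmetry `A^ijkl = A^klij`. -/
theorem viscPair_comm (μ : ℝ) (s t : Fin 3 → Fin 3 → ℝ) :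
    viscPair μ ε Θ x s t = viscPair μ ε Θ x t s := by
  unfold viscPair
  rw [sum_sum_comm]
  refine Finset.sum_congr rfl fun i _ => Finset.sum_congr rfl fun j _ =>
    Finset.sum_congr rfl fun k _ => Finset.sum_congr rfl fun l _ => ?_
  simp only [visc]
  rw [gUp_symm k i, gUp_symm l j, gUp_symm k j, gUp_symm l i]
  ring

theorem viscPair_add_right (μ : ℝ) (s t t' : Fin 3 → Fin 3 → ℝ) :
    viscPair μ ε Θ x s (fun i j => t i j + t' i j) =
      viscPair μ ε Θ x s t + viscPair μ ε Θ x s t' := by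
  simp only [viscPair, mul_add, Finset.sum_add_distrib]

theorem viscPair_mul_right (μ c : ℝ) (s t : Fin 3 → Fin 3 → ℝ) :
    viscPair μ ε Θ x s (fun i j => c * t i j) = c * viscPair μ ε Θ x s t := by
  simp only [viscPair, Finset.mul_sum]
  refine Finset.sum_congr rfl fun i _ => Finset.sum_congr rfl fun j _ =>
    Finset.sum_congr rfl fun k _ => Finset.sum_congr rfl fun l _ => ?_
  ring

end Metric

/-! ### Bounded coefficients on the flow passage -/

namespace Passage

variable (P : Passage)

theorem vol_eq_prod :
    P.vol = (volume.restrict P.D).prod (volume.restrict (Ioo (-1 : ℝ) 1)) := by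
  rw [Measure.prod_restrict]
  rfl

theorem measure_D_lt_top : volume P.D < ⊤ := P.isBounded_D.measure_lt_top

instance isFiniteMeasure_restrict_D : IsFiniteMeasure (volume.restrict P.D) :=
  ⟨by simpa using P.measure_D_lt_top⟩

instance isFiniteMeasure_vol : IsFiniteMeasure P.vol := by
  rw [vol_eq_prod]
  infer_instance

theorem isOpen_region : IsOpen (P.D ×ˢ Ioo (-1 : ℝ) 1) := P.isOpen_D.prod isOpen_Ioo

theorem ae_mem : ∀ᵐ p ∂P.vol, p ∈ P.D ×ˢ Ioo (-1 : ℝ) 1 :=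
  ae_restrict_mem P.isOpen_region.measurableSet

theorem exists_radius_le : ∃ r₀ : ℝ, 0 < r₀ ∧ ∀ x ∈ closure P.D, r₀ ≤ x 1 := by
  obtain ⟨r₀, h0, h⟩ := P.radius_pos
  refine ⟨r₀, h0, fun x hx => ?_⟩
  exact closure_minimal (t := {x : Plane | r₀ ≤ x 1}) h
    (isClosed_le continuous_const (differentiable_coord 1).continuous) hx

theorem radius_ne_zero {x : Plane} (hx : x ∈ closure P.D) : x 1 ≠ 0 := by
  obtain ⟨r₀, h0, h⟩ := P.exists_radius_le
  exact (h0.trans_le (h x hx)).ne'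

theorem radius_pos' {x : Plane} (hx : x ∈ P.D) : 0 < x 1 := by
  obtain ⟨r₀, h0, h⟩ := P.radius_pos
  exact h0.trans_le (h x hx)

theorem ae_radius_ne_zero : ∀ᵐ p ∂P.vol, p.1 1 ≠ 0 := by
  filter_upwards [P.ae_mem] with p hp using P.radius_ne_zero (subset_closure hp.1)

/-- The closure of `Ω` is compact. Every bound on a coefficient below comes from here. -/
theorem memLp_top_of_continuousOn {f : Pt → ℝ}
    (hf : ContinuousOn f (closure P.D ×ˢ Icc (-1 : ℝ) 1)) : MemLp f ⊤ P.vol := by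
  have hc : IsCompact (closure P.D ×ˢ Icc (-1 : ℝ) 1) :=
    P.isBounded_D.isCompact_closure.prod isCompact_Icc
  have hs : P.D ×ˢ Ioo (-1 : ℝ) 1 ⊆ closure P.D ×ˢ Icc (-1 : ℝ) 1 :=
    prod_mono subset_closure Ioo_subset_Icc_self
  obtain ⟨C, hC⟩ := hc.exists_bound_of_continuousOn hf
  refine memLp_top_of_bound ((hf.mono hs).aestronglyMeasurable P.isOpen_region.measurableSet) C ?_
  filter_upwards [P.ae_mem] with p hp using hC p (hs hp)

theorem memLp_top_fst {c : Plane → ℝ} (hc : ContinuousOn c (closure P.D)) :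
    MemLp (fun p : Pt => c p.1) ⊤ P.vol :=
  P.memLp_top_of_continuousOn (hc.comp continuousOn_fst fun _ hp => hp.1)

theorem memLp_radius : MemLp (fun p : Pt => p.1 1) ⊤ P.vol :=
  P.memLp_top_fst (differentiable_coord 1).continuous.continuousOn

theorem memLp_radius_inv : MemLp (fun p : Pt => (p.1 1)⁻¹) ⊤ P.vol :=
  P.memLp_top_fst (c := fun x => (x 1)⁻¹)
    ((differentiable_coord 1).continuous.continuousOn.inv₀ fun _ hx => P.radius_ne_zero hx)

end Passage

/-! ### Continuity of the coefficients and of the kinematic quantities in the surface and the field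
-/

section Convergence

variable {X ι : Type} [MeasurableSpace X] {ν : Measure X} {q : ENNReal} {l : Filter ι}

theorem LpTendsto.assemble {a : Fin 2 → Fin 2 → ι → X → ℝ} {b : Fin 2 → ι → X → ℝ}
    {c : ι → X → ℝ} {a' : Fin 2 → Fin 2 → X → ℝ} {b' : Fin 2 → X → ℝ} {c' : X → ℝ}
    (ha : ∀ α β, LpTendsto ν q l (a α β) (a' α β)) (hb : ∀ α, LpTendsto ν q l (b α) (b' α))
    (hc : LpTendsto ν q l c c') (i j : Fin 3) :
    LpTendsto ν q l
      (fun n x => Blade.assemble (fun α β => a α β n x) (fun α => b α n x) (c n x) i j)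
      (fun x => Blade.assemble (fun α β => a' α β x) (fun α => b' α x) (c' x) i j) := by
  fin_cases i <;> fin_cases j <;> first | exact ha _ _ | exact hb _ | exact hc

theorem LpDeriv.assemble {a : Fin 2 → Fin 2 → ℝ → X → ℝ} {b : Fin 2 → ℝ → X → ℝ}
    {c : ℝ → X → ℝ} {a' : Fin 2 → Fin 2 → X → ℝ} {b' : Fin 2 → X → ℝ} {c' : X → ℝ}
    (ha : ∀ α β, LpDeriv ν q (a α β) (a' α β)) (hb : ∀ α, LpDeriv ν q (b α) (b' α))
    (hc : LpDeriv ν q c c') (i j : Fin 3) :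
    LpDeriv ν q
      (fun n x => Blade.assemble (fun α β => a α β n x) (fun α => b α n x) (c n x) i j)
      (fun x => Blade.assemble (fun α β => a' α β x) (fun α => b' α x) (c' x) i j) := by
  fin_cases i <;> fin_cases j <;> first | exact ha _ _ | exact hb _ | exact hc

end Convergence

/-- Divisions become multiplications by the bounded factors `ε⁻¹` and `r⁻¹`, so that the product
rules apply. -/
theorem gUp_eq_assemble (ε : ℝ) (Θ : Plane → ℝ) (x : Plane) (i j : Fin 3) :
    gUp ε Θ x i j = assemble kron (fun α => -ε⁻¹ * pd α Θ x)
      ((ε⁻¹) ^ 2 * ((x 1)⁻¹ ^ 2 * (1 + x 1 ^ 2 * (pd 0 Θ x ^ 2 + pd 1 Θ x ^ 2)))) i j := by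
  fin_cases i <;> fin_cases j <;>
    simp [gUp, assemble, kron, gradSq, div_eq_mul_inv, mul_comm, mul_left_comm]

theorem gLow_eq_assemble (ε : ℝ) (Θ : Plane → ℝ) (x : Plane) (i j : Fin 3) :
    gLow ε Θ x i j = assemble (fun α β => kron α β + x 1 ^ 2 * (pd α Θ x * pd β Θ x))
      (fun α => ε * (x 1 ^ 2 * pd α Θ x)) (ε ^ 2 * x 1 ^ 2) i j := by
  fin_cases i <;> fin_cases j <;> simp [gLow, assemble, kron] <;> ring

/-- Convergence of the surfaces `Θs n → Θ` in `C²(D̄)`. -/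
structure SurfaceTendsto {ι : Type} (P : Passage) (l : Filter ι) (Θs : ι → Plane → ℝ)
    (Θ : Plane → ℝ) : Prop where
  contDiff : ∀ n, ContDiff ℝ 2 (Θs n)
  contDiff_lim : ContDiff ℝ 2 Θ
  first : ∀ α, LpTendsto P.vol ⊤ l (fun n p => pd α (Θs n) p.1) (fun p => pd α Θ p.1)
  second : ∀ α β, LpTendsto P.vol ⊤ l (fun n p => pd α (pd β (Θs n)) p.1)
    (fun p => pd α (pd β Θ) p.1)

/-- Convergence of vector fields in `H¹`. -/
def FieldTendsto {ι : Type} (ν : Measure Pt) (l : Filter ι) (W : ι → Field) (w : Field) : Prop :=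
  ∀ i, LpTendsto ν 2 l (fun n => (W n i).val) (w i).val ∧
    ∀ j, LpTendsto ν 2 l (fun n p => (W n i).grad p j) (fun p => (w i).grad p j)

/-- A field with square integrable values and derivatives. -/
def SqIntegrable (ν : Measure Pt) (w : Field) : Prop :=
  ∀ i, MemLp (w i).val 2 ν ∧ ∀ j, MemLp (fun p => (w i).grad p j) 2 ν

theorem FieldTendsto.const {ι : Type} {ν : Measure Pt} {l : Filter ι} {w : Field}
    (h : SqIntegrable ν w) : FieldTendsto ν l (fun _ => w) w :=
  fun i => ⟨.const (h i).1, fun j => .const ((h i).2 j)⟩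

theorem Passage.MemV.sqIntegrable {P : Passage} {w : Field} (h : P.MemV w) :
    SqIntegrable P.vol w :=
  fun i => ⟨(h i).1, (h i).2.1⟩

section SurfaceConvergence

variable {ι : Type} {P : Passage} {l : Filter ι} {Θs : ι → Plane → ℝ} {Θ : Plane → ℝ}

theorem SurfaceTendsto.const (hΘ : ContDiff ℝ 2 Θ) : SurfaceTendsto P l (fun _ => Θ) Θ :=
  ⟨fun _ => hΘ, hΘ, fun α => .const (P.memLp_top_fst (continuous_pd hΘ α).continuousOn),
    fun α β => .const (P.memLp_top_fst (continuous_pd_pd hΘ α β).continuousOn)⟩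

theorem pd_line_apply {Θ η : Plane → ℝ} (hΘ : ContDiff ℝ 2 Θ) (hη : ContDiff ℝ 2 η) (α : Fin 2)
    (t : ℝ) (x : Plane) : pd α (Θ + t • η) x = pd α Θ x + t * pd α η x := by
  rw [pd_line (hΘ.differentiable two_ne_zero) (hη.differentiable two_ne_zero)]
  rfl

theorem pd_pd_line_apply {Θ η : Plane → ℝ} (hΘ : ContDiff ℝ 2 Θ) (hη : ContDiff ℝ 2 η)
    (α β : Fin 2) (t : ℝ) (x : Plane) :
    pd α (pd β (Θ + t • η)) x = pd α (pd β Θ) x + t * pd α (pd β η) x := by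
  rw [pd_line (hΘ.differentiable two_ne_zero) (hη.differentiable two_ne_zero),
    pd_line (differentiable_pd hΘ β) (differentiable_pd hη β)]
  rfl

theorem lpDeriv_pd {η : Plane → ℝ} (hΘ : ContDiff ℝ 2 Θ) (hη : ContDiff ℝ 2 η) (α : Fin 2) :
    LpDeriv P.vol ⊤ (fun (t : ℝ) p => pd α (Θ + t • η) p.1) (fun p => pd α η p.1) :=
  (LpDeriv.line (P.memLp_top_fst (continuous_pd hΘ α).continuousOn)
    (P.memLp_top_fst (continuous_pd hη α).continuousOn)).congr
    (fun _ _ => (pd_line_apply hΘ hη α _ _).symm) fun _ => rfl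

theorem lpDeriv_pd_pd {η : Plane → ℝ} (hΘ : ContDiff ℝ 2 Θ) (hη : ContDiff ℝ 2 η)
    (α β : Fin 2) :
    LpDeriv P.vol ⊤ (fun (t : ℝ) p => pd α (pd β (Θ + t • η)) p.1)
      (fun p => pd α (pd β η) p.1) :=
  (LpDeriv.line (P.memLp_top_fst (continuous_pd_pd hΘ α β).continuousOn)
    (P.memLp_top_fst (continuous_pd_pd hη α β).continuousOn)).congr
    (fun _ _ => (pd_pd_line_apply hΘ hη α β _ _).symm) fun _ => rfl

theorem SurfaceTendsto.line {η : Plane → ℝ} (hΘ : ContDiff ℝ 2 Θ) (hη : ContDiff ℝ 2 η) :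
    SurfaceTendsto P (𝓝[≠] (0 : ℝ)) (fun t => Θ + t • η) Θ :=
  ⟨fun t => hΘ.add (hη.const_smul t), hΘ,
    fun α => ((lpDeriv_pd hΘ hη α).tendsto).congr (fun _ _ => rfl) fun _ => by simp,
    fun α β => ((lpDeriv_pd_pd hΘ hη α β).tendsto).congr (fun _ _ => rfl) fun _ => by simp⟩

variable {W V : ι → Field} {w v : Field}

theorem lpTendsto_radius : LpTendsto P.vol ⊤ l (fun _ p => p.1 1) (fun p : Pt => p.1 1) :=
  .const P.memLp_radius

theorem lpTendsto_radius_inv :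
    LpTendsto P.vol ⊤ l (fun _ p => (p.1 1)⁻¹) (fun p : Pt => (p.1 1)⁻¹) :=
  .const P.memLp_radius_inv

theorem lpTendsto_const (c : ℝ) : LpTendsto P.vol ⊤ l (fun _ _ => c) (fun _ => c) :=
  .const (memLp_top_const c)

theorem SurfaceTendsto.gUp (h : SurfaceTendsto P l Θs Θ) (ε : ℝ) (i j : Fin 3) :
    LpTendsto P.vol ⊤ l (fun n p => gUp ε (Θs n) p.1 i j) (fun p => gUp ε Θ p.1 i j) := by
  simp only [gUp_eq_assemble]
  exact LpTendsto.assemble (fun α β => lpTendsto_const (kron α β))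
    (fun α => (h.first α).const_mul _)
    (((lpTendsto_radius_inv.pow 2).mul ((lpTendsto_const 1).add
      ((lpTendsto_radius.pow 2).mul (((h.first 0).pow 2).add ((h.first 1).pow 2))))).const_mul _)
    i j

theorem SurfaceTendsto.gLow (h : SurfaceTendsto P l Θs Θ) (ε : ℝ) (i j : Fin 3) :
    LpTendsto P.vol ⊤ l (fun n p => gLow ε (Θs n) p.1 i j) (fun p => gLow ε Θ p.1 i j) := by
  simp only [gLow_eq_assemble]
  exact LpTendsto.assemble (fun α β => (lpTendsto_const (kron α β)).add
      ((lpTendsto_radius.pow 2).mul ((h.first α).mul (h.first β))))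
    (fun α => ((lpTendsto_radius.pow 2).mul (h.first α)).const_mul _)
    ((lpTendsto_radius.pow 2).const_mul _) i j

theorem SurfaceTendsto.gLowDeriv (h : SurfaceTendsto P l Θs Θ) (ε : ℝ) (k i j : Fin 3) :
    LpTendsto P.vol ⊤ l (fun n p => gLowDeriv ε (Θs n) p.1 k i j)
      (fun p => gLowDeriv ε Θ p.1 k i j) := by
  have key : ∀ a, LpTendsto P.vol ⊤ l (fun n p => gLowPartial ε (Θs n) p.1 a i j)
      (fun p => gLowPartial ε Θ p.1 a i j) := fun a => by
    have h0 := (lpTendsto_radius (P := P) (l := l)).const_mul 2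
    have h1 := h0.mul (lpTendsto_const (kron a 1))
    have h2 := (lpTendsto_radius (P := P) (l := l)).pow 2
    exact LpTendsto.assemble
      (fun α β => (h1.mul ((h.first α).mul (h.first β))).add (h2.mul
        (((h.second a α).mul (h.first β)).add ((h.first α).mul (h.second a β)))))
      (fun α => ((h1.mul (h.first α)).add (h2.mul (h.second a α))).const_mul _)
      (h1.const_mul _) i j
  simp only [gLowDeriv_eq (h.contDiff _), gLowDeriv_eq h.contDiff_lim]
  fin_cases k
  exacts [key 0, key 1, lpTendsto_const 0]

theorem SurfaceTendsto.christoffel (h : SurfaceTendsto P l Θs Θ) (ε : ℝ) (i j k : Fin 3) :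
    LpTendsto P.vol ⊤ l (fun n p => christoffel ε (Θs n) p.1 i j k)
      (fun p => christoffel ε Θ p.1 i j k) :=
  (LpTendsto.sum _ fun m => (h.gUp ε i m).mul
    (((h.gLowDeriv ε j k m).add (h.gLowDeriv ε k j m)).sub (h.gLowDeriv ε m j k))).const_mul _

theorem SurfaceTendsto.visc (h : SurfaceTendsto P l Θs Θ) (μ ε : ℝ) (i j k m : Fin 3) :
    LpTendsto P.vol ⊤ l (fun n p => visc μ ε (Θs n) p.1 i j k m)
      (fun p => visc μ ε Θ p.1 i j k m) :=
  (((h.gUp ε i j).mul (h.gUp ε k m)).const_mul _).add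
    ((((h.gUp ε i k).mul (h.gUp ε j m)).add ((h.gUp ε i m).mul (h.gUp ε j k))).const_mul _)

theorem SurfaceTendsto.viscPair (h : SurfaceTendsto P l Θs Θ) (μ ε : ℝ)
    {s t : ι → Pt → Fin 3 → Fin 3 → ℝ} {s' t' : Pt → Fin 3 → Fin 3 → ℝ}
    (hs : ∀ i j, LpTendsto P.vol 2 l (fun n p => s n p i j) (fun p => s' p i j))
    (ht : ∀ i j, LpTendsto P.vol 2 l (fun n p => t n p i j) (fun p => t' p i j)) :
    LpTendsto P.vol 1 l (fun n p => viscPair μ ε (Θs n) p.1 (s n p) (t n p))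
      (fun p => viscPair μ ε Θ p.1 (s' p) (t' p)) :=
  LpTendsto.sum _ fun i => LpTendsto.sum _ fun j => LpTendsto.sum _ fun k => LpTendsto.sum _ fun m =>
    ((h.visc μ ε i j k m).mul (hs k m)).mul_two (ht i j)

/-- The first argument will be an acceleration, whose convective part is a product of two `L²`
functions and so only in `L¹`. The second must then be bounded, as test fields are. -/
theorem SurfaceTendsto.gPair (h : SurfaceTendsto P l Θs Θ) (ε : ℝ)
    {a b : ι → Pt → Fin 3 → ℝ} {a' b' : Pt → Fin 3 → ℝ}
    (ha : ∀ i, LpTendsto P.vol 1 l (fun n p => a n p i) (fun p => a' p i))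
    (hb : ∀ i, LpTendsto P.vol ⊤ l (fun n p => b n p i) (fun p => b' p i)) :
    LpTendsto P.vol 1 l (fun n p => gPair ε (Θs n) p (a n p) (b n p))
      (fun p => gPair ε Θ p (a' p) (b' p)) :=
  LpTendsto.sum _ fun k => LpTendsto.sum _ fun m =>
    ((hb m).mul ((h.gLow ε k m).mul (ha k))).congr (fun _ _ => mul_comm _ _) fun _ => mul_comm _ _

theorem SurfaceTendsto.cov (h : SurfaceTendsto P l Θs Θ) (ε : ℝ) (hW : FieldTendsto P.vol l W w)
    (i j : Fin 3) :
    LpTendsto P.vol 2 l (fun n p => cov ε (Θs n) (W n) p i j) (fun p => cov ε Θ w p i j) :=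
  ((hW j).2 i).add (LpTendsto.sum _ fun k => (h.christoffel ε j i k).mul (hW k).1)

theorem SurfaceTendsto.divg (h : SurfaceTendsto P l Θs Θ) (ε : ℝ)
    (hW : FieldTendsto P.vol l W w) :
    LpTendsto P.vol 2 l (fun n p => divg ε (Θs n) (W n) p) (fun p => divg ε Θ w p) :=
  LpTendsto.sum _ fun i => h.cov ε hW i i

theorem SurfaceTendsto.strain (h : SurfaceTendsto P l Θs Θ) (ε : ℝ)
    (hW : FieldTendsto P.vol l W w) (i j : Fin 3) :
    LpTendsto P.vol 2 l (fun n p => strain ε (Θs n) (W n) p i j) (fun p => strain ε Θ w p i j) :=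
  (LpTendsto.sum _ fun k => ((h.gLow ε j k).mul (h.cov ε hW i k)).add
    ((h.gLow ε i k).mul (h.cov ε hW j k))).const_mul _

theorem SurfaceTendsto.swirl (h : SurfaceTendsto P l Θs Θ) (ε : ℝ)
    (hW : FieldTendsto P.vol l W w) :
    LpTendsto P.vol 2 l (fun n p => swirl ε (Θs n) (W n) p) (fun p => swirl ε Θ w p) :=
  ((hW 2).1.const_mul ε).add (LpTendsto.sum _ fun β =>
    ((h.first β).mul (hW (up β)).1).congr (fun _ _ => mul_comm _ _) fun _ => mul_comm _ _)

theorem SurfaceTendsto.convect (h : SurfaceTendsto P l Θs Θ) (ε : ℝ)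
    (hW : FieldTendsto P.vol l W w) (hV : FieldTendsto P.vol l V v) (k : Fin 3) :
    LpTendsto P.vol 1 l (fun n p => convect ε (Θs n) (W n) (V n) p k)
      (fun p => convect ε Θ w v p k) :=
  LpTendsto.sum _ fun j => (hW j).1.mul_two (h.cov ε hV j k)

theorem LpTendsto.two_one {F : ι → Pt → ℝ} {G : Pt → ℝ} (h : LpTendsto P.vol 2 l F G) :
    LpTendsto P.vol 1 l F G :=
  ((LpTendsto.const (memLp_const (1 : ℝ))).mul_two h).congr (fun _ _ => one_mul _)
    fun _ => one_mul _

theorem SurfaceTendsto.coriolis (h : SurfaceTendsto P l Θs Θ) (om ε : ℝ)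
    (hW : FieldTendsto P.vol l W w) (k : Fin 3) :
    LpTendsto P.vol 2 l (fun n p => coriolis om ε (Θs n) (W n) p k)
      (fun p => coriolis om ε Θ w p k) := by
  have h0 := (((lpTendsto_radius (P := P) (l := l)).const_mul 2).mul (lpTendsto_const om))
  fin_cases k
  · exact (lpTendsto_const 0).of_top
  · exact (h0.mul (h.swirl ε hW)).neg
  · exact ((h0.mul (lpTendsto_const ε⁻¹)).mul (((h.first 1).mul (h.swirl ε hW)).add
      ((lpTendsto_radius_inv.pow 2).mul (hW 1).1))).congr
      (fun n p => by simp [Blade.coriolis, div_eq_mul_inv, mul_comm])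
      (fun p => by simp [Blade.coriolis, div_eq_mul_inv, mul_comm])

theorem SurfaceTendsto.centrifugal (h : SurfaceTendsto P l Θs Θ) (om ε : ℝ) (k : Fin 3) :
    LpTendsto P.vol ⊤ l (fun n p => centrifugal om ε (Θs n) p k)
      (fun p => centrifugal om ε Θ p k) := by
  have h0 := (lpTendsto_radius (P := P) (l := l)).const_mul (om ^ 2)
  fin_cases k
  · exact lpTendsto_const 0
  · exact h0
  · exact ((h0.mul (h.first 1)).mul (lpTendsto_const ε⁻¹)).neg

theorem SurfaceTendsto.accel (h : SurfaceTendsto P l Θs Θ) (om ε : ℝ)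
    (hW : FieldTendsto P.vol l W w) (k : Fin 3) :
    LpTendsto P.vol 1 l (fun n p => accel om ε (Θs n) (W n) p k)
      (fun p => accel om ε Θ w p k) :=
  ((h.convect ε hW hW k).add (h.coriolis om ε hW k).two_one).sub (h.centrifugal om ε k).of_top

end SurfaceConvergence

/-! ### Superposition operators on `L^∞` -/

section Superposition

variable {X ι : Type} [MeasurableSpace X] {ν : Measure X} {l : Filter ι} {F : ι → X → ℝ}
  {G : X → ℝ}

/-- Together with the converse below, this reduces convergence in `L^∞` to almost everywhere
estimates, to which a mean value argument can be applied pointwise. -/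
theorem LpTendsto.eventually_ae_le (h : LpTendsto ν ⊤ l F G) {e : ℝ} (he : 0 < e) :
    ∀ᶠ n in l, ∀ᵐ x ∂ν, |F n x - G x| ≤ e := by
  have h1 : ∀ᶠ n in l, eLpNorm (F n - G) ⊤ ν < ENNReal.ofReal e :=
    h.tendsto.eventually (gt_mem_nhds (by simpa using he))
  filter_upwards [h1] with n hn
  rw [eLpNorm_exponent_top] at hn
  filter_upwards [ae_le_eLpNormEssSup (f := F n - G) (μ := ν)] with x hx
  have := hx.trans hn.le
  rw [← ofReal_norm, ENNReal.ofReal_le_ofReal_iff he.le] at this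
  simpa using this

theorem LpTendsto.of_eventually_ae_le (hF : ∀ᶠ n in l, MemLp (F n) ⊤ ν) (hG : MemLp G ⊤ ν)
    (h : ∀ e : ℝ, 0 < e → ∀ᶠ n in l, ∀ᵐ x ∂ν, |F n x - G x| ≤ e) : LpTendsto ν ⊤ l F G := by
  refine ⟨hF, hG, ENNReal.tendsto_nhds_zero.2 fun e he => ?_⟩
  rcases eq_or_ne e ⊤ with rfl | hne
  · simp
  filter_upwards [h e.toReal (ENNReal.toReal_pos he.ne' hne)] with n hn
  rw [eLpNorm_exponent_top, ← ENNReal.ofReal_toReal hne]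
  exact eLpNormEssSup_le_of_ae_bound (by simpa using hn)

theorem exists_ae_abs_le (h : MemLp G ⊤ ν) : ∃ C : ℝ, 0 ≤ C ∧ ∀ᵐ x ∂ν, |G x| ≤ C := by
  refine ⟨(eLpNorm G ⊤ ν).toReal, ENNReal.toReal_nonneg, ?_⟩
  filter_upwards [ae_le_eLpNormEssSup (f := G) (μ := ν)] with x hx
  rw [← eLpNorm_exponent_top, ← ENNReal.ofReal_toReal h.2.ne, ← ofReal_norm,
    ENNReal.ofReal_le_ofReal_iff ENNReal.toReal_nonneg] at hx
  simpa using hx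

/-- Since `f` is controlled only on `K`, it is replaced by its extension by zero. That is Borel, and
the composite changes only on a null set. -/
theorem memLp_top_comp_of_isCompact {K : Set (ℝ × ℝ)} (hK : IsCompact K) {f : ℝ × ℝ → ℝ}
    (hf : ContinuousOn f K) {u v : X → ℝ} (hu : AEStronglyMeasurable u ν)
    (hv : AEStronglyMeasurable v ν) (h : ∀ᵐ x ∂ν, (u x, v x) ∈ K) :
    MemLp (fun x => f (u x, v x)) ⊤ ν := by
  classical
  obtain ⟨C, hC⟩ := hK.exists_bound_of_continuousOn hf
  have hm : Measurable (K.piecewise f fun _ => 0) :=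
    hf.measurable_piecewise continuousOn_const hK.measurableSet
  have h1 : AEMeasurable (fun x => K.piecewise f (fun _ => 0) (u x, v x)) ν :=
    hm.comp_aemeasurable (hu.aemeasurable.prodMk hv.aemeasurable)
  refine memLp_top_of_bound (h1.congr ?_).aestronglyMeasurable C ?_
  · filter_upwards [h] with x hx
    simp [hx]
  · filter_upwards [h] with x hx using hC _ hx

/-- A `C¹` function of two positive variables acts differentiably on `L^∞`. -/
theorem LpDeriv.comp₂ {f : ℝ × ℝ → ℝ} (hf : ContDiffOn ℝ 1 f (Ioi 0 ×ˢ Ioi 0))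
    {u v : ℝ → X → ℝ} {u' v' : X → ℝ} (hu : LpDeriv ν ⊤ u u') (hv : LpDeriv ν ⊤ v v')
    {c : ℝ} (hc : 0 < c) (hcu : ∀ᵐ x ∂ν, c ≤ u 0 x) (hcv : ∀ᵐ x ∂ν, c ≤ v 0 x) :
    LpDeriv ν ⊤ (fun t x => f (u t x, v t x))
      (fun x => fderiv ℝ f (u 0 x, v 0 x) (u' x, v' x)) := by
  obtain ⟨A, hA0, hA⟩ := exists_ae_abs_le hu.1
  obtain ⟨B, hB0, hB⟩ := exists_ae_abs_le hv.1
  obtain ⟨A', hA'0, hA'⟩ := exists_ae_abs_le hu.2.memLp_lim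
  obtain ⟨B', hB'0, hB'⟩ := exists_ae_abs_le hv.2.memLp_lim
  -- A compact convex rectangle in the open quadrant. Almost all values at `t = 0` lie in it with
  -- margin at least `c / 2` on each side, so the values at small `t` stay inside.
  set K : Set (ℝ × ℝ) := Icc (c / 2) (A + c) ×ˢ Icc (c / 2) (B + c) with hKdef
  have hK : IsCompact K := isCompact_Icc.prod isCompact_Icc
  have hKc : Convex ℝ K := (convex_Icc _ _).prod (convex_Icc _ _)
  have hO : IsOpen (Ioi (0 : ℝ) ×ˢ Ioi (0 : ℝ)) := isOpen_Ioi.prod isOpen_Ioi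
  have hKO : K ⊆ Ioi (0 : ℝ) ×ˢ Ioi (0 : ℝ) := fun y hy =>
    ⟨(half_pos hc).trans_le hy.1.1, (half_pos hc).trans_le hy.2.1⟩
  have hD : ContinuousOn (fderiv ℝ f) K := (hf.continuousOn_fderiv_of_isOpen hO le_rfl).mono hKO
  have hfK : ContinuousOn f K := hf.continuousOn.mono hKO
  have hder : ∀ y ∈ K, HasFDerivAt f (fderiv ℝ f y) y := fun y hy =>
    ((hf.differentiableOn one_ne_zero).differentiableAt (hO.mem_nhds (hKO hy))).hasFDerivAt
  obtain ⟨C, hC⟩ := hK.exists_bound_of_continuousOn hD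
  have hnear : ∀ e : ℝ, 0 < e → ∀ᶠ t in 𝓝[≠] (0 : ℝ), ∀ᵐ x ∂ν,
      |u t x - u 0 x| ≤ e ∧ |v t x - v 0 x| ≤ e := fun e he => by
    filter_upwards [hu.tendsto.eventually_ae_le he, hv.tendsto.eventually_ae_le he] with t h1 h2
    filter_upwards [h1, h2] with x h3 h4 using ⟨h3, h4⟩
  have hK0 : ∀ᵐ x ∂ν, (u 0 x, v 0 x) ∈ K := by
    filter_upwards [hcu, hcv, hA, hB] with x h1 h2 h3 h4
    have := abs_le.1 h3
    have := abs_le.1 h4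
    exact ⟨⟨by linarith, by linarith⟩, ⟨by linarith, by linarith⟩⟩
  have hKt : ∀ᶠ t in 𝓝[≠] (0 : ℝ), ∀ᵐ x ∂ν, (u t x, v t x) ∈ K := by
    filter_upwards [hnear (c / 2) (half_pos hc)] with t ht
    filter_upwards [ht, hcu, hcv, hA, hB] with x h0 h1 h2 h3 h4
    have := abs_le.1 h3
    have := abs_le.1 h4
    have := abs_le.1 h0.1
    have := abs_le.1 h0.2
    exact ⟨⟨by linarith, by linarith⟩, ⟨by linarith, by linarith⟩⟩
  have hmem0 : MemLp (fun x => f (u 0 x, v 0 x)) ⊤ ν :=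
    memLp_top_comp_of_isCompact hK hfK hu.1.1 hv.1.1 hK0
  have hpart : ∀ a : ℝ × ℝ, MemLp (fun x => fderiv ℝ f (u 0 x, v 0 x) a) ⊤ ν := fun a =>
    memLp_top_comp_of_isCompact (f := fun y => fderiv ℝ f y a) hK
      (hD.clm_apply continuousOn_const) hu.1.1 hv.1.1 hK0
  have hlim : MemLp (fun x => fderiv ℝ f (u 0 x, v 0 x) (u' x, v' x)) ⊤ ν := by
    have h1 : MemLp (fun x => fderiv ℝ f (u 0 x, v 0 x) (1, 0) * u' x +
        fderiv ℝ f (u 0 x, v 0 x) (0, 1) * v' x) ⊤ ν :=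
      (hu.2.memLp_lim.mul (hpart (1, 0))).add (hv.2.memLp_lim.mul (hpart (0, 1)))
    convert h1 using 2 with x
    have : (u' x, v' x) = u' x • ((1, 0) : ℝ × ℝ) + v' x • ((0, 1) : ℝ × ℝ) := by simp
    rw [this, map_add, map_smul, map_smul]
    simp [mul_comm]
  refine ⟨hmem0, .of_eventually_ae_le ?_ hlim fun e he => ?_⟩
  · filter_upwards [hKt, hu.tendsto.memLp, hv.tendsto.memLp] with t h1 h2 h3
    exact ((memLp_top_comp_of_isCompact hK hfK h2.1 h3.1 h1).sub hmem0).const_mul t⁻¹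
  -- `N` bounds the difference quotient of `(u, v)` as soon as it is within `1` of its limit. The
  -- tolerances `e / (2N)` and `e'` make each of the two error terms at most `e / 2`.
  · set N : ℝ := A' + B' + 1 with hN
    have hNpos : 0 < N := by positivity
    have hC1 : 0 < |C| + 1 := by positivity
    obtain ⟨δ, hδ, hunif⟩ := Metric.uniformContinuousOn_iff_le.1
      (hK.uniformContinuousOn_of_continuous hD) (e / (2 * N)) (by positivity)
    set e' := min 1 (e / (2 * (|C| + 1))) with he'
    have he'0 : 0 < e' := by positivity
    filter_upwards [hKt, hnear δ hδ, hu.2.eventually_ae_le he'0, hv.2.eventually_ae_le he'0]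
      with t h1 h2 h3 h4
    filter_upwards [h1, h2, h3, h4, hK0, hA', hB'] with x hx1 hx2 hx3 hx4 hx0 hxA hxB
    set y := (u t x, v t x)
    set y0 := (u 0 x, v 0 x)
    set d : ℝ × ℝ := t⁻¹ • (y - y0) with hd
    have hyy : ‖y - y0‖ ≤ δ := max_le hx2.1 hx2.2
    have hdd : ‖d - (u' x, v' x)‖ ≤ e' := max_le hx3 hx4
    have hp : ‖(u' x, v' x)‖ ≤ A' + B' := max_le (hxA.trans (by linarith)) (hxB.trans (by linarith))
    have hdn : ‖d‖ ≤ N := by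
      have h5 : ‖d‖ ≤ ‖d - (u' x, v' x)‖ + ‖(u' x, v' x)‖ := by
        simpa using norm_add_le (d - (u' x, v' x)) (u' x, v' x)
      have : e' ≤ 1 := min_le_left _ _
      linarith
    -- Mean value inequality for `f` minus its linearization at `y0`: along the segment the
    -- derivative differs from that at `y0` by at most `e / (2N)`, by uniform continuity on `K`.
    have hseg : ‖f y - f y0 - fderiv ℝ f y0 (y - y0)‖ ≤ e / (2 * N) * ‖y - y0‖ := by
      have hsub : segment ℝ y0 y ⊆ K := hKc.segment_subset hx0 hx1
      refine (convex_segment y0 y).norm_image_sub_le_of_norm_hasFDerivWithin_le'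
        (fun z hz => (hder z (hsub hz)).hasFDerivWithinAt) (fun z hz => ?_)
        (left_mem_segment ℝ y0 y) (right_mem_segment ℝ y0 y)
      rw [← dist_eq_norm]
      refine hunif z (hsub hz) y0 hx0 ?_
      rw [dist_eq_norm]
      refine le_trans ?_ hyy
      obtain ⟨s, hs, rfl⟩ := (segment_eq_image' ℝ y0 y ▸ hz)
      simp only [add_sub_cancel_left, norm_smul, Real.norm_eq_abs, abs_of_nonneg hs.1]
      exact mul_le_of_le_one_left (norm_nonneg _) hs.2
    -- Taylor remainder divided by `t`, plus the derivative applied to the error of the difference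
    -- quotient of `(u, v)`.
    have hsplit : t⁻¹ * (f y - f y0) - fderiv ℝ f y0 (u' x, v' x) =
        t⁻¹ * (f y - f y0 - fderiv ℝ f y0 (y - y0)) +
          fderiv ℝ f y0 (d - (u' x, v' x)) := by
      rw [map_sub (fderiv ℝ f y0) d, hd, map_smul, smul_eq_mul]
      ring
    rw [hsplit]
    have b1 : |t⁻¹ * (f y - f y0 - fderiv ℝ f y0 (y - y0))| ≤ e / (2 * N) * N := by
      rw [abs_mul]
      calc |t⁻¹| * |f y - f y0 - fderiv ℝ f y0 (y - y0)|
          ≤ |t⁻¹| * (e / (2 * N) * ‖y - y0‖) := by gcongr; exact hseg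
        _ = e / (2 * N) * ‖d‖ := by rw [hd, norm_smul, Real.norm_eq_abs]; ring
        _ ≤ _ := by gcongr
    have b2 : |fderiv ℝ f y0 (d - (u' x, v' x))| ≤ (|C| + 1) * (e / (2 * (|C| + 1))) := by
      refine ((fderiv ℝ f y0).le_opNorm _).trans ?_
      have h6 : ‖fderiv ℝ f y0‖ ≤ |C| + 1 := ((hC y0 hx0).trans (le_abs_self C)).trans (by linarith)
      have h7 := hdd.trans (min_le_right _ _)
      gcongr
    have e1 : e / (2 * N) * N = e / 2 := by field_simp
    have e2 : (|C| + 1) * (e / (2 * (|C| + 1))) = e / 2 := by field_simp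
    have := abs_add_le (t⁻¹ * (f y - f y0 - fderiv ℝ f y0 (y - y0)))
      (fderiv ℝ f y0 (d - (u' x, v' x)))
    linarith

end Superposition

/-! ### Difference quotients of the flow equations -/

section DifferenceQuotients

/-- The difference quotient `t⁻¹ (w - w₀)`. -/
noncomputable def diffQuot (t : ℝ) (w w₀ : Field) : Field := fun i =>
  ⟨fun p => t⁻¹ * ((w i).val p - (w₀ i).val p),
    fun p j => t⁻¹ * ((w i).grad p j - (w₀ i).grad p j)⟩

variable {ε om μ : ℝ} {Θ : Plane → ℝ} (t : ℝ) (w w₀ u : Field) (p : Pt)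

theorem cov_diffQuot (i j : Fin 3) :
    cov ε Θ (diffQuot t w w₀) p i j = t⁻¹ * (cov ε Θ w p i j - cov ε Θ w₀ p i j) := by
  simp only [cov, diffQuot, Fin.sum_univ_three]
  ring

theorem divg_diffQuot :
    divg ε Θ (diffQuot t w w₀) p = t⁻¹ * (divg ε Θ w p - divg ε Θ w₀ p) := by
  simp only [divg, cov_diffQuot, Fin.sum_univ_three]
  ring

theorem strain_diffQuot (i j : Fin 3) :
    strain ε Θ (diffQuot t w w₀) p i j = t⁻¹ * (strain ε Θ w p i j - strain ε Θ w₀ p i j) := by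
  simp only [strain, cov_diffQuot, Fin.sum_univ_three]
  ring

/-- Convection is quadratic, `B(w, w) - B(w₀, w₀) = B(w - w₀, w) + B(w₀, w - w₀)`. The Coriolis term
is linear and the centrifugal term cancels. -/
theorem accel_sub (k : Fin 3) :
    t⁻¹ * (accel om ε Θ w p k - accel om ε Θ w₀ p k) =
      convect ε Θ (diffQuot t w w₀) w p k + convect ε Θ w₀ (diffQuot t w w₀) p k +
        coriolis om ε Θ (diffQuot t w w₀) p k := by
  have h : coriolis om ε Θ (diffQuot t w w₀) p k =
      t⁻¹ * (coriolis om ε Θ w p k - coriolis om ε Θ w₀ p k) := by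
    fin_cases k <;> simp [coriolis, swirl, diffQuot] <;> ring
  rw [h]
  simp only [accel, convect, cov_diffQuot, diffQuot, Fin.sum_univ_three]
  ring

theorem viscPair_left_sub (x : Plane) (s s' r : Fin 3 → Fin 3 → ℝ) :
    viscPair μ ε Θ x (fun i j => t * (s i j - s' i j)) r =
      t * (viscPair μ ε Θ x s r - viscPair μ ε Θ x s' r) := by
  simp only [viscPair, ← Finset.sum_sub_distrib, Finset.mul_sum]
  refine Finset.sum_congr rfl fun i _ => Finset.sum_congr rfl fun j _ =>
    Finset.sum_congr rfl fun k _ => Finset.sum_congr rfl fun l _ => ?_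
  ring

theorem viscPair_strain_diffQuot (x : Plane) (r : Fin 3 → Fin 3 → ℝ) :
    viscPair μ ε Θ x (strain ε Θ (diffQuot t w w₀) p) r =
      t⁻¹ * (viscPair μ ε Θ x (strain ε Θ w p) r - viscPair μ ε Θ x (strain ε Θ w₀ p) r) := by
  rw [← viscPair_left_sub]
  congr 1
  funext i j
  exact strain_diffQuot t w w₀ p i j

theorem gPair_left_sub (a a' b : Fin 3 → ℝ) :
    gPair ε Θ p (fun k => t * (a k - a' k)) b = t * (gPair ε Θ p a b - gPair ε Θ p a' b) := by
  simp only [gPair, Fin.sum_univ_three]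
  ring

end DifferenceQuotients

/-- `w'` is the derivative at `t = 0` in `H¹` of the curve `W` of vector fields. -/
structure FieldDeriv (ν : Measure Pt) (W : ℝ → Field) (w' : Field) : Prop where
  val : ∀ i, LpDeriv ν 2 (fun t => (W t i).val) (w' i).val
  grad : ∀ i j, LpDeriv ν 2 (fun t p => (W t i).grad p j) (fun p => (w' i).grad p j)

theorem FieldDeriv.tendsto {ν : Measure Pt} {W : ℝ → Field} {w' : Field} (h : FieldDeriv ν W w') :
    FieldTendsto ν (𝓝[≠] 0) W (W 0) :=
  fun i => ⟨(h.val i).tendsto, fun j => (h.grad i j).tendsto⟩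

theorem FieldDeriv.quotient {ν : Measure Pt} {W : ℝ → Field} {w' : Field}
    (h : FieldDeriv ν W w') : FieldTendsto ν (𝓝[≠] 0) (fun t => diffQuot t (W t) (W 0)) w' :=
  fun i => ⟨(h.val i).quotient, fun j => (h.grad i j).quotient⟩

theorem FieldDeriv.sqIntegrable_zero {ν : Measure Pt} {W : ℝ → Field} {w' : Field}
    (h : FieldDeriv ν W w') : SqIntegrable ν (W 0) :=
  fun i => ⟨(h.val i).1, fun j => (h.grad i j).1⟩

theorem FieldDeriv.sqIntegrable {ν : Measure Pt} {W : ℝ → Field} {w' : Field}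
    (h : FieldDeriv ν W w') : SqIntegrable ν w' :=
  fun i => ⟨(h.val i).2.memLp_lim, fun j => (h.grad i j).2.memLp_lim⟩

section Smooth

variable (P : Passage) {φ : Pt → ℝ}

theorem memLp_top_of_contDiff (hφ : ContDiff ℝ ∞ φ) : MemLp φ ⊤ P.vol :=
  P.memLp_top_of_continuousOn hφ.continuous.continuousOn

theorem memLp_top_fderiv (hφ : ContDiff ℝ ∞ φ) (a : Pt) :
    MemLp (fun p => fderiv ℝ φ p a) ⊤ P.vol :=
  P.memLp_top_of_continuousOn
    ((hφ.continuous_fderiv (by simp)).clm_apply continuous_const).continuousOn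

theorem sqIntegrable_of_contDiff {v : Fin 3 → Pt → ℝ} (hv : ∀ i, ContDiff ℝ ∞ (v i)) :
    SqIntegrable P.vol (fun i => Jet.of (v i)) := fun i =>
  ⟨(memLp_top_of_contDiff P (hv i)).mono_exponent le_top,
    fun j => (memLp_top_fderiv P (hv i) (dir j)).mono_exponent le_top⟩

end Smooth

/-! ### The linearized equations -/

/-- If `∫ F t = b t` along the curve of solutions and `m t = ∫ G t - b t` is the residual of the
frozen state, then the derivative of `m` is minus the limit of `∫ t⁻¹ (F t - G t)`. -/
theorem hasDerivAt_residual {X : Type} [MeasurableSpace X] {ν : Measure X} {F G : ℝ → X → ℝ}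
    {f g L : X → ℝ} {b m : ℝ → ℝ} (hF : LpTendsto ν 1 (𝓝[≠] 0) F f)
    (hG : LpTendsto ν 1 (𝓝[≠] 0) G g)
    (hL : LpTendsto ν 1 (𝓝[≠] 0) (fun t x => t⁻¹ * (F t x - G t x)) L)
    (hb : ∀ᶠ t in 𝓝[≠] (0 : ℝ), ∫ x, F t x ∂ν - b t = 0)
    (hm : ∀ t, m t = ∫ x, G t x ∂ν - b t) (hm0 : m 0 = 0) :
    HasDerivAt m (-∫ x, L x ∂ν) 0 := by
  rw [hasDerivAt_iff_tendsto_slope]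
  refine hL.integral.neg.congr' ?_
  filter_upwards [hb, hF.memLp, hG.memLp] with t h1 h2 h3
  -- Along solutions `b t = ∫ F t`, so the slope of `m` is `-∫ t⁻¹ (F t - G t)`. No
  -- differentiability of `b` is required.
  rw [integral_const_mul, integral_sub (memLp_one_iff_integrable.1 h2)
    (memLp_one_iff_integrable.1 h3), slope_def_field, hm0, hm t, div_eq_inv_mul]
  linear_combination (-t⁻¹) * h1

/-! ### Momentum balance -/

section Momentum

variable {P : Passage}

/-- The integrand of the momentum balance. -/
noncomputable def momentumDensity (P : Passage) (Θ : Plane → ℝ) (w : Field) (ρ π : Pt → ℝ)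
    (v : Field) (p : Pt) : ℝ :=
  (viscPair P.μ P.ε Θ p.1 (strain P.ε Θ w p) (strain P.ε Θ v p)
      + gPair P.ε Θ p (fun k => ρ p * accel P.om P.ε Θ w p k - P.force k p)
          (fun m => (v m).val p)
      - π p * divg P.ε Θ v p) * (P.ε * p.1 1)

theorem lpTendsto_volumeElement {ι : Type} {l : Filter ι} :
    LpTendsto P.vol ⊤ l (fun _ p => P.ε * p.1 1) (fun p : Pt => P.ε * p.1 1) :=
  lpTendsto_radius.const_mul _

theorem LpTendsto.mul_volumeElement {ι : Type} {l : Filter ι} {F : ι → Pt → ℝ} {G : Pt → ℝ}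
    (h : LpTendsto P.vol 1 l F G) :
    LpTendsto P.vol 1 l (fun n p => F n p * (P.ε * p.1 1)) (fun p => G p * (P.ε * p.1 1)) :=
  (lpTendsto_volumeElement.mul h).congr (fun _ _ => mul_comm _ _) fun _ => mul_comm _ _

/-- The density multiplies an acceleration in `L¹` and must converge in `L^∞`. The pressure only
meets `div v` and may converge in `L²`. -/
theorem lpTendsto_momentumDensity {ι : Type} {l : Filter ι} {Θs : ι → Plane → ℝ} {Θ : Plane → ℝ}
    (h : SurfaceTendsto P l Θs Θ) {W : ι → Field} {w v : Field} (hW : FieldTendsto P.vol l W w)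
    {ρs πs : ι → Pt → ℝ} {ρ π : Pt → ℝ} (hρ : LpTendsto P.vol ⊤ l ρs ρ)
    (hπ : LpTendsto P.vol 2 l πs π) (hv : SqIntegrable P.vol v)
    (hv' : ∀ i, MemLp (v i).val ⊤ P.vol) :
    LpTendsto P.vol 1 l (fun n => momentumDensity P (Θs n) (W n) (ρs n) (πs n) v)
      (momentumDensity P Θ w ρ π v) := by
  have hV := FieldTendsto.const (l := l) hv
  refine (((h.viscPair P.μ P.ε (h.strain P.ε hW) (h.strain P.ε hV)).add
    (h.gPair P.ε (fun k => (hρ.mul (h.accel P.om P.ε hW k)).sub ?_)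
      fun i => .const (hv' i))).sub (hπ.mul_two (h.divg P.ε hV))).mul_volumeElement
  have hf : MemLp (P.force k) 2 P.vol := P.force_memLp k
  exact .const (hf.mono_exponent (by norm_num))

variable {M : FlowModel} {Θ η : Plane → ℝ}

/-- Here `b` is the traction term: it contains the varied surface and `v` but not the state, so it
drops out of the difference. -/
theorem hasDerivAt_momentum (hΘ : ContDiff ℝ 2 Θ) (hη : ContDiff ℝ 2 η) {s : ℝ → State}
    {s' : State} (hW : FieldDeriv P.vol (fun t => (s t).vel) s'.vel)
    (hρ : LpDeriv P.vol ⊤ (fun t => M.density (s t)) (M.densityLin s'))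
    (hπ : LpDeriv P.vol 2 (fun t => M.pressure (s t)) (M.pressureLin (s 0) s'))
    {v : Field} (hv : SqIntegrable P.vol v) (hv' : ∀ i, MemLp (v i).val ⊤ P.vol)
    (h0 : momentum P M Θ (s 0) v = 0)
    (hs : ∀ᶠ t in 𝓝[≠] (0 : ℝ), momentum P M (Θ + t • η) (s t) v = 0) :
    HasDerivAt (fun t : ℝ => momentum P M (Θ + t • η) (s 0) v)
      (-momentumLin P M Θ (s 0) s' v) 0 := by
  have hS : SurfaceTendsto P (𝓝[≠] (0 : ℝ)) (fun t => Θ + t • η) Θ := .line hΘ hη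
  have hV := FieldTendsto.const (l := 𝓝[≠] (0 : ℝ)) hv
  have hW0 := FieldTendsto.const (l := 𝓝[≠] (0 : ℝ)) hW.sqIntegrable_zero
  have hρ0 := LpTendsto.const (l := 𝓝[≠] (0 : ℝ)) hρ.1
  refine hasDerivAt_residual
    (lpTendsto_momentumDensity hS hW.tendsto hρ.tendsto hπ.tendsto hv hv')
    (lpTendsto_momentumDensity hS hW0 hρ0 (.const hπ.1) hv hv')
    ?_ hs (fun t => rfl) (by simpa using h0)
  have main := (((hS.viscPair P.μ P.ε (hS.strain P.ε hW.quotient) (hS.strain P.ε hV)).add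
    (hS.gPair P.ε (fun k => (hρ.quotient.mul (hS.accel P.om P.ε hW.tendsto k)).add
      (hρ0.mul (((hS.convect P.ε hW0 hW.quotient k).add
        (hS.convect P.ε hW.quotient hW.tendsto k)).add
          (hS.coriolis P.om P.ε hW.quotient k).two_one)))
      fun i => .const (hv' i))).sub (hπ.quotient.mul_two (hS.divg P.ε hV))).mul_volumeElement
  refine main.congr (fun t p => ?_) fun p => rfl
  rw [viscPair_strain_diffQuot]
  -- The splitting `ρ_t a_t - ρ_0 a_0 = (ρ_t - ρ_0) a_t + ρ_0 (a_t - a_0)`. The body force cancels.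
  have e : (fun k => t⁻¹ * (M.density (s t) p - M.density (s 0) p) *
      accel P.om P.ε (Θ + t • η) (s t).vel p k + M.density (s 0) p *
      (convect P.ε (Θ + t • η) (s 0).vel (diffQuot t (s t).vel (s 0).vel) p k +
        convect P.ε (Θ + t • η) (diffQuot t (s t).vel (s 0).vel) (s t).vel p k +
        coriolis P.om P.ε (Θ + t • η) (diffQuot t (s t).vel (s 0).vel) p k)) =
      fun k => t⁻¹ * ((M.density (s t) p * accel P.om P.ε (Θ + t • η) (s t).vel p k -
        P.force k p) - (M.density (s 0) p * accel P.om P.ε (Θ + t • η) (s 0).vel p k -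
        P.force k p)) := by
    funext k
    linear_combination -M.density (s 0) p *
      accel_sub (om := P.om) (ε := P.ε) (Θ := Θ + t • η) t (s t).vel (s 0).vel p k
  rw [e, gPair_left_sub]
  simp only [momentumDensity]
  ring

end Momentum

/-! ### Energy balance -/

section Energy

variable {P : Passage} {M : FlowModel} {Θ η : Plane → ℝ}

/-- The integrand of the energy balance. -/
noncomputable def energyDensity (P : Passage) (cv κ : ℝ) (h : Pt → ℝ) (Θ : Plane → ℝ) (w : Field)
    (ρ π : Pt → ℝ) (T : Jet) (ψ : Pt → ℝ) (p : Pt) : ℝ :=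
  ((ρ p * cv * (∑ j, (w j).val p * T.grad p j)
        + π p * divg P.ε Θ w p
        - viscPair P.μ P.ε Θ p.1 (strain P.ε Θ w p) (strain P.ε Θ w p) - h p) * ψ p
      + κ * ∑ i, ∑ j, gUp P.ε Θ p.1 i j * T.grad p i * fderiv ℝ ψ p (dir j))
      * (P.ε * p.1 1)

variable {cv κ : ℝ} {h : Pt → ℝ} {ψ : Pt → ℝ}

theorem LpTendsto.mul_bounded {ι : Type} {l : Filter ι} {ν : Measure Pt} {F : ι → Pt → ℝ}
    {G : Pt → ℝ} (h : LpTendsto ν 1 l F G) {b : Pt → ℝ} (hb : MemLp b ⊤ ν) :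
    LpTendsto ν 1 l (fun n p => F n p * b p) (fun p => G p * b p) :=
  ((LpTendsto.const hb).mul h).congr (fun _ _ => mul_comm _ _) fun _ => mul_comm _ _

theorem SurfaceTendsto.heatFlux {ι : Type} {l : Filter ι} {Θs : ι → Plane → ℝ}
    (hS : SurfaceTendsto P l Θs Θ) {T : ι → Jet} {T' : Jet}
    (hT : ∀ j, LpTendsto P.vol 2 l (fun n p => (T n).grad p j) (fun p => T'.grad p j))
    (hψ : ContDiff ℝ ∞ ψ) :
    LpTendsto P.vol 1 l
      (fun n p => κ * ∑ i, ∑ j, Blade.gUp P.ε (Θs n) p.1 i j * (T n).grad p i *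
        fderiv ℝ ψ p (dir j))
      (fun p => κ * ∑ i, ∑ j, Blade.gUp P.ε Θ p.1 i j * T'.grad p i * fderiv ℝ ψ p (dir j)) :=
  (LpTendsto.sum _ fun i => LpTendsto.sum _ fun j =>
    (((hS.gUp P.ε i j).mul (hT i)).two_one).mul_bounded
      (memLp_top_fderiv P hψ (dir j))).const_mul κ

theorem lpTendsto_energyDensity {ι : Type} {l : Filter ι} {Θs : ι → Plane → ℝ}
    (hS : SurfaceTendsto P l Θs Θ) {W : ι → Field} {w : Field} (hW : FieldTendsto P.vol l W w)
    {ρs πs : ι → Pt → ℝ} {ρ π : Pt → ℝ} (hρ : LpTendsto P.vol ⊤ l ρs ρ)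
    (hπ : LpTendsto P.vol 2 l πs π) {T : ι → Jet} {T' : Jet}
    (hT : ∀ j, LpTendsto P.vol 2 l (fun n p => (T n).grad p j) (fun p => T'.grad p j))
    (hh : MemLp h 1 P.vol) (hψ : ContDiff ℝ ∞ ψ) :
    LpTendsto P.vol 1 l (fun n => energyDensity P cv κ h (Θs n) (W n) (ρs n) (πs n) (T n) ψ)
      (energyDensity P cv κ h Θ w ρ π T' ψ) :=
  ((((((hρ.mul (lpTendsto_const cv)).mul (LpTendsto.sum _ fun j => (hW j).1.mul_two (hT j))).add
    (hπ.mul_two (hS.divg P.ε hW))).sub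
      (hS.viscPair P.μ P.ε (hS.strain P.ε hW) (hS.strain P.ε hW))).sub
        (LpTendsto.const hh)).mul_bounded (memLp_top_of_contDiff P hψ)).add
          (hS.heatFlux hT hψ) |>.mul_volumeElement

/-- The argument for the momentum balance with `b = 0`. The heat source cancels in the difference,
so integrability of `h` suffices. -/
theorem hasDerivAt_energy (hΘ : ContDiff ℝ 2 Θ) (hη : ContDiff ℝ 2 η) {s : ℝ → State}
    {s' : State} (hW : FieldDeriv P.vol (fun t => (s t).vel) s'.vel)
    (hρ : LpDeriv P.vol ⊤ (fun t => (s t).dens) s'.dens)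
    (hπ : LpDeriv P.vol 2 (fun t => M.pressure (s t)) (M.pressureLin (s 0) s'))
    (hT : ∀ j, LpDeriv P.vol 2 (fun t p => (s t).temp.grad p j) (fun p => s'.temp.grad p j))
    (hh : MemLp h 1 P.vol) (hψ : ContDiff ℝ ∞ ψ)
    (h0 : energy P M cv κ h Θ (s 0) ψ = 0)
    (hs : ∀ᶠ t in 𝓝[≠] (0 : ℝ), energy P M cv κ h (Θ + t • η) (s t) ψ = 0) :
    HasDerivAt (fun t : ℝ => energy P M cv κ h (Θ + t • η) (s 0) ψ)
      (-energyLin P M cv κ Θ (s 0) s' ψ) 0 := by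
  have hS : SurfaceTendsto P (𝓝[≠] (0 : ℝ)) (fun t => Θ + t • η) Θ := .line hΘ hη
  have hW0 := FieldTendsto.const (l := 𝓝[≠] (0 : ℝ)) hW.sqIntegrable_zero
  have hρ0 := LpTendsto.const (l := 𝓝[≠] (0 : ℝ)) hρ.1
  have hπ0 := LpTendsto.const (l := 𝓝[≠] (0 : ℝ)) hπ.1
  have hψt := memLp_top_of_contDiff P hψ
  refine hasDerivAt_residual (b := fun _ => 0)
    (lpTendsto_energyDensity hS hW.tendsto hρ.tendsto hπ.tendsto (fun j => (hT j).tendsto) hh hψ)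
    (lpTendsto_energyDensity hS hW0 hρ0 hπ0 (fun j => .const (hT j).1) hh hψ)
    ?_ (hs.mono fun t ht => by rw [sub_zero]; exact ht) (fun t => (sub_zero _).symm)
    (by simpa using h0)
  -- The dissipation is a symmetric quadratic form in the strain: its difference is the strain of
  -- the quotient paired once with the moving strain and once with the frozen one, which gives the
  -- factor `2` in the limit.
  have hstr := hS.strain P.ε hW.quotient
  have main := (((((((hρ.quotient.mul (lpTendsto_const cv)).mul
    (LpTendsto.sum Finset.univ fun j => (hW.tendsto j).1.mul_two (hT j).tendsto)).add
    ((hρ0.mul (lpTendsto_const cv)).mul (LpTendsto.sum Finset.univ fun j =>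
      ((hW.quotient j).1.mul_two (hT j).tendsto).add ((hW0 j).1.mul_two (hT j).quotient)))).add
    (hπ.quotient.mul_two (hS.divg P.ε hW.tendsto))).add
    (hπ0.mul_two (hS.divg P.ε hW.quotient))).sub
    ((hS.viscPair P.μ P.ε hstr (hS.strain P.ε hW.tendsto)).add
      (hS.viscPair P.μ P.ε hstr (hS.strain P.ε hW0)))).mul_bounded hψt).add
    -- Only the gradient enters the heat flux. The value of this jet is a dummy `0`.
    (hS.heatFlux (T := fun t => ⟨fun _ => 0, fun p j =>
      t⁻¹ * ((s t).temp.grad p j - (s 0).temp.grad p j)⟩) (κ := κ) (fun j => (hT j).quotient) hψ)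
    |>.mul_volumeElement
  refine main.congr (fun t p => ?_) fun p => ?_
  · rw [viscPair_strain_diffQuot, viscPair_strain_diffQuot, divg_diffQuot,
      viscPair_comm P.μ (strain P.ε (Θ + t • η) (s 0).vel p) (strain P.ε (Θ + t • η) (s t).vel p)]
    simp only [energyDensity, diffQuot, Fin.sum_univ_three]
    ring
  · rw [viscPair_comm P.μ (strain P.ε Θ s'.vel p), ← two_mul]

end Energy

/-! ### Conservation of mass -/

section Conservation

variable {P : Passage}

/-- The mass flux does not contain the surface, so along the solutions it is a function of `t` that
vanishes near `0`. The product rule computes its derivative, which must be zero. -/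
theorem massFlux_add_eq_zero {s : ℝ → State} {s' : State}
    (hW : FieldDeriv P.vol (fun t => (s t).vel) s'.vel)
    (hρ : LpDeriv P.vol ⊤ (fun t => (s t).dens) s'.dens) {q : Pt → ℝ} (hq : ContDiff ℝ ∞ q)
    (h0 : massFlux P (s 0).dens (s 0).vel q = 0)
    (hs : ∀ᶠ t in 𝓝[≠] (0 : ℝ), massFlux P (s t).dens (s t).vel q = 0) :
    massFlux P s'.dens (s 0).vel q + massFlux P (s 0).dens s'.vel q = 0 := by
  have key : ∀ {ρ : Pt → ℝ} {w : Field}, MemLp ρ ⊤ P.vol → SqIntegrable P.vol w →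
      Integrable (fun p => (∑ j, ρ p * (w j).val p * fderiv ℝ q p (dir j)) * (P.ε * p.1 1))
        P.vol := fun {ρ w} h1 h2 => by
    have := (LpTendsto.sum (Finset.univ : Finset (Fin 3)) fun j =>
      -- Constant families turn the limit lemmas into statements of membership in `L^q`. The filter
      -- plays no role.
      (((LpTendsto.const (l := (⊤ : Filter ℕ)) h1).mul (.const (h2 j).1)).two_one).mul_bounded
        (memLp_top_fderiv P hq (dir j))).mul_volumeElement
    exact memLp_one_iff_integrable.1 this.memLp_lim
  have hd : LpDeriv P.vol 1 (fun t p => (∑ j, (s t).dens p * ((s t).vel j).val p *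
      fderiv ℝ q p (dir j)) * (P.ε * p.1 1)) _ :=
    ((LpDeriv.const (lpTendsto_volumeElement (l := (⊤ : Filter ℕ))).memLp_lim).mul
      (LpDeriv.sum Finset.univ fun j => (LpDeriv.const (memLp_top_fderiv P hq (dir j))).mul
        (((LpDeriv.const (memLp_const (1 : ℝ))).mul_two (hρ.mul (hW.val j)))))).congr
      (fun t p => by simp only [Fin.sum_univ_three]; ring) fun p => rfl
  have h1 := hd.hasDerivAt_integral
  have h2 : HasDerivAt (fun t => massFlux P (s t).dens (s t).vel q) 0 0 := by
    refine (hasDerivAt_const (0 : ℝ) (0 : ℝ)).congr_of_eventuallyEq ?_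
    rw [EventuallyEq, ← nhdsNE_sup_pure, eventually_sup]
    exact ⟨hs, by simpa using h0⟩
  have h3 := h1.unique h2
  rw [massFlux, massFlux, ← integral_add (key hρ.2.memLp_lim hW.sqIntegrable_zero)
    (key hρ.1 hW.sqIntegrable)]
  refine Eq.trans ?_ h3
  refine integral_congr_ae (Eventually.of_forall fun p => ?_)
  simp only [Fin.sum_univ_three]
  ring

/-- By `divg_eq` each velocity is divergence free also with respect to `Θ`. So are the difference
quotients, and the constraint passes to their limit. -/
theorem divg_eq_zero {Θ η : Plane → ℝ} (hΘ : ContDiff ℝ 2 Θ) (hη : ContDiff ℝ 2 η)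
    {W : ℝ → Field} {w' : Field} (hW : FieldDeriv P.vol W w')
    (h0 : ∀ᵐ p ∂P.vol, divg P.ε Θ (W 0) p = 0)
    (hs : ∀ᶠ t in 𝓝[≠] (0 : ℝ), ∀ᵐ p ∂P.vol, divg P.ε (Θ + t • η) (W t) p = 0) :
    ∀ᵐ p ∂P.vol, divg P.ε Θ w' p = 0 := by
  have hS : SurfaceTendsto P (𝓝[≠] (0 : ℝ)) (fun _ => Θ) Θ := .const hΘ
  have h1 := (hS.divg P.ε hW.quotient).congr' (F' := fun _ _ => 0) (G' := divg P.ε Θ w') (by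
    filter_upwards [hs] with t ht
    filter_upwards [ht, h0, P.ae_radius_ne_zero] with p h2 h3 hr
    have hΘt : ContDiff ℝ 2 (Θ + t • η) := hΘ.add (hη.const_smul t)
    rw [divg_eq P.ε_pos.ne' hΘt hr] at h2
    rw [divg_diffQuot, h3, divg_eq P.ε_pos.ne' hΘ hr, h2]
    simp) ae_eq_rfl
  have h2 := tendsto_nhds_unique tendsto_const_nhds h1.tendsto
  rw [eLpNorm_eq_zero_iff ((memLp_const 0).sub h1.memLp_lim).1 (by simp)] at h2
  filter_upwards [h2] with p hp
  simpa using hp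

end Conservation

/-! ### The Gateaux derivative of the state -/

/-- The missing memberships in `L^q` come from the curve consisting of solutions. -/
theorem HasLpDeriv.lpDeriv {ν : Measure Pt} {q : ENNReal} {u : ℝ → Pt → ℝ} {u' : Pt → ℝ}
    (h : HasLpDeriv ν q u u') (hu : ∀ᶠ t in 𝓝 (0 : ℝ), MemLp (u t) q ν) (hu' : MemLp u' q ν) :
    LpDeriv ν q u u' := by
  refine ⟨hu.self_of_nhds, ?_, hu', h⟩
  filter_upwards [hu.filter_mono nhdsWithin_le_nhds] with t ht
  exact (ht.sub hu.self_of_nhds).const_mul _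

section Linearized

variable {P : Passage} {M : FlowModel} {S : (Plane → ℝ) → State} {Θ η : Plane → ℝ} {s' : State}

theorem IsGateauxDeriv.fieldDeriv (h : IsGateauxDeriv P M S Θ η s')
    (hsol : ∀ᶠ t in 𝓝 (0 : ℝ), IsSolution P M (Θ + t • η) (S (Θ + t • η))) :
    FieldDeriv P.vol (fun t => (S (Θ + t • η)).vel) s'.vel :=
  ⟨fun i => (h.2.1 i).1.lpDeriv (hsol.mono fun _ ht => (ht.1 i).1) (h.1 i).1,
    fun i j => ((h.2.1 i).2 j).lpDeriv (hsol.mono fun _ ht => (ht.1 i).2.1 j) ((h.1 i).2.1 j)⟩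

/-- The isentropic law is treated as an equation of state of two variables that ignores the second,
so that `LpDeriv.comp₂` covers it. -/
theorem contDiff_const_mul_rpow_fst (a b : ℝ) :
    ContDiffOn ℝ 1 (fun y : ℝ × ℝ => a * y.1 ^ b) (Ioi 0 ×ˢ Ioi 0) := by
  intro y hy
  exact (contDiffAt_const.mul
    (contDiffAt_fst.rpow_const_of_ne (ne_of_gt hy.1))).contDiffWithinAt

theorem fderiv_const_mul_rpow_fst (a b : ℝ) {y : ℝ × ℝ} (hy : 0 < y.1) (d : ℝ × ℝ) :
    fderiv ℝ (fun y : ℝ × ℝ => a * y.1 ^ b) y d = a * b * y.1 ^ (b - 1) * d.1 := by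
  have h1 : HasFDerivAt (fun y : ℝ × ℝ => y.1 ^ b) _ y :=
    (hasFDerivAt_fst (𝕜 := ℝ) (p := y)).rpow_const (Or.inl hy.ne')
  rw [(h1.const_mul a).fderiv]
  simp
  ring

theorem isLinearizedSolution (hM : M.Regular P) (hΘ : ContDiff ℝ 2 Θ) (hη : ContDiff ℝ 2 η)
    (hsol : ∀ᶠ t in 𝓝 (0 : ℝ), IsSolution P M (Θ + t • η) (S (Θ + t • η)))
    (h : IsGateauxDeriv P M S Θ η s') : IsLinearizedSolution P M Θ η (S Θ) s' := by
  set s : ℝ → State := fun t => S (Θ + t • η) with hs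
  have e0 : s 0 = S Θ := by simp [hs]
  rw [← e0]
  have hsol0 : IsSolution P M Θ (s 0) := by simpa [hs] using hsol.self_of_nhds
  have hsol' := hsol.filter_mono (nhdsWithin_le_nhds (s := {(0 : ℝ)}ᶜ))
  have hW := h.fieldDeriv hsol
  have hmom : LpDeriv P.vol ⊤ (fun t => M.density (s t)) (M.densityLin s') →
      LpDeriv P.vol 2 (fun t => M.pressure (s t)) (M.pressureLin (s 0) s') →
      ∀ v : Fin 3 → Pt → ℝ, (∀ i, P.IsWallTest (v i)) →
        HasDerivAt (fun t : ℝ => momentum P M (Θ + t • η) (s 0) (fun i => Jet.of (v i)))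
          (-momentumLin P M Θ (s 0) s' (fun i => Jet.of (v i))) 0 := fun hρ hπ v hv =>
    hasDerivAt_momentum hΘ hη hW hρ hπ (sqIntegrable_of_contDiff P fun i => (hv i).1)
      (fun i => memLp_top_of_contDiff P (hv i).1) (hsol0.2.1 v hv)
      (hsol'.mono fun t ht => ht.2.1 v hv)
  cases M with
  | incompressible =>
    have hp := HasLpDeriv.lpDeriv h.2.2.2 (hsol.mono fun _ ht => ht.2.2.1) h.2.2.1
    exact ⟨h.1, hmom (.const (memLp_top_const (1 : ℝ))) hp, h.2.2.1,
      divg_eq_zero hΘ hη hW hsol0.2.2.2 (hsol'.mono fun _ ht => ht.2.2.2)⟩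
  | compressible eos cv κ g =>
    obtain ⟨hρm, hρd, hTm, hTd, hT1, hT1d⟩ := h.2.2
    have hρ := hρd.lpDeriv (hsol.mono fun _ ht => ht.2.2.1.1) hρm
    have hT := hTd.lpDeriv (hsol.mono fun _ ht => ht.2.2.2.1.1) hTm
    have hTg : ∀ j, LpDeriv P.vol 2 (fun t p => (s t).temp.grad p j)
        (fun p => s'.temp.grad p j) := fun j =>
      (hT1d.2 j).lpDeriv (hsol.mono fun _ ht => (ht.2.2.2.2.1.2 j).1) (hT1.2 j).1
    obtain ⟨c₁, hc₁, hρc⟩ := hsol0.2.2.1.2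
    obtain ⟨c₂, hc₂, hTc⟩ := hsol0.2.2.2.1.2
    have hp := LpDeriv.comp₂ hM.1 hρ hT (lt_min hc₁ hc₂)
      (hρc.mono fun _ hx => (min_le_left _ _).trans hx)
      (hTc.mono fun _ hx => (min_le_right _ _).trans hx)
    refine ⟨h.1, hmom hρ hp.of_top, hT1, fun q hq => ⟨?_, ?_⟩⟩
    · exact massFlux_add_eq_zero (s := s) hW hρ hq.1 (hsol0.2.2.2.2.2 q hq).1
        (hsol'.mono fun _ ht => (ht.2.2.2.2.2 q hq).1)
    · exact hasDerivAt_energy hΘ hη hW hρ hp.of_top hTg (memLp_one_iff_integrable.2 hM.2.2.2) hq.1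
        (hsol0.2.2.2.2.2 q hq).2 (hsol'.mono fun _ ht => (ht.2.2.2.2.2 q hq).2)
  | isentropic a b =>
    obtain ⟨hρm, hρd⟩ := h.2.2
    have hρ := hρd.lpDeriv (hsol.mono fun _ ht => ht.2.2.1.1) hρm
    obtain ⟨c, hc, hρc⟩ := hsol0.2.2.1.2
    -- The density fills both slots, the second being irrelevant.
    have hp := (LpDeriv.comp₂ (contDiff_const_mul_rpow_fst a b) hρ hρ hc hρc hρc).congr_ae
      (fun _ => ae_eq_rfl) (G' := FlowModel.pressureLin (s 0) s' (.isentropic a b)) (by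
        filter_upwards [hρc] with p hx
        exact fderiv_const_mul_rpow_fst a b (hc.trans_le hx) _)
    exact ⟨h.1, hmom hρ hp.of_top, fun q hq =>
      massFlux_add_eq_zero (s := s) hW hρ hq.1 (hsol0.2.2.2 q hq)
        (hsol'.mono fun _ ht => ht.2.2.2 q hq)⟩

end Linearized

/-! ### The variation of the dissipation energy -/

section Variation

variable {ε μ : ℝ} {Θ η : Plane → ℝ}

/-- The variation of the covariant metric tensor in direction `η`. -/
noncomputable def gLowVar (ε : ℝ) (Θ η : Plane → ℝ) (x : Plane) : Fin 3 → Fin 3 → ℝ :=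
  assemble (fun α β => x 1 ^ 2 * (pd α η x * pd β Θ x + pd α Θ x * pd β η x))
    (fun α => ε * (x 1 ^ 2 * pd α η x)) 0

/-- The variation of the derivatives of the covariant metric tensor in direction `η`. -/
noncomputable def gLowPartialVar (ε : ℝ) (Θ η : Plane → ℝ) (x : Plane) (a : Fin 2) :
    Fin 3 → Fin 3 → ℝ :=
  assemble
    (fun α β => 2 * x 1 * kron a 1 * (pd α η x * pd β Θ x + pd α Θ x * pd β η x) +
      x 1 ^ 2 * (pd a (pd α η) x * pd β Θ x + pd a (pd α Θ) x * pd β η x +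
        (pd α η x * pd a (pd β Θ) x + pd α Θ x * pd a (pd β η) x)))
    (fun α => ε * (2 * x 1 * kron a 1 * pd α η x + x 1 ^ 2 * pd a (pd α η) x)) 0

/-- The part of the variation of the strain rate tensor that contains the second derivatives
of `η`. -/
noncomputable def strainHess (ε : ℝ) (Θ η : Plane → ℝ) (w : Field) (p : Pt) :
    Fin 3 → Fin 3 → ℝ :=
  assemble
    (fun α β => (1 / 2) * p.1 1 ^ 2 *
      ((∑ σ, (w (up σ)).val p * pd α (pd σ η) p.1) * pd β Θ p.1 +
        (∑ σ, (w (up σ)).val p * pd β (pd σ η) p.1) * pd α Θ p.1))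
    (fun α => (1 / 2) * ε * p.1 1 ^ 2 * ∑ σ, (w (up σ)).val p * pd α (pd σ η) p.1) 0

/-- The variation of the strain rate tensor in direction `η`, at fixed velocity. -/
noncomputable def strainVar (ε : ℝ) (Θ η : Plane → ℝ) (w : Field) (p : Pt) (i j : Fin 3) : ℝ :=
  (∑ l, pd l η p.1 * strain1 Θ w ε l p i j) + strainHess ε Θ η w p i j

/-- This identifies the explicit coefficients `strain1` and `strainHess` with the formal variation
of the Lie derivative formula for the strain. Mixed derivatives of `Θ` and `η` have to be
interchanged. -/
theorem strainVar_eq_lie (hΘ : ContDiff ℝ 2 Θ) (hη : ContDiff ℝ 2 η) {p : Pt} (hx : p.1 1 ≠ 0)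
    (w : Field) (i j : Fin 3) :
    strainVar ε Θ η w p i j = (1 / 2) * ∑ k, ((w k).val p *
        ![gLowPartialVar ε Θ η p.1 0 i j, gLowPartialVar ε Θ η p.1 1 i j, 0] k +
      (gLowVar ε Θ η p.1 j k * (w k).grad p i + gLowVar ε Θ η p.1 i k * (w k).grad p j)) := by
  have h1 := pd_comm hΘ 1 0 p.1
  have h2 := pd_comm hη 1 0 p.1
  fin_cases i <;> fin_cases j <;>
    simp [strainVar, strain1, strainHess, psi1, psi2, gLowVar, gLowPartialVar, assemble,
      Fin.sum_univ_two, Fin.sum_univ_three, kron, h1, h2] <;>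
    field_simp <;> ring

/-- With `b_α = w^σ η_ασ`, `b_3 = 0` and `c = r² (Θ_1, Θ_2, ε)`, the tensor `strainHess` is the
symmetrized product of `b` and `c`. Raising the index of `c` gives `(0, 0, ε⁻¹)`. So the trace term
vanishes with `b_3`, and the rest is `2μ` times `s` applied to the raised `b` and `c`, where the
raised `b` is `(b_1, b_2, -ε⁻¹ b_α Θ_α)`. -/
theorem viscPair_strainHess (hε : ε ≠ 0) (p : Pt) (hx : p.1 1 ≠ 0) (w : Field)
    {s : Fin 3 → Fin 3 → ℝ} (hs : ∀ i j, s i j = s j i) :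
    viscPair μ ε Θ p.1 s (strainHess ε Θ η w p) =
      2 * μ / ε * ∑ α, (∑ σ, (w (up σ)).val p * pd α (pd σ η) p.1) *
        (s (up α) 2 - pd α Θ p.1 / ε * s 2 2) := by
  have h1 := hs 1 0
  have h2 := hs 2 0
  have h3 := hs 2 1
  -- The sums are made opaque, so that the identity is polynomial in two unknowns `b 0`, `b 1`.
  obtain ⟨b, hb⟩ : ∃ b : Fin 2 → ℝ, ∀ α, ∑ σ, (w (up σ)).val p * pd α (pd σ η) p.1 = b α :=
    ⟨_, fun _ => rfl⟩
  simp only [strainHess, hb]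
  simp [viscPair, visc, gUp, gradSq, assemble, Fin.sum_univ_two, Fin.sum_univ_three, h1, h2, h3]
  field_simp
  ring

/-- The first term yields `K`, the second and the last yield `Φ̂^λσ`. The isolated `∂_ξ w^α`
disappears only after integration over the fibre. -/
theorem strain_transverse (hε : ε ≠ 0) (hΘ : ContDiff ℝ 2 Θ) (p : Pt) (hx : p.1 1 ≠ 0)
    (w : Field) (α : Fin 2) :
    strain ε Θ w p (up α) 2 - pd α Θ p.1 / ε * strain ε Θ w p 2 2 =
      (1 / 2) * (ε * p.1 1 ^ 2 * (∑ β, (w (up β)).val p * pd α (pd β Θ) p.1) +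
        ε * p.1 1 ^ 2 * (ε * (w 2).grad p (up α) + ∑ ν, (w (up ν)).grad p (up α) * pd ν Θ p.1) +
        (w (up α)).grad p 2 -
        p.1 1 ^ 2 * pd α Θ p.1 *
          (ε * (w 2).grad p 2 + ∑ ν, (w (up ν)).grad p 2 * pd ν Θ p.1)) := by
  have h1 := pd_comm hΘ 1 0 p.1
  rw [strain_eq_lie hε hx, strain_eq_lie hε hx]
  simp only [gLowDeriv_eq hΘ]
  fin_cases α <;>
    simp [gLow, gLowPartial, assemble, Fin.sum_univ_two, Fin.sum_univ_three, kron, h1] <;>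
    field_simp <;> ring

end Variation

/-! ### Differentiability of the metric, the strain and the dissipation along the variation -/

section VariationLp

variable {P : Passage} {Θ η : Plane → ℝ}

theorem lpDeriv_radius : LpDeriv P.vol ⊤ (fun _ p => p.1 1) (fun _ : Pt => 0) :=
  .const P.memLp_radius

theorem lpDeriv_radius_inv : LpDeriv P.vol ⊤ (fun _ p => (p.1 1)⁻¹) (fun _ : Pt => 0) :=
  .const P.memLp_radius_inv

theorem lpDeriv_const (c : ℝ) : LpDeriv P.vol ⊤ (fun _ _ => c) (fun _ : Pt => 0) :=
  .const (memLp_top_const c)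

theorem LpDeriv.sq {X : Type} [MeasurableSpace X] {ν : Measure X} {F : ℝ → X → ℝ} {G : X → ℝ}
    (h : LpDeriv ν ⊤ F G) :
    LpDeriv ν ⊤ (fun t x => F t x ^ 2) (fun x => 2 * F 0 x * G x) :=
  (h.mul h).congr (fun _ _ => (pow_two _).symm) fun _ => by ring

theorem lpDeriv_gUp (hΘ : ContDiff ℝ 2 Θ) (hη : ContDiff ℝ 2 η) (i j : Fin 3) :
    LpDeriv P.vol ⊤ (fun (t : ℝ) p => gUp P.ε (Θ + t • η) p.1 i j)
      (fun p => ∑ l, pd l η p.1 * gUp1 Θ P.ε l p.1 i j) := by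
  have h1 := lpDeriv_pd (P := P) hΘ hη
  simp only [gUp_eq_assemble]
  refine (LpDeriv.assemble (fun α β => lpDeriv_const (kron α β))
    (fun α => (h1 α).const_mul _)
    (((lpDeriv_radius_inv.sq).mul ((lpDeriv_const 1).add
      ((lpDeriv_radius.sq).mul (((h1 0).sq).add ((h1 1).sq))))).const_mul _)
    i j).congr_ae (fun _ => ae_eq_rfl) ?_
  filter_upwards [P.ae_radius_ne_zero] with p hp
  have hε := P.ε_pos.ne'
  fin_cases i <;> fin_cases j <;>
    simp [assemble, gUp1, kron, Fin.sum_univ_two] <;> field_simp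

theorem lpDeriv_visc (hΘ : ContDiff ℝ 2 Θ) (hη : ContDiff ℝ 2 η) (μ : ℝ) (i j k m : Fin 3) :
    LpDeriv P.vol ⊤ (fun (t : ℝ) p => visc μ P.ε (Θ + t • η) p.1 i j k m)
      (fun p => ∑ l, pd l η p.1 * visc1 Θ μ P.ε l p.1 i j k m) := by
  have h := lpDeriv_gUp (P := P) hΘ hη
  refine ((((h i j).mul (h k m)).const_mul (-(2 / 3) * μ)).add
    ((((h i k).mul (h j m)).add ((h i m).mul (h j k))).const_mul μ)).congr
    (fun _ _ => rfl) fun p => ?_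
  simp only [visc1, Fin.sum_univ_two, zero_smul, add_zero]
  ring

theorem lpDeriv_gLow (hΘ : ContDiff ℝ 2 Θ) (hη : ContDiff ℝ 2 η) (i j : Fin 3) :
    LpDeriv P.vol ⊤ (fun (t : ℝ) p => gLow P.ε (Θ + t • η) p.1 i j)
      (fun p => gLowVar P.ε Θ η p.1 i j) := by
  have h1 := lpDeriv_pd (P := P) hΘ hη
  simp only [gLow_eq_assemble]
  refine (LpDeriv.assemble (fun α β => (lpDeriv_const (kron α β)).add
      ((lpDeriv_radius.sq).mul ((h1 α).mul (h1 β))))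
    (fun α => ((lpDeriv_radius.sq).mul (h1 α)).const_mul _)
    ((lpDeriv_radius.sq).const_mul _) i j).congr (fun _ _ => rfl) fun p => ?_
  simp only [gLowVar, zero_smul, add_zero, mul_zero, zero_mul, zero_add]

theorem lpDeriv_gLowDeriv (hΘ : ContDiff ℝ 2 Θ) (hη : ContDiff ℝ 2 η) (k i j : Fin 3) :
    LpDeriv P.vol ⊤ (fun (t : ℝ) p => gLowDeriv P.ε (Θ + t • η) p.1 k i j)
      (fun p => ![gLowPartialVar P.ε Θ η p.1 0 i j, gLowPartialVar P.ε Θ η p.1 1 i j, 0] k) := by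
  have h1 := lpDeriv_pd (P := P) hΘ hη
  have h2 := lpDeriv_pd_pd (P := P) hΘ hη
  have hΘt : ∀ t : ℝ, ContDiff ℝ 2 (Θ + t • η) := fun t => hΘ.add (hη.const_smul t)
  have key : ∀ a, LpDeriv P.vol ⊤ (fun (t : ℝ) p => gLowPartial P.ε (Θ + t • η) p.1 a i j)
      (fun p => gLowPartialVar P.ε Θ η p.1 a i j) := fun a => by
    have c0 := (lpDeriv_radius (P := P)).const_mul 2
    have c1 := c0.mul (lpDeriv_const (kron a 1))
    have c2 := (lpDeriv_radius (P := P)).sq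
    refine (LpDeriv.assemble
      (fun α β => (c1.mul ((h1 α).mul (h1 β))).add (c2.mul
        (((h2 a α).mul (h1 β)).add ((h1 α).mul (h2 a β)))))
      (fun α => ((c1.mul (h1 α)).add (c2.mul (h2 a α))).const_mul P.ε)
      (c1.const_mul (P.ε ^ 2)) i j).congr (fun _ _ => rfl) fun p => ?_
    simp only [gLowPartialVar, zero_smul, add_zero, mul_zero, zero_mul, zero_add]
  simp only [gLowDeriv_eq (hΘt _)]
  fin_cases k
  exacts [key 0, key 1, lpDeriv_const 0]

/-- In the Lie derivative form the strain is a sum of metric coefficients, differentiable in `L^∞`,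
times components of the field, differentiable in `L²`. -/
theorem lpDeriv_strain (hΘ : ContDiff ℝ 2 Θ) (hη : ContDiff ℝ 2 η) {W : ℝ → Field} {w' : Field}
    (hW : FieldDeriv P.vol W w') (i j : Fin 3) :
    LpDeriv P.vol 2 (fun (t : ℝ) p => strain P.ε (Θ + t • η) (W t) p i j)
      (fun p => strain P.ε Θ w' p i j + strainVar P.ε Θ η (W 0) p i j) := by
  have hg := lpDeriv_gLow (P := P) hΘ hη
  refine ((LpDeriv.sum Finset.univ fun k => ((lpDeriv_gLowDeriv hΘ hη k i j).mul (hW.val k)).add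
    (((hg j k).mul (hW.grad k i)).add ((hg i k).mul (hW.grad k j)))).const_mul (1 / 2)).congr_ae
    (fun t => ?_) ?_
  · filter_upwards [P.ae_radius_ne_zero] with p hp
    rw [strain_eq_lie P.ε_pos.ne' hp]
    simp only [mul_comm (gLowDeriv _ _ _ _ _ _)]
  · filter_upwards [P.ae_radius_ne_zero] with p hp
    rw [strain_eq_lie P.ε_pos.ne' hp, strainVar_eq_lie hΘ hη hp]
    simp only [zero_smul, add_zero, Fin.sum_univ_three]
    ring

theorem lpDeriv_viscPair (hΘ : ContDiff ℝ 2 Θ) (hη : ContDiff ℝ 2 η) {W : ℝ → Field} {w' : Field}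
    (hW : FieldDeriv P.vol W w') :
    LpDeriv P.vol 1 (fun (t : ℝ) p => viscPair P.μ P.ε (Θ + t • η) p.1
        (strain P.ε (Θ + t • η) (W t) p) (strain P.ε (Θ + t • η) (W t) p))
      (fun p => (∑ l, pd l η p.1 * Mterm P Θ (W 0) l p) +
        2 * viscPair P.μ P.ε Θ p.1 (strain P.ε Θ (W 0) p)
          (fun i j => strain P.ε Θ w' p i j + strainVar P.ε Θ η (W 0) p i j)) := by
  have hs := lpDeriv_strain hΘ hη hW
  refine (LpDeriv.sum Finset.univ fun i => LpDeriv.sum Finset.univ fun j =>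
    LpDeriv.sum Finset.univ fun k => LpDeriv.sum Finset.univ fun m =>
      ((lpDeriv_visc hΘ hη P.μ i j k m).mul (hs k m)).mul_two (hs i j)).congr
    (fun _ _ => rfl) fun p => ?_
  simp only [zero_smul, add_zero]
  rw [two_mul]
  -- The two strain factors contribute the same pairing with its arguments in opposite order.
  nth_rewrite 1 [viscPair_comm]
  simp only [viscPair, Mterm, Fin.sum_univ_two, Finset.mul_sum, ← Finset.sum_add_distrib]
  refine Finset.sum_congr rfl fun i _ => Finset.sum_congr rfl fun j _ =>
    Finset.sum_congr rfl fun k _ => Finset.sum_congr rfl fun m _ => ?_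
  ring

end VariationLp

/-! ### Integration over the fibres `{x} × (-1, 1)` -/

section Fibre

variable {P : Passage}

/-- `A` and `f` are integrable, with the same integral over `D` and `Ω` respectively. -/
structure FibreIntegral (P : Passage) (A : Plane → ℝ) (f : Pt → ℝ) : Prop where
  integrableOn : IntegrableOn A P.D
  integrable : Integrable f P.vol
  integral_eq : ∫ x in P.D, A x = ∫ p, f p ∂P.vol

variable {A B : Plane → ℝ} {f g : Pt → ℝ}

theorem FibreIntegral.add (h : FibreIntegral P A f) (h' : FibreIntegral P B g) :
    FibreIntegral P (fun x => A x + B x) (fun p => f p + g p) :=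
  ⟨h.1.add h'.1, h.2.add h'.2, by
    rw [integral_add h.1 h'.1, integral_add h.2 h'.2, h.3, h'.3]⟩

theorem FibreIntegral.sum {κ : Type} (s : Finset κ) {A : κ → Plane → ℝ} {f : κ → Pt → ℝ}
    (h : ∀ k, FibreIntegral P (A k) (f k)) :
    FibreIntegral P (fun x => ∑ k ∈ s, A k x) (fun p => ∑ k ∈ s, f k p) :=
  ⟨integrable_finsetSum _ fun k _ => (h k).1, integrable_finsetSum _ fun k _ => (h k).2, by
    rw [integral_finsetSum _ fun k _ => (h k).1, integral_finsetSum _ fun k _ => (h k).2]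
    exact Finset.sum_congr rfl fun k _ => (h k).3⟩

theorem FibreIntegral.congr (h : FibreIntegral P A f) (hA : ∀ x, A x = B x)
    (hf : ∀ p, f p = g p) : FibreIntegral P B g := by
  obtain rfl : A = B := funext hA
  obtain rfl : f = g := funext hf
  exact h

/-- Fubini's theorem. The weight is bounded and constant along each fibre, so it leaves the inner
integral. -/
theorem FibreIntegral.of_integrable (hf : Integrable f P.vol) {c : Plane → ℝ}
    (hc : ContinuousOn c (closure P.D)) :
    FibreIntegral P (fun x => c x * ∫ ξ in Ioo (-1 : ℝ) 1, f (x, ξ)) (fun p => c p.1 * f p) := by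
  have hcf : Integrable (fun p => c p.1 * f p) P.vol :=
    memLp_one_iff_integrable.1 (((memLp_one_iff_integrable.2 hf).mul' (P.memLp_top_fst hc)))
  refine ⟨?_, hcf, ?_⟩
  · rw [P.vol_eq_prod] at hcf
    have := hcf.integral_prod_left
    simp only [integral_const_mul] at this
    exact this
  · rw [P.vol_eq_prod] at hcf ⊢
    rw [integral_prod _ hcf]
    simp only [integral_const_mul]

end Fibre

/-! ### Vanishing traces on the blades -/

section Boundary

variable {P : Passage}

theorem hasDerivAt_fibre {φ : Pt → ℝ} (hφ : ContDiff ℝ ∞ φ) (x : Plane) (ξ : ℝ) :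
    HasDerivAt (fun s => φ (x, s)) (fderiv ℝ φ (x, ξ) (dir 2)) ξ := by
  have h1 : HasFDerivAt φ (fderiv ℝ φ (x, ξ)) (x, ξ) :=
    (hφ.differentiable (by simp) _).hasFDerivAt
  have h2 : HasDerivAt (fun s : ℝ => (x, s)) ((0 : Plane), (1 : ℝ)) ξ :=
    (hasDerivAt_const ξ x).prodMk (hasDerivAt_id ξ)
  exact h1.comp_hasDerivAt ξ h2

theorem Passage.IsWallTest.eq_zero {φ : Pt → ℝ} (hφ : P.IsWallTest φ) {x : Plane} (hx : x ∈ P.D)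
    {ξ : ℝ} (hξ : ξ = -1 ∨ ξ = 1) : φ (x, ξ) = 0 :=
  hφ.2.self_of_nhdsSet (x, ξ) (Or.inr ⟨subset_closure hx, by simpa using hξ⟩)

/-- The integrand is `∂_ξ (φ ψ)`, and the product vanishes at `ξ = ±1`. -/
theorem integral_fibre_eq_zero {φ ψ : Pt → ℝ} (hφ : P.IsWallTest φ) (hψ : P.IsWallTest ψ)
    {x : Plane} (hx : x ∈ P.D) :
    ∫ ξ in Ioo (-1 : ℝ) 1, (φ (x, ξ) * fderiv ℝ ψ (x, ξ) (dir 2) +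
      ψ (x, ξ) * fderiv ℝ φ (x, ξ) (dir 2)) = 0 := by
  have hc : ∀ {χ : Pt → ℝ}, ContDiff ℝ ∞ χ →
      Continuous fun ξ : ℝ => fderiv ℝ χ (x, ξ) (dir 2) := fun hχ =>
    ((hχ.continuous_fderiv (by simp)).comp (by fun_prop)).clm_apply continuous_const
  have hc' : ∀ {χ : Pt → ℝ}, ContDiff ℝ ∞ χ → Continuous fun ξ : ℝ => χ (x, ξ) := fun hχ =>
    hχ.continuous.comp (by fun_prop)
  rw [← integral_Ioc_eq_integral_Ioo, ← intervalIntegral.integral_of_le (by norm_num),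
    intervalIntegral.integral_eq_sub_of_hasDerivAt (f := fun ξ => φ (x, ξ) * ψ (x, ξ))]
  · simp [hφ.eq_zero hx (Or.inr rfl), hφ.eq_zero hx (Or.inl rfl)]
  · intro ξ _
    refine ((hasDerivAt_fibre hφ.1 x ξ).mul (hasDerivAt_fibre hψ.1 x ξ)).congr_deriv ?_
    ring
  · exact (((hc' hφ.1).mul (hc hψ.1)).add ((hc' hψ.1).mul (hc hφ.1))).intervalIntegrable _ _

theorem Passage.MemV.exists_tendsto {w : Field} (hw : P.MemV w) (i : Fin 3) :
    ∃ φ : ℕ → Pt → ℝ, (∀ n, P.IsWallTest (φ n)) ∧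
      LpTendsto P.vol 2 atTop (fun n => φ n) (w i).val ∧
      ∀ j, LpTendsto P.vol 2 atTop (fun n p => fderiv ℝ (φ n) p (dir j))
        (fun p => (w i).grad p j) := by
  obtain ⟨h1, h2, φ, hφ, hφ1, hφ2⟩ := hw i
  exact ⟨φ, hφ, ⟨Eventually.of_forall fun n =>
      (memLp_top_of_contDiff P (hφ n).1).mono_exponent le_top, h1, hφ1⟩,
    fun j => ⟨Eventually.of_forall fun n =>
      (memLp_top_fderiv P (hφ n).1 (dir j)).mono_exponent le_top, h2 j, hφ2 j⟩⟩

/-- The trace of a product of two components of a field in `V(Ω)` vanishes on the blades. -/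
theorem integral_fibre_deriv_eq_zero {w : Field} (hw : P.MemV w) (i j : Fin 3) {c : Plane → ℝ}
    (hc : ContinuousOn c (closure P.D)) :
    ∫ p, c p.1 * ((w i).val p * (w j).grad p 2 + (w j).val p * (w i).grad p 2) ∂P.vol = 0 := by
  -- Both components are approximated in `H¹` by functions vanishing near the wall. The products
  -- converge in `L¹`, so the integral is a limit of zeros.
  obtain ⟨φ, hφ, hφ1, hφ2⟩ := hw.exists_tendsto i
  obtain ⟨ψ, hψ, hψ1, hψ2⟩ := hw.exists_tendsto j
  have h := (LpTendsto.const (P.memLp_top_fst hc)).mul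
    ((hφ1.mul_two (hψ2 2)).add (hψ1.mul_two (hφ2 2)))
  refine tendsto_nhds_unique h.integral (tendsto_const_nhds.congr' ?_)
  filter_upwards [((hφ1.mul_two (hψ2 2)).add (hψ1.mul_two (hφ2 2))).memLp] with n hn
  rw [← (FibreIntegral.of_integrable (memLp_one_iff_integrable.1 hn) hc).integral_eq]
  refine (setIntegral_eq_zero_of_forall_eq_zero fun x hx => ?_).symm
  rw [integral_fibre_eq_zero (hφ n) (hψ n) hx, mul_zero]

end Boundary

/-! ### The variational equation -/

section Weak

variable {P : Passage} {Θ η : Plane → ℝ} {w w' : Field}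

theorem pd_pd_coord (α β i : Fin 2) (x : Plane) : pd α (pd β fun y => y i) x = 0 := by
  rw [show (pd β fun y => y i) = fun _ => kron β i from funext (pd_coord β i), pd_const]

theorem contDiff_coord (i : Fin 2) : ContDiff ℝ 2 fun y : Plane => y i :=
  (EuclideanSpace.proj (𝕜 := ℝ) i).contDiff

theorem memLp_strain (hΘ : ContDiff ℝ 2 Θ) (hw : SqIntegrable P.vol w) (i j : Fin 3) :
    MemLp (fun p => strain P.ε Θ w p i j) 2 P.vol :=
  ((SurfaceTendsto.const (l := (⊤ : Filter ℕ)) hΘ).strain P.ε (.const hw) i j).memLp_lim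

theorem integrable_viscPair (hΘ : ContDiff ℝ 2 Θ) (μ : ℝ) {s t : Pt → Fin 3 → Fin 3 → ℝ}
    (hs : ∀ i j, MemLp (fun p => s p i j) 2 P.vol) (ht : ∀ i j, MemLp (fun p => t p i j) 2 P.vol) :
    Integrable (fun p => viscPair μ P.ε Θ p.1 (s p) (t p)) P.vol :=
  memLp_one_iff_integrable.1 ((SurfaceTendsto.const (l := (⊤ : Filter ℕ)) hΘ).viscPair μ P.ε
    (fun i j => .const (hs i j)) fun i j => .const (ht i j)).memLp_lim

/-- The direction `η = x^l` has constant gradient and zero Hessian, so with the velocity fixed the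
derivative of the strain is exactly this coefficient. `memLp_visc1` uses the same device. -/
theorem memLp_strain1 (hΘ : ContDiff ℝ 2 Θ) (hw : SqIntegrable P.vol w) (l : Fin 2) (i j : Fin 3) :
    MemLp (fun p => strain1 Θ w P.ε l p i j) 2 P.vol := by
  have h0 : FieldDeriv P.vol (fun _ => w) (fun _ => ⟨fun _ => 0, fun _ _ => 0⟩) :=
    ⟨fun i => .const (hw i).1, fun i j => .const ((hw i).2 j)⟩
  convert (lpDeriv_strain hΘ (contDiff_coord l) h0 i j).2.memLp_lim using 2 with p
  have h1 : strainHess P.ε Θ (fun y => y l) w p i j = 0 := by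
    simp only [strainHess, pd_pd_coord]
    fin_cases i <;> fin_cases j <;> simp [assemble]
  have h2 : strain P.ε Θ (fun _ => ⟨fun _ => 0, fun _ _ => 0⟩) p i j = 0 := by
    simp [strain, cov]
  simp only [strainVar, pd_coord, h1, h2]
  simp [kron]

theorem memLp_visc1 (hΘ : ContDiff ℝ 2 Θ) (μ : ℝ) (n : Fin 2) (i j k l : Fin 3) :
    MemLp (fun p : Pt => visc1 Θ μ P.ε n p.1 i j k l) ⊤ P.vol := by
  convert (lpDeriv_visc (P := P) hΘ (contDiff_coord n) μ i j k l).2.memLp_lim using 2 with p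
  simp [pd_coord, kron]

theorem integrable_Mterm (hΘ : ContDiff ℝ 2 Θ) (hw : SqIntegrable P.vol w) (n : Fin 2) :
    Integrable (fun p => Mterm P Θ w n p) P.vol :=
  integrable_finsetSum _ fun i _ => integrable_finsetSum _ fun j _ =>
    integrable_finsetSum _ fun k _ => integrable_finsetSum _ fun l _ => memLp_one_iff_integrable.1
      ((memLp_strain hΘ hw k l).mul' ((memLp_strain hΘ hw i j).mul' (memLp_visc1 hΘ P.μ n i j k l)
        (r := 2)))

/-- The integrand on `Ω` whose fibre integral is the integrand of the variational form. -/
noncomputable def weakDensity (P : Passage) (Θ η : Plane → ℝ) (w w' : Field) (p : Pt) : ℝ :=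
  (∑ l, ∑ σ, pd l (pd σ η) p.1 * (2 * P.μ * p.1 1 ^ 3) *
    ((∑ α, pd l (pd α Θ) p.1 * ((w (up α)).val p * (w (up σ)).val p)) +
      P.ε * ((w (up σ)).val p * (w 2).grad p (up l)) +
      (∑ ν, pd ν Θ p.1 * ((w (up σ)).val p * (w (up ν)).grad p (up l))) -
      pd l Θ p.1 / P.ε * ((w (up σ)).val p *
        (P.ε * (w 2).grad p 2 + ∑ ν, (w (up ν)).grad p 2 * pd ν Θ p.1)))) +
  (∑ l, p.1 1 * pd l η p.1 * (2 * viscPair P.μ P.ε Θ p.1 (strain P.ε Θ w p)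
      (strain1 Θ w P.ε l p) + Mterm P Θ w l p)) +
  p.1 1 * (2 * viscPair P.μ P.ε Θ p.1 (strain P.ε Θ w p) (strain P.ε Θ w' p))

theorem integrable_mul_of_memLp_two {f g : Pt → ℝ} (hf : MemLp f 2 P.vol) (hg : MemLp g 2 P.vol) :
    Integrable (fun p => f p * g p) P.vol :=
  memLp_one_iff_integrable.1 (hg.mul' hf)

theorem fibreIntegral_Phi0 (hΘ : ContDiff ℝ 2 Θ) (hw : SqIntegrable P.vol w)
    (hw' : SqIntegrable P.vol w') :
    FibreIntegral P (fun x => x 1 * Phi0 P Θ w w' x)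
      (fun p => p.1 1 * (2 * viscPair P.μ P.ε Θ p.1 (strain P.ε Θ w p) (strain P.ε Θ w' p))) :=
  .of_integrable ((integrable_viscPair hΘ P.μ (memLp_strain hΘ hw) (memLp_strain hΘ hw')).const_mul 2)
    (c := fun x => x 1) (differentiable_coord 1).continuous.continuousOn

/-- Every summand is a continuous weight in `x` times an integrable function on `Ω`, so Fubini
applies term by term. This also proves the convergence of all integrals over `D`. -/
theorem fibreIntegral_weakIntegrand (hΘ : ContDiff ℝ 2 Θ) (hη : ContDiff ℝ 2 η)
    (hw : SqIntegrable P.vol w) (hw' : SqIntegrable P.vol w') :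
    FibreIntegral P (weakIntegrand P Θ w (Jet2.of η) w') (weakDensity P Θ η w w') := by
  have hr : Continuous fun x : Plane => x 1 := (differentiable_coord 1).continuous
  have c1 := fun α => continuous_pd hΘ α
  have c2 := fun α β => continuous_pd_pd hΘ α β
  have d1 := fun α => continuous_pd hη α
  have d2 := fun α β => continuous_pd_pd hη α β
  have hk : ∀ l σ, Continuous fun x : Plane => pd l (pd σ η) x * (2 * P.μ * x 1 ^ 3) :=
    fun l σ => (d2 l σ).mul (continuous_const.mul (hr.pow 3))
  have hξ : ∀ σ : Fin 2, Integrable (fun p : Pt => (w (up σ)).val p *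
      (P.ε * (w 2).grad p 2 + ∑ ν, (w (up ν)).grad p 2 * pd ν Θ p.1)) P.vol := fun σ =>
    integrable_mul_of_memLp_two (hw (up σ)).1 ((((hw 2).2 2).const_mul P.ε).add
      (memLp_finsetSum _ fun ν _ => (P.memLp_top_fst (c1 ν).continuousOn).mul' ((hw (up ν)).2 2)))
  have main := ((FibreIntegral.sum Finset.univ fun l : Fin 2 =>
    FibreIntegral.sum Finset.univ fun σ : Fin 2 =>
    (((FibreIntegral.sum Finset.univ fun α : Fin 2 =>
      FibreIntegral.of_integrable (P := P)
        (integrable_mul_of_memLp_two (hw (up α)).1 (hw (up σ)).1)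
        ((hk l σ).mul (c2 l α)).continuousOn).add
      (FibreIntegral.of_integrable (P := P)
        (integrable_mul_of_memLp_two (hw (up σ)).1 ((hw 2).2 (up l)))
        ((hk l σ).mul (continuous_const (y := P.ε))).continuousOn)).add
      (FibreIntegral.sum Finset.univ fun ν : Fin 2 =>
        FibreIntegral.of_integrable (P := P)
        (integrable_mul_of_memLp_two (hw (up σ)).1 ((hw (up ν)).2 (up l)))
        ((hk l σ).mul (c1 ν)).continuousOn)).add
      (FibreIntegral.of_integrable (P := P) (hξ σ)
        ((hk l σ).mul ((c1 l).div_const P.ε).neg).continuousOn)).add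
    (FibreIntegral.sum Finset.univ fun l : Fin 2 =>
      FibreIntegral.of_integrable (P := P)
        (((integrable_viscPair hΘ P.μ (memLp_strain hΘ hw) (memLp_strain1 hΘ hw l)).const_mul
          2).add (integrable_Mterm hΘ hw l)) (hr.mul (d1 l)).continuousOn)).add
    (fibreIntegral_Phi0 hΘ hw hw')
  refine main.congr (fun x => ?_) fun p => ?_
  · simp only [weakIntegrand, Kterm, Kten, Wten, Phi2, Phi1, Jet2.of, Fin.sum_univ_two, kron]
    simp
    ring
  · simp only [weakDensity, Fin.sum_univ_two, Pi.mul_apply, Pi.neg_apply, Pi.add_apply]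
    ring

/-- If the variation of the dissipation energy in direction `η` vanishes, then the variational
equation holds for `η`. -/
theorem weakEquation_of_variation (hΘ : ContDiff ℝ 2 Θ) (hη : ContDiff ℝ 2 η) (hw : P.MemV w)
    (hw' : SqIntegrable P.vol w')
    (h : ∫ p, P.ε * p.1 1 * ((∑ l, pd l η p.1 * Mterm P Θ w l p) +
        2 * viscPair P.μ P.ε Θ p.1 (strain P.ε Θ w p)
          (fun i j => strain P.ε Θ w' p i j + strainVar P.ε Θ η w p i j)) ∂P.vol = 0) :
    WeakEquation P Θ w (Jet2.of η) w' := by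
  have hε := P.ε_pos.ne'
  have hF := fibreIntegral_weakIntegrand hΘ hη hw.sqIntegrable hw'
  refine ⟨hF.integrableOn, hF.integral_eq.trans ?_⟩
  -- Weight of the extra term `2μr η_ασ w^σ ∂_ξ w^α`. By symmetry of the Hessian it equals `μr η_ασ
  -- ∂_ξ (w^σ w^α)`, summed over `α` and `σ`.
  set c : Fin 2 → Fin 2 → Plane → ℝ := fun α σ x => P.μ * x 1 * pd α (pd σ η) x with hc
  have hcc : ∀ α σ, ContinuousOn (c α σ) (closure P.D) := fun α σ =>
    ((continuous_const.mul (differentiable_coord 1).continuous).mul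
      (continuous_pd_pd hη α σ)).continuousOn
  have hR : ∀ α σ, Integrable (fun p => c α σ p.1 * ((w (up σ)).val p * (w (up α)).grad p 2 +
      (w (up α)).val p * (w (up σ)).grad p 2)) P.vol := fun α σ =>
    (FibreIntegral.of_integrable
      ((integrable_mul_of_memLp_two (hw (up σ)).1 ((hw (up α)).2.1 2)).add
        (integrable_mul_of_memLp_two (hw (up α)).1 ((hw (up σ)).2.1 2))) (hcc α σ)).integrable
  have hR0 : ∫ p, ∑ α, ∑ σ, c α σ p.1 * ((w (up σ)).val p * (w (up α)).grad p 2 +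
      (w (up α)).val p * (w (up σ)).grad p 2) ∂P.vol = 0 := by
    rw [integral_finsetSum _ fun α _ => integrable_finsetSum _ fun σ _ => hR α σ]
    refine Finset.sum_eq_zero fun α _ => ?_
    rw [integral_finsetSum _ fun σ _ => hR α σ]
    exact Finset.sum_eq_zero fun σ _ => integral_fibre_deriv_eq_zero hw _ _ (hcc α σ)
  -- Where `r ≠ 0`, the density of the variation is `ε` times that of the variational form plus the
  -- remainder just shown to integrate to zero.
  have hpt : ∀ᵐ p ∂P.vol, P.ε * p.1 1 * ((∑ l, pd l η p.1 * Mterm P Θ w l p) +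
        2 * viscPair P.μ P.ε Θ p.1 (strain P.ε Θ w p)
          (fun i j => strain P.ε Θ w' p i j + strainVar P.ε Θ η w p i j)) =
      P.ε * weakDensity P Θ η w w' p +
        ∑ α, ∑ σ, c α σ p.1 * ((w (up σ)).val p * (w (up α)).grad p 2 +
          (w (up α)).val p * (w (up σ)).grad p 2) := by
    filter_upwards [P.ae_radius_ne_zero] with p hr
    have e : strainVar P.ε Θ η w p = fun i j =>
        (pd 0 η p.1 * strain1 Θ w P.ε 0 p i j + pd 1 η p.1 * strain1 Θ w P.ε 1 p i j) +
          strainHess P.ε Θ η w p i j := by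
      funext i j
      simp only [strainVar, Fin.sum_univ_two]
    rw [viscPair_add_right P.μ _ (strain P.ε Θ w' p), e,
      viscPair_add_right P.μ _ (fun i j => pd 0 η p.1 * strain1 Θ w P.ε 0 p i j +
        pd 1 η p.1 * strain1 Θ w P.ε 1 p i j),
      viscPair_add_right, viscPair_mul_right, viscPair_mul_right,
      viscPair_strainHess hε p hr w (strain_symm w p)]
    simp only [strain_transverse hε hΘ p hr, weakDensity, hc, Fin.sum_univ_two,
      pd_comm hη 1 0 p.1]
    field_simp
    ring
  rw [integral_congr_ae hpt, integral_add (hF.integrable.const_mul _)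
    (integrable_finsetSum _ fun α _ => integrable_finsetSum _ fun σ _ => hR α σ), hR0, add_zero,
    integral_const_mul] at h
  exact (mul_eq_zero.1 h).resolve_left hε

end Weak

/-! ### Minimizers of the dissipation energy -/

theorem Passage.IsTest.contDiff_two {P : Passage} {η : Plane → ℝ} (h : P.IsTest η) :
    ContDiff ℝ 2 η :=
  mod_cast contDiff_infty.1 h.1 2

section Minimizer

variable {P : Passage} {Θ η : Plane → ℝ}

/-- Fermat's rule for the energy as a function of `t`, which is differentiable because its integrand
is so in `L¹`. -/
theorem weakEquation_of_isLocalMin (hΘ : ContDiff ℝ 2 Θ) (hη : ContDiff ℝ 2 η) {W : ℝ → Field}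
    {w' : Field} (hW : FieldDeriv P.vol W w') (hV : P.MemV (W 0))
    (hmin : IsLocalMin (fun t : ℝ => dissipation P (Θ + t • η) (W t)) 0) :
    WeakEquation P Θ (W 0) (Jet2.of η) w' := by
  refine weakEquation_of_variation hΘ hη hV hW.sqIntegrable ?_
  have h := ((LpDeriv.const ((P.memLp_radius).const_mul P.ε)).mul
    (lpDeriv_viscPair hΘ hη hW)).hasDerivAt_integral.const_mul (1 / 2)
  have h' : HasDerivAt (fun t : ℝ => dissipation P (Θ + t • η) (W t)) _ 0 :=
    h.congr_of_eventuallyEq (Eventually.of_forall fun t => by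
      simp only [dissipation, mul_comm (P.ε * _)])
  have h0 := hmin.hasDerivAt_eq_zero h'
  simp only [zero_mul, zero_add] at h0
  exact (mul_eq_zero.1 h0).resolve_left (by norm_num)

end Minimizer

/-! ### The equation in `H²₀` -/

section Closure

variable {P : Passage} {Θ : Plane → ℝ} {w : Field}

/-- The coefficients of the derivatives of `η` are in `L²`, where these derivatives converge, so the
products converge in `L¹`. -/
theorem weakEquation_of_tendsto (hΘ : ContDiff ℝ 2 Θ) (hw : SqIntegrable P.vol w)
    (hK : ∀ l σ, MemLp (fun x => Kterm P Θ w l σ x + x 1 * Phi2 P Θ w l σ x) 2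
      (volume.restrict P.D))
    (hΦ : ∀ l, MemLp (fun x => x 1 * Phi1 P Θ w l x) 2 (volume.restrict P.D))
    {η : Jet2} {φ : ℕ → Plane → ℝ} {W : ℕ → Field} {w' : Field} (hφ : H2Tendsto P φ η)
    (hW : FieldTendsto P.vol atTop W w') (hW2 : ∀ n, SqIntegrable P.vol (W n))
    (heq : ∀ n, WeakEquation P Θ w (Jet2.of (φ n)) (W n)) : WeakEquation P Θ w η w' := by
  obtain ⟨hT, -, hg, hh, -, hgt, hht⟩ := hφ
  have hb : ∀ {c : Plane → ℝ}, Continuous c → MemLp c 2 (volume.restrict P.D) := fun {c} hc => by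
    obtain ⟨C, hC⟩ := P.isBounded_D.isCompact_closure.exists_bound_of_continuousOn hc.continuousOn
    refine MemLp.of_bound hc.aestronglyMeasurable C ?_
    filter_upwards [ae_restrict_mem P.isOpen_D.measurableSet] with x hx
    exact hC x (subset_closure hx)
  have h2 : ∀ l σ, LpTendsto (volume.restrict P.D) 2 atTop (fun n => pd l (pd σ (φ n)))
      (η.hess l σ) := fun l σ =>
    ⟨Eventually.of_forall fun n => hb (continuous_pd_pd (hT n).contDiff_two l σ), hh l σ, hht l σ⟩
  have h1 : ∀ l, LpTendsto (volume.restrict P.D) 2 atTop (fun n => pd l (φ n)) (η.grad l) :=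
    fun l => ⟨Eventually.of_forall fun n => hb (continuous_pd (hT n).contDiff_two l), hg l, hgt l⟩
  have hA := (LpTendsto.sum Finset.univ fun l => LpTendsto.sum Finset.univ fun σ =>
    (LpTendsto.const (hK l σ)).mul_two (h2 l σ)).add
      (LpTendsto.sum Finset.univ fun l => (LpTendsto.const (hΦ l)).mul_two (h1 l))
  have hS : SurfaceTendsto P (atTop : Filter ℕ) (fun _ => Θ) Θ := .const hΘ
  -- The term with the velocity derivative passes to the limit on `Ω`, where convergence in `H¹` is
  -- available, and is carried back to `D` by `fibreIntegral_Phi0`.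
  have hB := lpTendsto_radius.mul ((hS.viscPair P.μ P.ε (hS.strain P.ε (.const hw))
    (hS.strain P.ε hW)).const_mul 2)
  have hw' : SqIntegrable P.vol w' := fun i => ⟨(hW i).1.memLp_lim, fun j => ((hW i).2 j).memLp_lim⟩
  have hF := fibreIntegral_Phi0 hΘ hw hw'
  have hAi := memLp_one_iff_integrable.1 hA.memLp_lim
  refine ⟨hAi.add hF.integrableOn, ?_⟩
  have e : ∫ x in P.D, weakIntegrand P Θ w η w' x = _ := integral_add hAi hF.integrableOn
  rw [e, hF.integral_eq]
  refine tendsto_nhds_unique (hA.integral.add hB.integral) (tendsto_const_nhds.congr' ?_)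
  filter_upwards [hA.memLp] with n hn
  have hFn := fibreIntegral_Phi0 hΘ hw (hW2 n)
  rw [← hFn.integral_eq, ← integral_add (memLp_one_iff_integrable.1 hn) hFn.integrableOn]
  exact (heq n).2.symm

end Closure

/-! ### The pointwise equation -/

/-- `f` is integrable, with integral `a`. -/
structure IntegralEq {X : Type} [MeasurableSpace X] (ν : Measure X) (f : X → ℝ) (a : ℝ) :
    Prop where
  integrable : Integrable f ν
  integral_eq : ∫ x, f x ∂ν = a

section IntegralEq

variable {X : Type} [MeasurableSpace X] {ν : Measure X} {f g : X → ℝ} {a b : ℝ}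

theorem IntegralEq.of_integrable (h : Integrable f ν) : IntegralEq ν f (∫ x, f x ∂ν) := ⟨h, rfl⟩

theorem IntegralEq.add (h : IntegralEq ν f a) (h' : IntegralEq ν g b) :
    IntegralEq ν (fun x => f x + g x) (a + b) :=
  ⟨h.1.add h'.1, by rw [integral_add h.1 h'.1, h.2, h'.2]⟩

theorem IntegralEq.sub (h : IntegralEq ν f a) (h' : IntegralEq ν g b) :
    IntegralEq ν (fun x => f x - g x) (a - b) :=
  ⟨h.1.sub h'.1, by rw [integral_sub h.1 h'.1, h.2, h'.2]⟩

theorem IntegralEq.const_mul (c : ℝ) (h : IntegralEq ν f a) :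
    IntegralEq ν (fun x => c * f x) (c * a) :=
  ⟨h.1.const_mul c, by rw [integral_const_mul, h.2]⟩

theorem IntegralEq.sum {κ : Type} (s : Finset κ) {f : κ → X → ℝ} {a : κ → ℝ}
    (h : ∀ k, IntegralEq ν (f k) (a k)) :
    IntegralEq ν (fun x => ∑ k ∈ s, f k x) (∑ k ∈ s, a k) :=
  ⟨integrable_finsetSum _ fun k _ => (h k).1, by
    rw [integral_finsetSum _ fun k _ => (h k).1]
    exact Finset.sum_congr rfl fun k _ => (h k).2⟩

theorem IntegralEq.congr (h : IntegralEq ν f a) (hf : ∀ x, f x = g x) : IntegralEq ν g a := by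
  obtain rfl : f = g := funext hf
  exact h

end IntegralEq

section Pointwise

variable {P : Passage} {u φ : Plane → ℝ}

theorem Passage.IsTest.pd (hφ : P.IsTest φ) (α : Fin 2) : P.IsTest (pd α φ) := by
  have hs : tsupport (Blade.pd α φ) ⊆ tsupport φ :=
    tsupport_fderiv_apply_subset ℝ (EuclideanSpace.single α 1)
  exact ⟨(hφ.1.fderiv_right (m := ∞) (by simp)).clm_apply contDiff_const,
    hφ.2.1.mono' (subset_closure.trans hs), hs.trans hφ.2.2⟩

/-- Outside `D` nothing is known about `u`, but the product is supported in a compact subset of `D`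
and is therefore continuous on the whole plane. -/
theorem integrable_mul_test (hu : ContinuousOn u P.D) (hφ : P.IsTest φ) :
    Integrable (fun x => u x * φ x) := by
  refine Continuous.integrable_of_hasCompactSupport ?_ hφ.2.1.mul_left
  refine continuous_of_tsupport fun x hx => ?_
  have hx' : x ∈ P.D := hφ.2.2 (closure_mono (Function.support_mul_subset_right u φ) hx)
  exact (hu.continuousAt (P.isOpen_D.mem_nhds hx')).mul hφ.1.continuous.continuousAt

theorem integralEq_mul_test (hu : ContinuousOn u P.D) (hφ : P.IsTest φ) :
    IntegralEq (volume.restrict P.D) (fun x => u x * φ x) (∫ x in P.D, u x * φ x) :=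
  .of_integrable (integrable_mul_test hu hφ).integrableOn

theorem setIntegral_mul_test (hφ : P.IsTest φ) (u : Plane → ℝ) :
    ∫ x in P.D, u x * φ x = ∫ x, u x * φ x := by
  refine setIntegral_eq_integral_of_forall_compl_eq_zero fun x hx => ?_
  rw [image_eq_zero_of_notMem_tsupport fun h => hx (hφ.2.2 h), mul_zero]

theorem continuousOn_pd (hu : ContDiffOn ℝ 1 u P.D) (α : Fin 2) : ContinuousOn (pd α u) P.D :=
  (hu.continuousOn_fderiv_of_isOpen P.isOpen_D le_rfl).clm_apply continuousOn_const

theorem contDiffOn_pd (hu : ContDiffOn ℝ 2 u P.D) (α : Fin 2) : ContDiffOn ℝ 1 (pd α u) P.D :=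
  (hu.fderiv_of_isOpen P.isOpen_D (m := 1) (by norm_num)).clm_apply contDiffOn_const

theorem integral_mul_pd_test (hu : ContDiffOn ℝ 1 u P.D) (hφ : P.IsTest φ) (α : Fin 2) :
    ∫ x in P.D, u x * pd α φ x = -∫ x in P.D, pd α u x * φ x := by
  rw [setIntegral_mul_test (hφ.pd α), setIntegral_mul_test hφ]
  exact integral_mul_fderiv_eq_neg_fderiv_mul_of_integrable
    (integrable_mul_test (continuousOn_pd hu α) hφ)
    (integrable_mul_test hu.continuousOn (hφ.pd α)) (integrable_mul_test hu.continuousOn hφ)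
    (fun x hx => (hu.differentiableOn one_ne_zero).differentiableAt
      (P.isOpen_D.mem_nhds (hφ.2.2 hx)))
    fun x _ => hφ.1.differentiable (by simp) x

theorem integral_mul_pd_pd_test (hu : ContDiffOn ℝ 2 u P.D) (hφ : P.IsTest φ) (α β : Fin 2) :
    ∫ x in P.D, u x * pd α (pd β φ) x = ∫ x in P.D, pd α (pd β u) x * φ x := by
  -- Interchanging the derivatives of `φ` first makes those of `u` come out in the stated order.
  simp only [pd_comm hφ.contDiff_two α β]
  rw [integral_mul_pd_test (hu.of_le one_le_two) (hφ.pd α),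
    integral_mul_pd_test (contDiffOn_pd hu β) hφ, neg_neg]

/-- The fundamental lemma gives zero almost everywhere, and continuity on the open set `D` gives it
everywhere. -/
theorem eqOn_zero_of_integral_test (hu : ContinuousOn u P.D)
    (h : ∀ φ, P.IsTest φ → ∫ x in P.D, u x * φ x = 0) : ∀ x ∈ P.D, u x = 0 := by
  have h1 : ∀ᵐ x ∂volume, x ∈ P.D → u x = 0 := by
    refine P.isOpen_D.ae_eq_zero_of_integral_contDiff_smul_eq_zero
      (hu.locallyIntegrableOn P.isOpen_D.measurableSet) fun g hg hc hs => ?_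
    have := h g ⟨hg, hc, hs⟩
    rw [setIntegral_mul_test ⟨hg, hc, hs⟩] at this
    simpa [mul_comm] using this
  exact Measure.eqOn_open_of_ae_eq (μ := volume)
    ((ae_restrict_iff' P.isOpen_D.measurableSet).2 h1) P.isOpen_D hu continuousOn_const

variable {Θ : Plane → ℝ} {w : Field}

theorem continuousOn_strongOperator (hK : ∀ l σ, ContDiffOn ℝ 2 (Kterm P Θ w l σ) P.D)
    (hΦ2 : ∀ l σ, ContDiffOn ℝ 2 (fun x => x 1 * Phi2 P Θ w l σ x) P.D)
    (hΦ1 : ∀ l, ContDiffOn ℝ 1 (fun x => x 1 * Phi1 P Θ w l x) P.D)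
    {Ψ : Plane → ℝ} (hΨ : ContinuousOn Ψ P.D) : ContinuousOn (strongOperator P Θ w Ψ) P.D :=
  (((continuousOn_finsetSum _ fun l _ => continuousOn_finsetSum _ fun σ _ =>
      continuousOn_pd (contDiffOn_pd (hK l σ) σ) l).add
    (continuousOn_finsetSum _ fun l _ => continuousOn_finsetSum _ fun σ _ =>
      continuousOn_pd (contDiffOn_pd (hΦ2 l σ) σ) l)).sub
    (continuousOn_finsetSum _ fun l _ => continuousOn_pd (hΦ1 l) l)).add
    ((differentiable_coord 1).continuous.continuousOn.mul hΨ)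

/-- Integration by parts turns the variational equation into the fourth-order equation. -/
theorem integral_Phi0_eq (hK : ∀ l σ, ContDiffOn ℝ 2 (Kterm P Θ w l σ) P.D)
    (hΦ2 : ∀ l σ, ContDiffOn ℝ 2 (fun x => x 1 * Phi2 P Θ w l σ x) P.D)
    (hΦ1 : ∀ l, ContDiffOn ℝ 1 (fun x => x 1 * Phi1 P Θ w l x) P.D) {w' : Field}
    (hφ : P.IsTest φ) (h : WeakEquation P Θ w (Jet2.of φ) w')
    (hi : IntegrableOn (fun x => x 1 * Phi0 P Θ w w' x) P.D) :
    ∫ x in P.D, x 1 * Phi0 P Θ w w' x =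
      -∫ x in P.D, strongOperator P Θ w (fun _ => 0) x * φ x := by
  have i1 : ∀ l σ, IntegralEq (volume.restrict P.D) (fun x => Kterm P Θ w l σ x * pd l (pd σ φ) x)
      (∫ x in P.D, pd l (pd σ (Kterm P Θ w l σ)) x * φ x) := fun l σ =>
    ⟨(integrable_mul_test (hK l σ).continuousOn ((hφ.pd σ).pd l)).integrableOn,
      integral_mul_pd_pd_test (hK l σ) hφ l σ⟩
  have i2 : ∀ l σ, IntegralEq (volume.restrict P.D)
      (fun x => x 1 * Phi2 P Θ w l σ x * pd l (pd σ φ) x)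
      (∫ x in P.D, pd l (pd σ fun y => y 1 * Phi2 P Θ w l σ y) x * φ x) := fun l σ =>
    ⟨(integrable_mul_test (hΦ2 l σ).continuousOn ((hφ.pd σ).pd l)).integrableOn,
      integral_mul_pd_pd_test (hΦ2 l σ) hφ l σ⟩
  have i3 : ∀ l, IntegralEq (volume.restrict P.D) (fun x => x 1 * Phi1 P Θ w l x * pd l φ x)
      (-∫ x in P.D, pd l (fun y => y 1 * Phi1 P Θ w l y) x * φ x) := fun l =>
    ⟨(integrable_mul_test (hΦ1 l).continuousOn (hφ.pd l)).integrableOn,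
      integral_mul_pd_test (hΦ1 l) hφ l⟩
  have e1 := ((((IntegralEq.sum Finset.univ fun l => IntegralEq.sum Finset.univ fun σ =>
    (i1 l σ).add (i2 l σ)).add (IntegralEq.sum Finset.univ i3)).add (.of_integrable hi)).congr
    (g := weakIntegrand P Θ w (Jet2.of φ) w') fun x => by
      simp only [weakIntegrand, Jet2.of, Fin.sum_univ_two]
      ring).integral_eq
  have e2 := ((((IntegralEq.sum Finset.univ fun l => IntegralEq.sum Finset.univ fun σ =>
    integralEq_mul_test (continuousOn_pd (contDiffOn_pd (hK l σ) σ) l) hφ).add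
    (IntegralEq.sum Finset.univ fun l => IntegralEq.sum Finset.univ fun σ =>
      integralEq_mul_test (continuousOn_pd (contDiffOn_pd (hΦ2 l σ) σ) l) hφ)).sub
    (IntegralEq.sum Finset.univ fun l => integralEq_mul_test (continuousOn_pd (hΦ1 l) l) hφ)).congr
    (g := fun x => strongOperator P Θ w (fun _ => 0) x * φ x) fun x => by
      simp only [strongOperator, Fin.sum_univ_two]
      ring).integral_eq
  have e3 := h.2
  simp only [Fin.sum_univ_two] at e1 e2
  linarith

/-- The integrated equation forces `rΨ` to be minus the remaining terms. Since `r > 0` on `D`, this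
determines a continuous `Ψ`. -/
theorem exists_density (hK : ∀ l σ, ContDiffOn ℝ 2 (Kterm P Θ w l σ) P.D)
    (hΦ2 : ∀ l σ, ContDiffOn ℝ 2 (fun x => x 1 * Phi2 P Θ w l σ x) P.D)
    (hΦ1 : ∀ l, ContDiffOn ℝ 1 (fun x => x 1 * Phi1 P Θ w l x) P.D)
    {W : (Plane → ℝ) → Field}
    (h : ∀ φ, P.IsTest φ → WeakEquation P Θ w (Jet2.of φ) (W φ) ∧
      IntegrableOn (fun x => x 1 * Phi0 P Θ w (W φ) x) P.D) :
    ∃ Ψ : Plane → ℝ, ContinuousOn Ψ P.D ∧ ∀ φ, P.IsTest φ →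
      ∫ x in P.D, x 1 * Phi0 P Θ w (W φ) x = ∫ x in P.D, x 1 * Ψ x * φ x := by
  refine ⟨fun x => -(strongOperator P Θ w (fun _ => 0) x / x 1),
    ((continuousOn_strongOperator hK hΦ2 hΦ1 continuousOn_const).div
      (differentiable_coord 1).continuous.continuousOn
      fun x hx => (P.radius_pos' hx).ne').neg, fun φ hφ => ?_⟩
  rw [integral_Phi0_eq hK hΦ2 hΦ1 hφ (h φ hφ).1 (h φ hφ).2, ← integral_neg]
  refine setIntegral_congr_fun P.isOpen_D.measurableSet fun x hx => ?_
  have := (P.radius_pos' hx).ne'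
  simp only []
  field_simp

theorem strongOperator_eq_zero (hK : ∀ l σ, ContDiffOn ℝ 2 (Kterm P Θ w l σ) P.D)
    (hΦ2 : ∀ l σ, ContDiffOn ℝ 2 (fun x => x 1 * Phi2 P Θ w l σ x) P.D)
    (hΦ1 : ∀ l, ContDiffOn ℝ 1 (fun x => x 1 * Phi1 P Θ w l x) P.D)
    {W : (Plane → ℝ) → Field}
    (h : ∀ φ, P.IsTest φ → WeakEquation P Θ w (Jet2.of φ) (W φ) ∧
      IntegrableOn (fun x => x 1 * Phi0 P Θ w (W φ) x) P.D)
    {Ψ : Plane → ℝ} (hΨ : ContinuousOn Ψ P.D) (hΨ' : ∀ φ, P.IsTest φ →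
      ∫ x in P.D, x 1 * Phi0 P Θ w (W φ) x = ∫ x in P.D, x 1 * Ψ x * φ x) :
    ∀ x ∈ P.D, strongOperator P Θ w Ψ x = 0 := by
  refine eqOn_zero_of_integral_test (continuousOn_strongOperator hK hΦ2 hΦ1 hΨ) fun φ hφ => ?_
  have h1 := integral_Phi0_eq hK hΦ2 hΦ1 hφ (h φ hφ).1 (h φ hφ).2
  rw [hΨ' φ hφ] at h1
  have hr : ContinuousOn (fun x : Plane => x 1) P.D :=
    (differentiable_coord 1).continuous.continuousOn
  have e : ∀ x, strongOperator P Θ w Ψ x * φ x =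
      strongOperator P Θ w (fun _ => 0) x * φ x + x 1 * Ψ x * φ x := fun x => by
    simp only [strongOperator]
    ring
  have h2 := (integralEq_mul_test (continuousOn_strongOperator hK hΦ2 hΦ1
    (continuousOn_const (c := (0 : ℝ)))) hφ).add
    (integralEq_mul_test (hr.mul hΨ) hφ)
  refine ((h2.congr fun x => (e x).symm).integral_eq).trans ?_
  simp only [Pi.mul_apply, h1, add_neg_cancel]

end Pointwise

/-! ### Ellipticity -/

/-- The contraction of `K` with `ζ` factors as `2μr³ |ζ|² ∫ (ζ_α w^α)² dξ`, and an integral of a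
square vanishes only if the function does almost everywhere. -/
theorem ellipticity {P : Passage} {w : Field} (hw : SqIntegrable P.vol w) :
    ∀ᵐ x ∂(volume.restrict P.D), ∀ ζ : Fin 2 → ℝ,
      0 ≤ ∑ α, ∑ β, ∑ l, ∑ σ, Kten P w α β l σ x * ζ α * ζ β * ζ l * ζ σ ∧
      (∑ α, ∑ β, ∑ l, ∑ σ, Kten P w α β l σ x * ζ α * ζ β * ζ l * ζ σ = 0 ↔
        ζ = 0 ∨ ∀ᵐ ξ ∂(volume.restrict (Ioo (-1 : ℝ) 1)),
          ∑ α, ζ α * (w (up α)).val (x, ξ) = 0) := by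
  have hint : ∀ α β : Fin 2, ∀ᵐ x ∂(volume.restrict P.D),
      Integrable (fun ξ => (w (up α)).val (x, ξ) * (w (up β)).val (x, ξ))
        (volume.restrict (Ioo (-1 : ℝ) 1)) := fun α β => by
    have h := integrable_mul_of_memLp_two (hw (up α)).1 (hw (up β)).1
    rw [P.vol_eq_prod] at h
    exact h.prod_right_ae
  -- Integrability on the fibre is needed for three products only, so the exceptional set of `x`
  -- does not depend on `ζ`.
  filter_upwards [hint 0 0, hint 0 1, hint 1 1, ae_restrict_mem P.isOpen_D.measurableSet]
    with x h00 h01 h11 hx ζ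
  have hr := P.radius_pos' hx
  have hμ := P.μ_pos
  have hi : IntegralEq (volume.restrict (Ioo (-1 : ℝ) 1))
      (fun ξ => (∑ α, ζ α * (w (up α)).val (x, ξ)) ^ 2)
      (ζ 0 ^ 2 * Wten w 0 0 x + 2 * ζ 0 * ζ 1 * Wten w 0 1 x + ζ 1 ^ 2 * Wten w 1 1 x) := by
    refine ((((IntegralEq.of_integrable h00).const_mul (ζ 0 ^ 2)).add
      ((IntegralEq.of_integrable h01).const_mul (2 * ζ 0 * ζ 1))).add
      ((IntegralEq.of_integrable h11).const_mul (ζ 1 ^ 2))).congr fun ξ => ?_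
    simp only [Fin.sum_univ_two]
    ring
  have hW10 : Wten w 1 0 x = Wten w 0 1 x := by
    simp only [Wten, mul_comm]
  have key : ∑ α, ∑ β, ∑ l, ∑ σ, Kten P w α β l σ x * ζ α * ζ β * ζ l * ζ σ =
      2 * P.μ * x 1 ^ 3 * ((ζ 0 ^ 2 + ζ 1 ^ 2) *
        ∫ ξ in Ioo (-1 : ℝ) 1, (∑ α, ζ α * (w (up α)).val (x, ξ)) ^ 2) := by
    rw [hi.integral_eq]
    simp only [Kten, Fin.sum_univ_two, kron, hW10]
    simp
    ring
  have hnn : 0 ≤ ∫ ξ in Ioo (-1 : ℝ) 1, (∑ α, ζ α * (w (up α)).val (x, ξ)) ^ 2 :=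
    integral_nonneg fun ξ => sq_nonneg _
  rw [key]
  refine ⟨by positivity, ?_⟩
  have hpos : 2 * P.μ * x 1 ^ 3 ≠ 0 := by positivity
  rw [mul_eq_zero, or_iff_right hpos, mul_eq_zero]
  refine or_congr ?_ ?_
  · constructor
    · intro h
      have h0 : ζ 0 = 0 := by nlinarith [sq_nonneg (ζ 0), sq_nonneg (ζ 1)]
      have h1 : ζ 1 = 0 := by nlinarith [sq_nonneg (ζ 0), sq_nonneg (ζ 1)]
      funext i
      fin_cases i
      exacts [h0, h1]
    · rintro rfl
      simp
  · rw [integral_eq_zero_iff_of_nonneg (fun ξ => sq_nonneg _) hi.integrable]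
    refine eventually_congr (Eventually.of_forall fun ξ => ?_)
    simp

end Blade

/-! ### The theorem -/

theorem theorem1 (P : Blade.Passage) (M : Blade.FlowModel) (hM : M.Regular P)
    -- the class of admissible surfaces, with given boundary data
    (Θ₀ Θs : Blade.Plane → ℝ) (ℱ : Set (Blade.Plane → ℝ))
    (hℱ : ∀ Θ ∈ ℱ, ContDiff ℝ 2 Θ ∧ Blade.BoundaryConditions P Θ₀ Θs Θ)
    -- the solution of the Navier-Stokes equations as a function of the surface
    (S : (Blade.Plane → ℝ) → Blade.State)
    (hS : ∀ Θ ∈ ℱ, Blade.IsSolution P M Θ (S Θ))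
    -- the surface `Θ` minimizes the dissipation energy and can be varied within the class
    (Θ : Blade.Plane → ℝ) (hΘ : Θ ∈ ℱ)
    (hvar : ∀ η, P.IsTest η → ∀ᶠ t in 𝓝 (0 : ℝ), Θ + t • η ∈ ℱ)
    (hmin : ∀ Θ' ∈ ℱ,
      Blade.dissipation P Θ (S Θ).vel ≤ Blade.dissipation P Θ' (S Θ').vel)
    -- the Gateaux derivative of the solution at `Θ`
    (S' : (Blade.Plane → ℝ) → Blade.State)
    (hS' : ∀ η, P.IsTest η → Blade.IsGateauxDeriv P M S Θ η (S' η)) :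
    -- the two flow problems to which the equation for `Θ` is coupled
    Blade.IsSolution P M Θ (S Θ) ∧
    (∀ η, P.IsTest η → Blade.IsLinearizedSolution P M Θ η (S Θ) (S' η)) ∧
    -- the boundary conditions
    Blade.BoundaryConditions P Θ₀ Θs Θ ∧
    -- the fourth-order equation in the sense of distributions
    (∀ φ, P.IsTest φ →
      Blade.WeakEquation P Θ (S Θ).vel (Blade.Jet2.of φ) (S' φ).vel ∧
      IntegrableOn (fun x => x 1 * Blade.Phi0 P Θ (S Θ).vel (S' φ).vel x) P.D) ∧
    -- the fourth-order equation pointwise, for regular coefficients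
    ((∀ l σ, ContDiffOn ℝ 2 (Blade.Kterm P Θ (S Θ).vel l σ) P.D) →
      (∀ l σ, ContDiffOn ℝ 2 (fun x => x 1 * Blade.Phi2 P Θ (S Θ).vel l σ x) P.D) →
      (∀ l, ContDiffOn ℝ 1 (fun x => x 1 * Blade.Phi1 P Θ (S Θ).vel l x) P.D) →
      (∃ Ψ : Blade.Plane → ℝ, ContinuousOn Ψ P.D ∧
        ∀ φ, P.IsTest φ → ∫ x in P.D, x 1 * Blade.Phi0 P Θ (S Θ).vel (S' φ).vel x
          = ∫ x in P.D, x 1 * Ψ x * φ x) ∧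
      ∀ Ψ : Blade.Plane → ℝ, ContinuousOn Ψ P.D →
        (∀ φ, P.IsTest φ → ∫ x in P.D, x 1 * Blade.Phi0 P Θ (S Θ).vel (S' φ).vel x
          = ∫ x in P.D, x 1 * Ψ x * φ x) →
        ∀ x ∈ P.D, Blade.strongOperator P Θ (S Θ).vel Ψ x = 0) ∧
    -- the variational form for all `η ∈ H²₀(D)`
    ((∀ l σ, MemLp (fun x => Blade.Kterm P Θ (S Θ).vel l σ x
        + x 1 * Blade.Phi2 P Θ (S Θ).vel l σ x) 2 (volume.restrict P.D)) →
      (∀ l, MemLp (fun x => x 1 * Blade.Phi1 P Θ (S Θ).vel l x) 2 (volume.restrict P.D)) →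
      ∀ (η : Blade.Jet2) (φ : ℕ → Blade.Plane → ℝ) (w' : Blade.Field),
        Blade.H2Tendsto P φ η → P.MemV w' →
        (∀ i, Blade.JetTendsto P.vol atTop (fun n => (S' (φ n)).vel i) (w' i)) →
        Blade.WeakEquation P Θ (S Θ).vel η w') ∧
    -- ellipticity
    (∀ᵐ x ∂(volume.restrict P.D), ∀ ζ : Fin 2 → ℝ,
      0 ≤ ∑ α, ∑ β, ∑ l, ∑ σ,
        Blade.Kten P (S Θ).vel α β l σ x * ζ α * ζ β * ζ l * ζ σ ∧
      (∑ α, ∑ β, ∑ l, ∑ σ,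
          Blade.Kten P (S Θ).vel α β l σ x * ζ α * ζ β * ζ l * ζ σ = 0 ↔
        ζ = 0 ∨ ∀ᵐ ξ ∂(volume.restrict (Ioo (-1 : ℝ) 1)),
          ∑ α, ζ α * ((S Θ).vel (Blade.up α)).val (x, ξ) = 0)) := by
  have hΘ2 : ContDiff ℝ 2 Θ := (hℱ Θ hΘ).1
  have hsol : ∀ η, P.IsTest η → ∀ᶠ t in 𝓝 (0 : ℝ),
      Blade.IsSolution P M (Θ + t • η) (S (Θ + t • η)) :=
    fun η hη => (hvar η hη).mono fun t ht => hS _ ht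
  have hV : P.MemV (S Θ).vel := (hS Θ hΘ).1
  have e0 : ∀ η : Blade.Plane → ℝ, Θ + (0 : ℝ) • η = Θ := fun η => by simp
  have hweak : ∀ φ, P.IsTest φ →
      Blade.WeakEquation P Θ (S Θ).vel (Blade.Jet2.of φ) (S' φ).vel ∧
      IntegrableOn (fun x => x 1 * Blade.Phi0 P Θ (S Θ).vel (S' φ).vel x) P.D := by
    intro φ hφ
    refine ⟨?_, (Blade.fibreIntegral_Phi0 hΘ2 hV.sqIntegrable
      (hS' φ hφ).1.sqIntegrable).integrableOn⟩
    -- The global minimum over `ℱ` becomes a local one in `t`, because the varied surfaces belong to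
    -- `ℱ` only for small `t`.
    have h := Blade.weakEquation_of_isLocalMin hΘ2 hφ.contDiff_two
      ((hS' φ hφ).fieldDeriv (hsol φ hφ)) (by simpa only [e0] using hV) (by
        filter_upwards [hvar φ hφ] with t ht
        simpa only [e0] using hmin _ ht)
    simpa only [e0] using h
  refine ⟨hS Θ hΘ, fun η hη => Blade.isLinearizedSolution hM hΘ2 hη.contDiff_two (hsol η hη)
    (hS' η hη), (hℱ Θ hΘ).2, hweak, fun hK hΦ2 hΦ1 =>
      ⟨Blade.exists_density hK hΦ2 hΦ1 hweak,
        fun Ψ hΨ hΨ' => Blade.strongOperator_eq_zero hK hΦ2 hΦ1 hweak hΨ hΨ'⟩,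
    fun hK hΦ η φ w' hφ hw' hconv => ?_, Blade.ellipticity hV.sqIntegrable⟩
  have hV' : ∀ n, P.MemV (S' (φ n)).vel := fun n => (hS' (φ n) (hφ.1 n)).1
  exact Blade.weakEquation_of_tendsto hΘ2 hV.sqIntegrable hK hΦ hφ
    (fun i => ⟨⟨Eventually.of_forall fun n => (hV' n i).1, (hw' i).1, (hconv i).1⟩,
      fun j => ⟨Eventually.of_forall fun n => (hV' n i).2.1 j, (hw' i).2.1 j, (hconv i).2 j⟩⟩)
    (fun n => (hV' n).sqIntegrable) fun n => (hweak (φ n) (hφ.1 n)).1
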